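/- **Marked diagrams.** Let $r\ge 1$. A marked diagram on $2r$ vertices is a graph with $2r$ vertices, arranged in an upper row numbered $1,\dots,r$ and a lower row numbered $r+1,\dots,2r$ (both from left to right), and $r$ edges such that each vertex is incident to precisely one edge; the rightmost vertex of each horizontal edge (joining vertices of the same row) and the bottommost vertex of each vertical edge (joining vertices of different rows) may or may not be marked. **The algebra $D_r(x)$.** For marked diagrams $X,Y$ draw $Y$ below $X$ and connect the $l$-th lower vertex of $X$ with the $l$-th upper vertex of $Y$ for $1\le l\le r$, to get the marked graph $G(X,Y)$. Its connected components are paths, whose ends are upper vertices of $X$ or lower vertices of $Y$, and loops. Let $X*Y$ be the marked diagram whose upper row is that of $X$ and whose lower row is that of $Y$, two vertices being joined by an edge if and only if they are the ends of a path in $G(X,Y)$, and the bottommost (vertical edge) or rightmost (horizontal edge) end being marked if and only if the number of marked vertices along that path is odd. Let $l(X,Y)$ be the number of loops of $G(X,Y)$. For a path $p$ with $s$ marked vertices, move all the marks along $p$ to its bottommost (or, if both ends lie in the same row, rightmost) end and put $\gamma(p)=(-1)^{h}(-1)^{\lfloor s/2\rfloor}$, where $h$ is the total number of moves of a mark across a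 horizontal edge. For a loop $c$ with $s$ marked vertices put $\gamma(c)=0$ if $s$ is odd and $\gamma(c)=(-1)^{h}(-1)^{s/2}$ if $s$ is even, where $h$ is the number of moves across horizontal edges when all the marks are moved to a fixed vertex of $c$. Let $s(X,Y)=\prod_p\gamma(p)\prod_c\gamma(c)\in\{0,1,-1\}$, over all paths $p$ and all loops $c$ of $G(X,Y)$. Then $D_r(x)$ is the vector space over $\mathbb R(x)$ with basis the marked diagrams on $2r$ vertices and with the bilinear multiplication $XY=x^{l(X,Y)}\,s(X,Y)\,X*Y$ for marked diagrams $X,Y$. **Generators.** Let $\sigma_l$ ($1\le l\le r-1$) be the unmarked diagram with vertical straight edges except that the edges at the $l$-th and $(l+1)$-st vertices cross; let $J_1$ be the diagram with all edges vertical and straight whose first edge is marked and no other; let $c_{12}$ be the unmarked diagram in which the first two vertices of the upper row are joined, the first two vertices of the lower row are joined, and the other edges are vertical and straight. **Theorem.** Let $r\ge 4$. Then $D_r(x)$ is an associative algebra, with the unmarked diagram of vertical straight edges as its unit, and it is the associative unital algebra over $\mathbb R(x)$ generated by $\sigma_1,\dots,\sigma_{r-1},J_1,c_{12}$ subject to the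 relations below. That is, there is an isomorphism of unital $\mathbb R(x)$-algebras onto $D_r(x)$, from the quotient of the free associative unital algebra on symbols $\sigma_1,\dots,\sigma_{r-1},J_1,c_{12}$ by the two-sided ideal generated by these relations, which maps each symbol to the diagram of the same name. 1. (i) $\sigma_l^2=1$ for $1\le l\le r-1$; 2. (ii) $\sigma_l\sigma_m=\sigma_m\sigma_l$ for $1\le l,m\le r-1$, $|l-m|\ge 2$; 3. (iii) $(\sigma_l\sigma_{l+1})^3=1$ for $1\le l\le r-2$; 4. (iv) $J_1^2=-1$; 5. (v) $J_1\sigma_l=\sigma_lJ_1$ for $2\le l\le r-1$; 6. (vi) $(J_1\sigma_1)^4=1$; 7. (vii) $c_{12}^2=x\,c_{12}$; 8. (viii) $c_{12}\sigma_l=\sigma_lc_{12}$ for $3\le l\le r-1$; 9. (ix) $c_{12}\sigma_1=c_{12}=\sigma_1c_{12}$; 10. (x) $c_{12}\sigma_2c_{12}=c_{12}$; 11. (xi) $c_{12}J_1c_{12}=0$; 12. (xii) $(\sigma_1J_1+J_1)c_{12}=0=c_{12}(J_1+J_1\sigma_1)$; 13. (xiii) $\sigma_2\sigma_1J_1\sigma_1\sigma_2c_{12}=c_{12}\sigma_2\sigma_1J_1\sigma_1\sigma_2$;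 14. (xiv) $c_{12}\sigma_2\sigma_1\sigma_3\sigma_2c_{12}\sigma_2\sigma_3\sigma_1\sigma_2=\sigma_2\sigma_1\sigma_3\sigma_2c_{12}\sigma_2\sigma_3\sigma_1\sigma_2c_{12}$. -/

import Mathlib

namespace UnitaryBrauer

/-! ## Marked diagrams -/

/-- The `2r` vertices of a diagram: `Sum.inl i` is the `(i+1)`-st vertex (from left to right) of the
upper row, `Sum.inr i` the `(i+1)`-st vertex of the lower row. -/
abbrev Vertex (r : ℕ) : Type := Fin r ⊕ Fin r

/-- The numbering of the vertices: `1, …, r` from left to right in the upper row and `r+1, …, 2r`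
from left to right in the lower row. The rightmost end of a horizontal edge and the bottommost end
of a vertical edge is the end with the larger number. -/
def Vertex.num {r : ℕ} : Vertex r → ℕ
  | Sum.inl i => (i : ℕ) + 1
  | Sum.inr i => r + (i : ℕ) + 1

/-- Marked diagrams on `2r` vertices: `r` edges such that every vertex is incident to precisely one
of them (`partner v` is the other end of the edge at `v`), together with a set of marked vertices,
all of which are the rightmost (horizontal edges) or bottommost (vertical edges) end of their
edge. -/
@[ext]
structure MarkedDiagram (r : ℕ) where
  partner : Vertex r → Vertex r
  partner_partner : ∀ v, partner (partner v) = v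
  partner_ne : ∀ v, partner v ≠ v
  marked : Vertex r → Bool
  num_lt_of_marked : ∀ v, marked v = true → (partner v).num < v.num

namespace MarkedDiagram

variable {r : ℕ}

/-- Whether the edge at the vertex `v` is horizontal, that is, joins vertices in the same row. -/
def horizontal (X : MarkedDiagram r) (v : Vertex r) : Bool :=
  v.isLeft == (X.partner v).isLeft

/-! ## The marked graph `G(X, Y)` -/

/-- The vertices of `G(X, Y)`: `Sum.inl v` is the vertex `v` of the diagram `X` (drawn above),
`Sum.inr v` the vertex `v` of the diagram `Y` (drawn below). -/
abbrev GVertex (r : ℕ) : Type := Vertex r ⊕ Vertex r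

/-- The other end of the edge of `X` or of `Y` at a vertex of `G(X, Y)`. -/
def edge (X Y : MarkedDiagram r) : GVertex r → GVertex r :=
  Sum.map X.partner Y.partner

/-- The `l`-th lower vertex of `X` and the `l`-th upper vertex of `Y` are connected to each other;
`glue` exchanges them, and it fixes the upper vertices of `X` and the lower vertices of `Y`. -/
def glue : GVertex r → GVertex r
  | Sum.inl (Sum.inl i) => Sum.inl (Sum.inl i)
  | Sum.inl (Sum.inr i) => Sum.inr (Sum.inl i)
  | Sum.inr (Sum.inl i) => Sum.inl (Sum.inr i)
  | Sum.inr (Sum.inr i) => Sum.inr (Sum.inr i)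

/-- The marked vertices of `G(X, Y)`. -/
def gmarked (X Y : MarkedDiagram r) : GVertex r → Bool :=
  Sum.elim X.marked Y.marked

/-- Whether the edge of `X` or `Y` at a vertex of `G(X, Y)` is horizontal. -/
def ghorizontal (X Y : MarkedDiagram r) : GVertex r → Bool :=
  Sum.elim X.horizontal Y.horizontal

/-- The graph `G(X, Y)`: the edges of `X`, the edges of `Y`, and the edges connecting the `l`-th
lower vertex of `X` with the `l`-th upper vertex of `Y`. -/
def graph (X Y : MarkedDiagram r) : SimpleGraph (GVertex r) :=
  SimpleGraph.fromRel fun v w => edge X Y v = w ∨ glue v = w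

/-- The vertices of `X * Y`, as vertices of `G(X, Y)`: the upper row of `X` and the lower row
of `Y`. -/
def outer : Vertex r → GVertex r
  | Sum.inl i => Sum.inl (Sum.inl i)
  | Sum.inr i => Sum.inr (Sum.inr i)

/-- The outer vertices of `G(X, Y)` are the upper vertices of `X` and the lower vertices of `Y`;
these are the ends of the paths, all other vertices have degree two. -/
def IsOuter (w : GVertex r) : Prop := glue w = w

instance : DecidablePred (IsOuter (r := r)) := fun w => decEq (glue w) w

/-- One step along `G(X, Y)`: follow the edge of `X` or `Y` at the given vertex, and then the
connecting edge at the vertex so reached (if there is one). -/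
def step (X Y : MarkedDiagram r) (w : GVertex r) : GVertex r := glue (edge X Y w)

/-- Walk `n` steps along `G(X, Y)`, starting at `w`. The walk runs through the edges of `X` and `Y`
that join `step^[j] w` to `edge (step^[j] w)`, for `j = 0, …, n - 1`. This is the number of marked
vertices along the walk, from `w` up to `edge (step^[n-1] w)`. -/
def marks (X Y : MarkedDiagram r) (w : GVertex r) (n : ℕ) : ℕ :=
  ∑ j ∈ Finset.range n,
    ((gmarked X Y ((step X Y)^[j] w)).toNat + (gmarked X Y (edge X Y ((step X Y)^[j] w))).toNat)

/-- The number of horizontal edges among the edges number `a, …, n - 1` of the walk from `w`. -/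
def horizontals (X Y : MarkedDiagram r) (w : GVertex r) (a n : ℕ) : ℕ :=
  ∑ j ∈ Finset.Ico a n, (ghorizontal X Y ((step X Y)^[j] w)).toNat

/-- The number of horizontal moves needed to move all the marks along the walk with `n` steps from
`w` to its last vertex `edge (step^[n-1] w)`: a mark at `step^[j] w` moves across the edges
`j, …, n - 1`, a mark at `edge (step^[j] w)` across the edges `j + 1, …, n - 1`. -/
def moves (X Y : MarkedDiagram r) (w : GVertex r) (n : ℕ) : ℕ :=
  ∑ j ∈ Finset.range n,
    ((gmarked X Y ((step X Y)^[j] w)).toNat * horizontals X Y w j n +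
      (gmarked X Y (edge X Y ((step X Y)^[j] w))).toNat * horizontals X Y w (j + 1) n)

theorem edge_edge (X Y : MarkedDiagram r) (w : GVertex r) : edge X Y (edge X Y w) = w := by
  rcases w with v | v
  · simp [edge, X.partner_partner]
  · simp [edge, Y.partner_partner]

theorem edge_ne (X Y : MarkedDiagram r) (w : GVertex r) : edge X Y w ≠ w := by
  rcases w with v | v
  · simpa [edge] using X.partner_ne v
  · simpa [edge] using Y.partner_ne v

theorem glue_glue (w : GVertex r) : glue (glue w) = w := by
  rcases w with (i | i) | (i | i) <;> rfl

theorem isOuter_outer (v : Vertex r) : IsOuter (outer v) := by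
  rcases v with i | i <;> rfl

theorem step_injective (X Y : MarkedDiagram r) : Function.Injective (step X Y) :=
  ((Function.LeftInverse.injective glue_glue).comp
    (Function.LeftInverse.injective (edge_edge X Y)))

/-- The walk that starts at an outer vertex reaches an outer vertex again. -/
theorem exists_isOuter_step (X Y : MarkedDiagram r) (v : Vertex r) :
    ∃ n, 0 < n ∧ IsOuter ((step X Y)^[n] (outer v)) := by
  obtain ⟨n, hn, h⟩ := (step_injective X Y).mem_periodicPts (outer v)
  refine ⟨n, hn, ?_⟩
  rw [h.eq]
  exact isOuter_outer v

/-! ## Paths and the diagram `X * Y` -/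

/-- The number of edges of `X` and `Y` in the path of `G(X, Y)` starting at the outer
vertex `v`. -/
def pathLength (X Y : MarkedDiagram r) (v : Vertex r) : ℕ :=
  Nat.find (exists_isOuter_step X Y v)

/-- The other end of the path of `G(X, Y)` starting at the outer vertex `v`. -/
def pathEnd (X Y : MarkedDiagram r) (v : Vertex r) : Vertex r :=
  Sum.elim id id ((step X Y)^[pathLength X Y v] (outer v))

/-- The number of marked vertices along the path of `G(X, Y)` starting at the outer vertex `v`. -/
def pathMarks (X Y : MarkedDiagram r) (v : Vertex r) : ℕ :=
  marks X Y (outer v) (pathLength X Y v)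

/-- `γ(p)` for the path `p` of `G(X, Y)` starting at the outer vertex `v`; the marks are moved to
the other end of the path. -/
def pathSign (X Y : MarkedDiagram r) (v : Vertex r) : ℤ :=
  (-1) ^ moves X Y (outer v) (pathLength X Y v) * (-1) ^ (pathMarks X Y v / 2)

theorem pathLength_pos (X Y : MarkedDiagram r) (v : Vertex r) : 0 < pathLength X Y v :=
  (Nat.find_spec (exists_isOuter_step X Y v)).1

theorem outer_pathEnd (X Y : MarkedDiagram r) (v : Vertex r) :
    outer (pathEnd X Y v) = (step X Y)^[pathLength X Y v] (outer v) := by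
  have h : IsOuter ((step X Y)^[pathLength X Y v] (outer v)) :=
    (Nat.find_spec (exists_isOuter_step X Y v)).2
  unfold pathEnd
  generalize (step X Y)^[pathLength X Y v] (outer v) = w at h
  rcases w with (i | i) | (i | i)
  · rfl
  · simp [IsOuter, glue] at h
  · simp [IsOuter, glue] at h
  · rfl

theorem outer_injective : Function.Injective (outer (r := r)) := by
  rintro (i | i) (j | j) h <;> simp_all [outer]

theorem not_isOuter_step (X Y : MarkedDiagram r) (v : Vertex r) {n : ℕ} (h0 : 0 < n)
    (hn : n < pathLength X Y v) : ¬ IsOuter ((step X Y)^[n] (outer v)) := fun h =>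
  Nat.find_min (exists_isOuter_step X Y v) hn ⟨h0, h⟩

/-- Walking back along a path. -/
theorem step_pathEnd (X Y : MarkedDiagram r) (v : Vertex r) (j : ℕ)
    (hj : j < pathLength X Y v) :
    (step X Y)^[j] (outer (pathEnd X Y v)) =
      edge X Y ((step X Y)^[pathLength X Y v - 1 - j] (outer v)) := by
  induction j with
  | zero =>
    have h1 := outer_pathEnd X Y v
    have h2 := isOuter_outer (pathEnd X Y v)
    obtain ⟨m, hm⟩ : ∃ m, pathLength X Y v = m + 1 := ⟨_, (Nat.succ_pred_eq_of_pos hj).symm⟩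
    rw [hm] at h1 ⊢
    rw [Function.iterate_succ_apply'] at h1
    have h3 := congrArg glue h1
    rw [step, glue_glue] at h3
    simpa [← h3] using h2.symm
  | succ j ih =>
    rw [Function.iterate_succ_apply', ih (by omega)]
    obtain ⟨m, hm⟩ : ∃ m, pathLength X Y v - 1 - j = m + 1 :=
      ⟨pathLength X Y v - 1 - j - 1, by omega⟩
    have hm' : pathLength X Y v - 1 - (j + 1) = m := by omega
    rw [hm, hm', Function.iterate_succ_apply', step, edge_edge, step, glue_glue]

theorem isOuter_edge_iff (X Y : MarkedDiagram r) (w : GVertex r) :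
    IsOuter (edge X Y w) ↔ IsOuter (step X Y w) := by
  unfold IsOuter step
  rw [glue_glue]
  exact eq_comm

theorem pathLength_pathEnd (X Y : MarkedDiagram r) (v : Vertex r) :
    pathLength X Y (pathEnd X Y v) = pathLength X Y v ∧
      (step X Y)^[pathLength X Y v] (outer (pathEnd X Y v)) = outer v := by
  obtain ⟨m, hm⟩ : ∃ m, pathLength X Y v = m + 1 :=
    ⟨_, (Nat.succ_pred_eq_of_pos (pathLength_pos X Y v)).symm⟩
  have hend : (step X Y)^[pathLength X Y v] (outer (pathEnd X Y v)) = outer v := by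
    have h := step_pathEnd X Y v m (by omega)
    rw [hm, Function.iterate_succ_apply', h, hm, step, edge_edge, Nat.add_sub_cancel, Nat.sub_self]
    exact isOuter_outer v
  refine ⟨?_, hend⟩
  unfold pathLength
  rw [Nat.find_eq_iff]
  refine ⟨⟨pathLength_pos X Y v, ?_⟩, ?_⟩
  · have := isOuter_outer v
    rw [← hend] at this
    exact this
  · rintro n hn ⟨h0, h⟩
    change n < pathLength X Y v at hn
    rw [step_pathEnd X Y v n hn, isOuter_edge_iff, ← Function.iterate_succ_apply' (step X Y)] at h
    exact not_isOuter_step X Y v (Nat.succ_pos _) (by omega) h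

theorem pathEnd_pathEnd (X Y : MarkedDiagram r) (v : Vertex r) :
    pathEnd X Y (pathEnd X Y v) = v := by
  apply outer_injective
  rw [outer_pathEnd, (pathLength_pathEnd X Y v).1, (pathLength_pathEnd X Y v).2]

theorem pathEnd_ne (X Y : MarkedDiagram r) (v : Vertex r) : pathEnd X Y v ≠ v := by
  intro h
  have hrev := step_pathEnd X Y v
  rw [h] at hrev
  have hpos := pathLength_pos X Y v
  rcases Nat.even_or_odd' (pathLength X Y v - 1) with ⟨k, hk | hk⟩
  · have h1 := hrev k (by omega)
    rw [show pathLength X Y v - 1 - k = k by omega] at h1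
    exact edge_ne X Y _ h1.symm
  · have h1 := hrev (k + 1) (by omega)
    rw [show pathLength X Y v - 1 - (k + 1) = k by omega] at h1
    refine not_isOuter_step X Y v (n := k + 1) (by omega) (by omega) ?_
    rw [h1, isOuter_edge_iff, ← Function.iterate_succ_apply' (step X Y), h1]
    have h2 := Function.iterate_succ_apply' (step X Y) k (outer v)
    rw [h1] at h2
    exact h2.symm

/-- The marked diagram `X * Y`: its vertices are the upper vertices of `X` and the lower vertices
of `Y`, two of them being joined when they are the ends of a path in `G(X, Y)`; the rightmost or
bottommost end of an edge is marked when there is an odd number of marked vertices along that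
path. -/
def star (X Y : MarkedDiagram r) : MarkedDiagram r where
  partner := pathEnd X Y
  partner_partner := pathEnd_pathEnd X Y
  partner_ne := pathEnd_ne X Y
  marked v := decide ((pathEnd X Y v).num < v.num) && decide (Odd (pathMarks X Y (pathEnd X Y v)))
  num_lt_of_marked v h := by simp at h; exact h.1

/-! ## Loops -/

/-- The loops of `G(X, Y)`: the connected components without outer vertices. -/
noncomputable def loops (X Y : MarkedDiagram r) : Finset (graph X Y).ConnectedComponent :=
  (Set.toFinite {C | ∀ w ∈ C.supp, ¬ IsOuter w}).toFinset

/-- `γ(l)` for the loop `l` of `G(X, Y)` through `w`. The walk from `w` runs once around the loop,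
through all its vertices, and ends at `glue w`; the marks are moved to this vertex. -/
noncomputable def loopSign (X Y : MarkedDiagram r) (w : GVertex r) : ℤ :=
  let n := Function.minimalPeriod (step X Y) w
  if Odd (marks X Y w n) then 0 else (-1) ^ moves X Y w n * (-1) ^ (marks X Y w n / 2)

/-- The sign `s(X, Y)` in `{0, 1, -1}`: the product of `γ(p)` over the paths `p` and of `γ(l)` over
the loops `l` of `G(X, Y)`. In every path the marks are moved to its bottommost or rightmost end;
in every loop an arbitrary vertex has been fixed. -/
noncomputable def sign (X Y : MarkedDiagram r) : ℤ :=
  (∏ v : Vertex r with v.num < (pathEnd X Y v).num, pathSign X Y v) *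
    ∏ C ∈ loops X Y, loopSign X Y (Quot.out C)

/-! ## The generating diagrams -/

/-- The unmarked diagram without horizontal edges that joins the `i`-th upper vertex to the
`π i`-th lower vertex. -/
def ofPerm (π : Equiv.Perm (Fin r)) : MarkedDiagram r where
  partner := Sum.elim (fun i => Sum.inr (π i)) (fun i => Sum.inl (π.symm i))
  partner_partner v := by rcases v with i | i <;> simp
  partner_ne v := by rcases v with i | i <;> simp
  marked _ := false
  num_lt_of_marked v h := by simp at h

/-- The diagram `σ_l` (`1 ≤ l ≤ r - 1`): the edges are vertical and straight, except that the
`l`-th and the `(l+1)`-st one cross. -/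
def sigma (l : ℕ) (hl : 1 ≤ l ∧ l < r) : MarkedDiagram r :=
  ofPerm (Equiv.swap ⟨l - 1, by omega⟩ ⟨l, hl.2⟩)

/-- The diagram `J_1`: the edges are vertical and straight, and the first one is marked. -/
def diagJ (h : 0 < r) : MarkedDiagram r where
  partner := Sum.swap
  partner_partner := Sum.swap_swap
  partner_ne v := by rcases v with i | i <;> simp
  marked v := decide (v = Sum.inr ⟨0, h⟩)
  num_lt_of_marked v hv := by
    simp only [decide_eq_true_eq] at hv
    subst hv
    simp [Vertex.num]
    omega

/-- The diagram `c_{12}`: there is a horizontal edge between the first two vertices of either row,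
the other edges are vertical and straight, and there are no marks. -/
def diagC (h : 1 < r) : MarkedDiagram r where
  partner
    | Sum.inl i =>
        if i = ⟨0, by omega⟩ then Sum.inl ⟨1, h⟩
        else if i = ⟨1, h⟩ then Sum.inl ⟨0, by omega⟩ else Sum.inr i
    | Sum.inr i =>
        if i = ⟨0, by omega⟩ then Sum.inr ⟨1, h⟩
        else if i = ⟨1, h⟩ then Sum.inr ⟨0, by omega⟩ else Sum.inl i
  partner_partner v := by rcases v with i | i <;> grind
  partner_ne v := by rcases v with i | i <;> grind
  marked _ := false
  num_lt_of_marked v hv := by simp at hv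

end MarkedDiagram

/-! ## The algebra `D_r(x)` -/

/-- The vector space over `ℝ(x)` with a basis formed by the marked diagrams on `2r` vertices. -/
def DiagramAlgebra (r : ℕ) : Type := MarkedDiagram r →₀ RatFunc ℝ

namespace DiagramAlgebra

variable {r : ℕ}

noncomputable instance : AddCommGroup (DiagramAlgebra r) :=
  inferInstanceAs (AddCommGroup (MarkedDiagram r →₀ RatFunc ℝ))

noncomputable instance : Module (RatFunc ℝ) (DiagramAlgebra r) :=
  inferInstanceAs (Module (RatFunc ℝ) (MarkedDiagram r →₀ RatFunc ℝ))

/-- The basis of `D_r(x)` formed by the marked diagrams. -/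
noncomputable def basis (r : ℕ) :
    Module.Basis (MarkedDiagram r) (RatFunc ℝ) (DiagramAlgebra r) :=
  Module.Basis.ofRepr (LinearEquiv.refl (RatFunc ℝ) (MarkedDiagram r →₀ RatFunc ℝ))

/-- The bilinear multiplication with `X Y = x ^ l(X, Y) s(X, Y) X * Y` for any marked diagrams `X`
and `Y`, where `l(X, Y)` is the number of loops in `G(X, Y)`. -/
noncomputable def mul :
    DiagramAlgebra r →ₗ[RatFunc ℝ] DiagramAlgebra r →ₗ[RatFunc ℝ] DiagramAlgebra r :=
  (basis r).constr (RatFunc ℝ) fun X => (basis r).constr (RatFunc ℝ) fun Y =>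
    ((RatFunc.X : RatFunc ℝ) ^ (X.loops Y).card * ((X.sign Y : ℤ) : RatFunc ℝ)) • basis r (X.star Y)

noncomputable instance : Mul (DiagramAlgebra r) := ⟨fun a b => mul a b⟩

/-- The unit is the unmarked diagram with straight vertical edges. -/
noncomputable instance : One (DiagramAlgebra r) := ⟨basis r (MarkedDiagram.ofPerm 1)⟩

end DiagramAlgebra

/-! ## Generators and relations -/

/-- The generators `σ_1, …, σ_{r-1}, J_1, c_{12}`. -/
inductive Gen (r : ℕ) : Type
  | sigma (l : ℕ) (hl : 1 ≤ l ∧ l < r) : Gen r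
  | J : Gen r
  | c : Gen r

/-- The generator `σ_l` of the free algebra. -/
noncomputable def fσ {r : ℕ} (l : ℕ) (hl : 1 ≤ l ∧ l < r) : FreeAlgebra (RatFunc ℝ) (Gen r) :=
  FreeAlgebra.ι (RatFunc ℝ) (Gen.sigma l hl)

/-- The generator `J_1` of the free algebra. -/
noncomputable def fJ (r : ℕ) : FreeAlgebra (RatFunc ℝ) (Gen r) :=
  FreeAlgebra.ι (RatFunc ℝ) Gen.J

/-- The generator `c_{12}` of the free algebra. -/
noncomputable def fc (r : ℕ) : FreeAlgebra (RatFunc ℝ) (Gen r) :=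
  FreeAlgebra.ι (RatFunc ℝ) Gen.c

/-- The defining relations. -/
inductive Rel (r : ℕ) (hr : 4 ≤ r) :
    FreeAlgebra (RatFunc ℝ) (Gen r) → FreeAlgebra (RatFunc ℝ) (Gen r) → Prop
  | i (l : ℕ) (hl : 1 ≤ l ∧ l < r) : Rel r hr (fσ l hl ^ 2) 1
  | ii (l m : ℕ) (hl : 1 ≤ l ∧ l < r) (hm : 1 ≤ m ∧ m < r) (h : 2 ≤ |(l : ℤ) - (m : ℤ)|) :
      Rel r hr (fσ l hl * fσ m hm) (fσ m hm * fσ l hl)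
  | iii (l : ℕ) (hl : 1 ≤ l ∧ l < r) (hl' : 1 ≤ l + 1 ∧ l + 1 < r) :
      Rel r hr ((fσ l hl * fσ (l + 1) hl') ^ 3) 1
  | iv : Rel r hr (fJ r ^ 2) (-1)
  | v (l : ℕ) (hl : 1 ≤ l ∧ l < r) (h : 2 ≤ l) : Rel r hr (fJ r * fσ l hl) (fσ l hl * fJ r)
  | vi : Rel r hr ((fJ r * fσ 1 (by omega)) ^ 4) 1
  | vii : Rel r hr (fc r ^ 2) ((RatFunc.X : RatFunc ℝ) • fc r)
  | viii (l : ℕ) (hl : 1 ≤ l ∧ l < r) (h : 3 ≤ l) : Rel r hr (fc r * fσ l hl) (fσ l hl * fc r)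
  | ix_left : Rel r hr (fc r * fσ 1 (by omega)) (fc r)
  | ix_right : Rel r hr (fc r) (fσ 1 (by omega) * fc r)
  | x : Rel r hr (fc r * fσ 2 (by omega) * fc r) (fc r)
  | xi : Rel r hr (fc r * fJ r * fc r) 0
  | xii_left : Rel r hr ((fσ 1 (by omega) * fJ r + fJ r) * fc r) 0
  | xii_right : Rel r hr 0 (fc r * (fJ r + fJ r * fσ 1 (by omega)))
  | xiii : Rel r hr
      (fσ 2 (by omega) * fσ 1 (by omega) * fJ r * fσ 1 (by omega) * fσ 2 (by omega) * fc r)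
      (fc r * fσ 2 (by omega) * fσ 1 (by omega) * fJ r * fσ 1 (by omega) * fσ 2 (by omega))
  | xiv : Rel r hr
      (fc r * fσ 2 (by omega) * fσ 1 (by omega) * fσ 3 (by omega) * fσ 2 (by omega) *
        fc r * fσ 2 (by omega) * fσ 3 (by omega) * fσ 1 (by omega) * fσ 2 (by omega))
      (fσ 2 (by omega) * fσ 1 (by omega) * fσ 3 (by omega) * fσ 2 (by omega) *
        fc r * fσ 2 (by omega) * fσ 3 (by omega) * fσ 1 (by omega) * fσ 2 (by omega) * fc r)

/-- The associative unital `ℝ(x)`-algebra generated by `σ_1, …, σ_{r-1}, J_1, c_{12}` subject to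
the defining relations `Rel`. -/
abbrev PresentedAlgebra (r : ℕ) (hr : 4 ≤ r) : Type := RingQuot (Rel r hr)

/-- The class of an element of the free algebra in the presented algebra. -/
noncomputable def toPresented (r : ℕ) (hr : 4 ≤ r) :
    FreeAlgebra (RatFunc ℝ) (Gen r) →ₐ[RatFunc ℝ] PresentedAlgebra r hr :=
  RingQuot.mkAlgHom (RatFunc ℝ) (Rel r hr)

end UnitaryBrauer

/-! The algebra `D_r(x)` acts on a space of tensors once `x` is specialised to `4r`. Take a complex
vector space with a nondegenerate symmetric form and a skew-adjoint complex structure `J`; then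
permutations of the factors, `J` on one factor, and the contraction of two factors followed by the
insertion of the invariant tensor act on the `r`-th tensor power. After diagonalisation of `J`, a
basis of the space is given by `Color r`, and a marked diagram becomes a matrix whose entries are
indexed by the colourings of the two rows: an entry vanishes unless the edges join compatible
colours, and otherwise it is the product of the eigenvalues `i` or `-i` at the marked vertices.
In the product of two such matrices, the colours along the paths of `G(X, Y)` are forced, while
each loop contributes the sum over its colourings. Rewriting all eigenvalues on a component in terms
of the one at its end costs a sign for every move across a horizontal edge, and pairs of marks give
`-1`; this is the rule for `X * Y`, `l(X, Y)` and `s(X, Y)`, with `x = 4r` (`mat_mul_mat`).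
Different diagrams give non-proportional operators and `4r` is not a root of unity, so an identity
between two monomials (a sign or zero, times a power of `x`, times a diagram) can be checked on
operators (`Specializes.unique`). Associativity and the relations of the generators in `D_r(x)`
follow; this gives a homomorphism from the presented algebra to `D_r(x)`.

For the converse, the relations are symmetrised. By the Coxeter presentation, which is proved by
sorting permutations (`IsCoxeter.hom`), the `σ_l` define an action of the symmetric group on the
presented algebra by conjugation, and the conjugates `J i` of `J_1` and `c i j` of `c_{12}` satisfy
the relations of a `BrauerSystem`; the condition `r ≥ 4` leaves room for two disjoint pairs. In any
such system the monomials (a product of `J`s) times (a permutation) times (a product of disjoint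
contractions) times (a product of `J`s) span (`span_monomials_eq_top`), and up to sign each of them
is the normal form of a marked diagram, which depends on the diagram only (`isNormal_monomial`,
`normal_eq`). Hence the presented algebra is spanned by elements indexed by the marked diagrams. The
homomorphism maps the element of a diagram to this diagram (`lift_normal`), so it maps a spanning
family bijectively to a basis and is an isomorphism. -/

namespace UnitaryBrauer

/-! ### Colourings of diagrams and of the glued graph -/

/-- The colours of the diagonalised representation: an isotypic index (the vertices of a diagram
serve as indices, so that there are enough of them to tell all edges apart), together with
the choice of one of the eigenvalues `i` and `-i` of the complex structure `J`. -/
abbrev Color (r : ℕ) : Type := Vertex r × Bool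

namespace Color

variable {r : ℕ}

/-- The colour dual to `s`: the same index, but the conjugate eigenvalue. -/
def conj (s : Color r) : Color r := (s.1, !s.2)

/-- The eigenvalue of `J` on a vector of colour `s`. -/
noncomputable def eigen (s : Color r) : ℂ := if s.2 then Complex.I else -Complex.I

@[simp] theorem conj_conj (s : Color r) : s.conj.conj = s := by simp [conj]

theorem conj_injective : Function.Injective (conj (r := r)) :=
  Function.LeftInverse.injective conj_conj

theorem eigen_conj (s : Color r) : s.conj.eigen = -s.eigen := by
  rcases s with ⟨k, b⟩
  cases b <;> simp [conj, eigen]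

theorem eigen_sq (s : Color r) : s.eigen ^ 2 = -1 := by
  rcases s with ⟨k, b⟩
  cases b <;> simp [eigen]

theorem eigen_ne_zero (s : Color r) : s.eigen ≠ 0 := by
  intro h
  have := s.eigen_sq
  simp [h] at this

theorem eigen_pow (s : Color r) (n : ℕ) :
    s.eigen ^ n = (-1) ^ (n / 2) * s.eigen ^ (n % 2) := by
  conv_lhs => rw [← Nat.div_add_mod n 2, pow_add, pow_mul, eigen_sq]

end Color

namespace MarkedDiagram

variable {r : ℕ}

/-- Vertical edges join vertices of equal colours, horizontal edges join vertices of dual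
colours. -/
def Consistent (X : MarkedDiagram r) (c : Vertex r → Color r) : Prop :=
  ∀ v, c (X.partner v) = if X.horizontal v then (c v).conj else c v

/-- The product of the eigenvalues at the marked vertices. -/
noncomputable def weight (X : MarkedDiagram r) (c : Vertex r → Color r) : ℂ :=
  ∏ v, (c v).eigen ^ (X.marked v).toNat

open Classical in
/-- The coefficient of a colouring of the `2r` vertices in the invariant tensor given by a
diagram. -/
noncomputable def kernel (X : MarkedDiagram r) (c : Vertex r → Color r) : ℂ :=
  if X.Consistent c then X.weight c else 0

/-- The matrix by which a diagram acts on the `r`-th tensor power. -/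
noncomputable def mat (X : MarkedDiagram r) :
    Matrix (Fin r → Color r) (Fin r → Color r) ℂ :=
  fun a b => X.kernel (Sum.elim a b)

/-- Colourings of the vertices of `G(X, Y)` that are compatible with the edges of `X` and `Y`. -/
def GConsistent (X Y : MarkedDiagram r) (g : GVertex r → Color r) : Prop :=
  ∀ w, g (edge X Y w) = if ghorizontal X Y w then (g w).conj else g w

/-- The contribution of a vertex of `G(X, Y)` to the weight of a colouring. -/
noncomputable def gweight (X Y : MarkedDiagram r) (g : GVertex r → Color r) (w : GVertex r) : ℂ :=
  (g w).eigen ^ (gmarked X Y w).toNat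

/-- Whether a vertex of `G(X, Y)` lies in the lower row of its diagram. -/
def glower : GVertex r → Bool := Sum.elim Sum.isRight Sum.isRight

/-- Passing to the dual colour in lower rows. In the twisted colours every edge joins vertices of
dual colours, whether it is horizontal or vertical. -/
def twist (b : Bool) (s : Color r) : Color r := if b then s.conj else s

@[simp] theorem twist_twist (b : Bool) (s : Color r) : twist b (twist b s) = s := by
  cases b <;> simp [twist]

theorem twist_conj (b : Bool) (s : Color r) : twist b s.conj = (twist b s).conj := by
  cases b <;> simp [twist]

theorem twist_injective (b : Bool) : Function.Injective (twist (r := r) b) :=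
  Function.LeftInverse.injective (twist_twist b)

theorem twist_not (b : Bool) (s : Color r) : twist (!b) s = (twist b s).conj := by
  cases b <;> simp [twist]

theorem consistent_iff (X : MarkedDiagram r) (c : Vertex r → Color r) :
    X.Consistent c ↔
      ∀ v, twist (X.partner v).isRight (c (X.partner v)) = (twist v.isRight (c v)).conj := by
  refine forall_congr' fun v => ?_
  unfold horizontal
  generalize X.partner v = w
  rcases v with i | i <;> rcases w with j | j <;>
    simp [twist, Color.conj_injective.eq_iff]
  exact ⟨fun h => by rw [h, Color.conj_conj], fun h => by rw [← h, Color.conj_conj]⟩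

theorem gConsistent_iff (X Y : MarkedDiagram r) (g : GVertex r → Color r) :
    GConsistent X Y g ↔
      ∀ w, twist (glower (edge X Y w)) (g (edge X Y w)) = (twist (glower w) (g w)).conj := by
  have hX := consistent_iff X (g ∘ Sum.inl)
  have hY := consistent_iff Y (g ∘ Sum.inr)
  unfold GConsistent
  rw [Sum.forall (p := fun w => g (edge X Y w) = _),
    Sum.forall (p := fun w => twist (glower (edge X Y w)) _ = _)]
  exact and_congr hX hY

theorem gConsistent_iff_and (X Y : MarkedDiagram r) (g : GVertex r → Color r) :
    GConsistent X Y g ↔ X.Consistent (g ∘ Sum.inl) ∧ Y.Consistent (g ∘ Sum.inr) := by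
  unfold GConsistent
  rw [Sum.forall]
  exact Iff.rfl

theorem glower_glue {w : GVertex r} (h : ¬ IsOuter w) : glower (glue w) = !glower w := by
  rcases w with (i | i) | (i | i)
  · exact absurd rfl h
  · rfl
  · rfl
  · exact absurd rfl h

theorem isOuter_glue_iff (w : GVertex r) : IsOuter (glue w) ↔ IsOuter w := by
  rcases w with (i | i) | (i | i) <;> simp [IsOuter, glue]

theorem glower_outer (v : Vertex r) : glower (outer v) = v.isRight := by
  rcases v with i | i <;> rfl

theorem eigen_edge {X Y : MarkedDiagram r} {g : GVertex r → Color r}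
    (hg : GConsistent X Y g) (w : GVertex r) :
    (g (edge X Y w)).eigen = (-1) ^ (ghorizontal X Y w).toNat * (g w).eigen := by
  rw [hg w]
  cases ghorizontal X Y w <;> simp [Color.eigen_conj]

theorem horizontals_succ (X Y : MarkedDiagram r) (w : GVertex r) {a n : ℕ} (h : a ≤ n) :
    horizontals X Y w a (n + 1) =
      horizontals X Y w a n + (ghorizontal X Y ((step X Y)^[n] w)).toNat := by
  unfold horizontals
  rw [Finset.sum_Ico_succ_top h]

theorem marks_succ (X Y : MarkedDiagram r) (w : GVertex r) (n : ℕ) :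
    marks X Y w (n + 1) = marks X Y w n +
      ((gmarked X Y ((step X Y)^[n] w)).toNat +
        (gmarked X Y (edge X Y ((step X Y)^[n] w))).toNat) :=
  Finset.sum_range_succ _ _

theorem moves_succ (X Y : MarkedDiagram r) (w : GVertex r) (n : ℕ) :
    moves X Y w (n + 1) = moves X Y w n +
      (marks X Y w n + (gmarked X Y ((step X Y)^[n] w)).toNat) *
        (ghorizontal X Y ((step X Y)^[n] w)).toNat := by
  unfold moves
  rw [Finset.sum_range_succ, horizontals_succ X Y w le_rfl]
  have h0 : horizontals X Y w n n = 0 := by simp [horizontals]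
  have h1 : horizontals X Y w (n + 1) (n + 1) = 0 := by simp [horizontals]
  rw [h0, h1, Finset.sum_congr rfl (g := fun j =>
    ((gmarked X Y ((step X Y)^[j] w)).toNat * horizontals X Y w j n +
      (gmarked X Y (edge X Y ((step X Y)^[j] w))).toNat * horizontals X Y w (j + 1) n) +
    ((gmarked X Y ((step X Y)^[j] w)).toNat +
      (gmarked X Y (edge X Y ((step X Y)^[j] w))).toNat) *
      (ghorizontal X Y ((step X Y)^[n] w)).toNat), Finset.sum_add_distrib, ← Finset.sum_mul]
  · unfold marks
    ring
  · intro j hj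
    rw [Finset.mem_range] at hj
    rw [horizontals_succ X Y w hj.le, horizontals_succ X Y w (a := j + 1) hj]
    ring

/-- Along a walk, all eigenvalues can be expressed by the one at the end; the signs that appear are
those of the moves of marks across horizontal edges. -/
theorem prod_gweight_walk {X Y : MarkedDiagram r} {g : GVertex r → Color r}
    (hg : GConsistent X Y g) (hglue : ∀ w, g (glue w) = g w) (w : GVertex r) (n : ℕ) :
    ∏ j ∈ Finset.range n, (gweight X Y g ((step X Y)^[j] w) *
        gweight X Y g (edge X Y ((step X Y)^[j] w))) =
      (-1) ^ moves X Y w n * (g ((step X Y)^[n] w)).eigen ^ marks X Y w n := by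
  induction n with
  | zero => simp [moves, marks]
  | succ n ih =>
    have hs : (g ((step X Y)^[n + 1] w)).eigen =
        (-1) ^ (ghorizontal X Y ((step X Y)^[n] w)).toNat * (g ((step X Y)^[n] w)).eigen := by
      rw [Function.iterate_succ_apply', step, hglue, eigen_edge hg]
    have he : g (edge X Y ((step X Y)^[n] w)) = g ((step X Y)^[n + 1] w) := by
      rw [Function.iterate_succ_apply', step, hglue]
    rw [Finset.prod_range_succ, ih, gweight, gweight, he, moves_succ, marks_succ, hs]
    generalize (g ((step X Y)^[n] w)).eigen = u
    generalize (ghorizontal X Y ((step X Y)^[n] w)).toNat = h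
    generalize (gmarked X Y ((step X Y)^[n] w)).toNat = a
    generalize (gmarked X Y (edge X Y ((step X Y)^[n] w))).toNat = b
    generalize marks X Y w n = s
    have h1 : ((-1 : ℂ) ^ h) ^ 2 = 1 := by rw [← pow_mul, mul_comm, pow_mul]; simp
    have h2 : ((-1 : ℂ) ^ h) ^ (s + a) * ((-1 : ℂ) ^ h) ^ (s + a) = 1 := by
      rw [← pow_add, ← two_mul, pow_mul, h1, one_pow]
    rw [pow_add (-1 : ℂ), mul_comm (s + a) h, pow_mul (-1 : ℂ) h]
    generalize (-1 : ℂ) ^ h = e at h1 h2 ⊢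
    linear_combination (-(-1) ^ moves X Y w n * u ^ s * u ^ a * u ^ b * e ^ b) * h2

end MarkedDiagram
end UnitaryBrauer

namespace UnitaryBrauer
namespace MarkedDiagram

variable {r : ℕ}

/-! ### Paths and loops of the glued graph -/

/-- The vertex `w` of `G(X, Y)` lies on a path: it is passed by the walk that starts at one of the
ends of this path. Of the two walks along the path, precisely one passes `w` before crossing
the edge of `X` or `Y` at `w`, and this is the one meant here. -/
def OnPath (X Y : MarkedDiagram r) (w : GVertex r) : Prop :=
  ∃ v, ∃ j < pathLength X Y v, (step X Y)^[j] (outer v) = w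

theorem iterate_step_outer_inj (X Y : MarkedDiagram r) {v v' : Vertex r} {i j : ℕ}
    (hi : i < pathLength X Y v) (hj : j < pathLength X Y v')
    (h : (step X Y)^[i] (outer v) = (step X Y)^[j] (outer v')) : v = v' ∧ i = j := by
  wlog hij : i ≤ j generalizing v v' i j
  · have := this hj hi h.symm (by omega)
    exact ⟨this.1.symm, this.2.symm⟩
  obtain ⟨k, rfl⟩ := Nat.exists_eq_add_of_le hij
  rw [Function.iterate_add_apply] at h
  have h' := (step_injective X Y).iterate i h
  rcases Nat.eq_zero_or_pos k with rfl | hk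
  · exact ⟨outer_injective h', rfl⟩
  · exact absurd (h' ▸ isOuter_outer v) (not_isOuter_step X Y v' hk (by omega))

theorem onPath_outer (X Y : MarkedDiagram r) (v : Vertex r) : OnPath X Y (outer v) :=
  ⟨v, 0, pathLength_pos X Y v, rfl⟩

theorem edge_iterate_step_outer (X Y : MarkedDiagram r) {v : Vertex r} {j : ℕ}
    (hj : j < pathLength X Y v) :
    edge X Y ((step X Y)^[j] (outer v)) =
      (step X Y)^[pathLength X Y v - 1 - j] (outer (pathEnd X Y v)) := by
  rw [step_pathEnd X Y v _ (by omega)]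
  congr 2
  rw [show pathLength X Y v - 1 - (pathLength X Y v - 1 - j) = j by omega]

theorem OnPath.edge {X Y : MarkedDiagram r} {w : GVertex r} (h : OnPath X Y w) :
    OnPath X Y (X.edge Y w) := by
  obtain ⟨v, j, hj, rfl⟩ := h
  refine ⟨pathEnd X Y v, pathLength X Y v - 1 - j, ?_, (edge_iterate_step_outer X Y hj).symm⟩
  rw [(pathLength_pathEnd X Y v).1]
  omega

theorem OnPath.step {X Y : MarkedDiagram r} {w : GVertex r} (h : OnPath X Y w) :
    OnPath X Y (X.step Y w) := by
  obtain ⟨v, j, hj, rfl⟩ := h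
  rw [← Function.iterate_succ_apply' (X.step Y)]
  rcases Nat.lt_or_ge (j + 1) (pathLength X Y v) with h1 | h1
  · exact ⟨v, j + 1, h1, rfl⟩
  · have : pathLength X Y v = j + 1 := by omega
    rw [Nat.succ_eq_add_one, ← this, ← outer_pathEnd]
    exact onPath_outer X Y _

theorem onPath_edge_iff (X Y : MarkedDiagram r) (w : GVertex r) :
    OnPath X Y (X.edge Y w) ↔ OnPath X Y w :=
  ⟨fun h => by simpa [edge_edge] using h.edge, OnPath.edge⟩

theorem glue_eq_step_edge (X Y : MarkedDiagram r) (w : GVertex r) :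
    glue w = X.step Y (X.edge Y w) := by
  rw [step, edge_edge]

theorem onPath_glue_iff (X Y : MarkedDiagram r) (w : GVertex r) :
    OnPath X Y (glue w) ↔ OnPath X Y w := by
  have key : ∀ u, OnPath X Y u → OnPath X Y (glue u) := fun u h => by
    rw [glue_eq_step_edge X Y]
    exact h.edge.step
  exact ⟨fun h => by simpa [glue_glue] using key _ h, key w⟩

theorem reachable_edge (X Y : MarkedDiagram r) (w : GVertex r) :
    (graph X Y).Reachable w (edge X Y w) :=
  SimpleGraph.Adj.reachable
    ((SimpleGraph.fromRel_adj _ _ _).2 ⟨(edge_ne X Y w).symm, Or.inl (Or.inl rfl)⟩)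

theorem reachable_glue (X Y : MarkedDiagram r) (w : GVertex r) :
    (graph X Y).Reachable w (glue w) := by
  by_cases h : w = glue w
  · rw [← h]
  · exact SimpleGraph.Adj.reachable
      ((SimpleGraph.fromRel_adj _ _ _).2 ⟨h, Or.inl (Or.inr rfl)⟩)

theorem reachable_step (X Y : MarkedDiagram r) (w : GVertex r) :
    (graph X Y).Reachable w (step X Y w) :=
  (reachable_edge X Y w).trans (reachable_glue X Y _)

theorem reachable_iterate_step (X Y : MarkedDiagram r) (w : GVertex r) (j : ℕ) :
    (graph X Y).Reachable w ((step X Y)^[j] w) := by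
  induction j with
  | zero => exact SimpleGraph.Reachable.refl _
  | succ j ih =>
    rw [Function.iterate_succ_apply']
    exact ih.trans (reachable_step X Y _)

/-- A set of vertices that is closed under crossing edges contains the whole component of each of
its elements. -/
theorem closed_of_reachable {X Y : MarkedDiagram r} {P : GVertex r → Prop}
    (he : ∀ w, P w → P (edge X Y w)) (hg : ∀ w, P w → P (glue w)) {w u : GVertex r}
    (h : (graph X Y).Reachable w u) (hw : P w) : P u := by
  obtain ⟨p⟩ := h
  induction p with
  | nil => exact hw
  | cons hadj _ ih =>
    refine ih ?_
    rw [graph, SimpleGraph.fromRel_adj] at hadj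
    rcases hadj.2 with (rfl | rfl) | (rfl | rfl)
    · exact he _ hw
    · exact hg _ hw
    · simpa [edge_edge] using he _ hw
    · simpa [glue_glue] using hg _ hw

theorem mem_loops (X Y : MarkedDiagram r) (C : (graph X Y).ConnectedComponent) :
    C ∈ loops X Y ↔ ∀ w, (graph X Y).connectedComponentMk w = C → ¬ IsOuter w := by
  simp [loops, SimpleGraph.ConnectedComponent.mem_supp_iff]

theorem exists_outer_of_isOuter {w : GVertex r} (h : IsOuter w) : ∃ v, outer v = w := by
  rcases w with (i | i) | (i | i)
  · exact ⟨Sum.inl i, rfl⟩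
  · simp [IsOuter, glue] at h
  · simp [IsOuter, glue] at h
  · exact ⟨Sum.inr i, rfl⟩

theorem mk_mem_loops_iff (X Y : MarkedDiagram r) (w : GVertex r) :
    (graph X Y).connectedComponentMk w ∈ loops X Y ↔ ¬ OnPath X Y w := by
  rw [mem_loops]
  constructor
  · rintro h ⟨v, j, _, rfl⟩
    refine h (outer v) ?_ (isOuter_outer v)
    exact SimpleGraph.ConnectedComponent.eq.2 (reachable_iterate_step X Y _ j)
  · intro h u hu hout
    obtain ⟨v, rfl⟩ := exists_outer_of_isOuter hout
    exact h (closed_of_reachable (P := OnPath X Y) (fun w => OnPath.edge)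
      (fun w => (onPath_glue_iff X Y w).2) (SimpleGraph.ConnectedComponent.exact hu)
      (onPath_outer X Y v))

theorem not_isOuter_of_not_onPath {X Y : MarkedDiagram r} {w : GVertex r}
    (h : ¬ OnPath X Y w) : ¬ IsOuter w := fun ho => by
  obtain ⟨v, rfl⟩ := exists_outer_of_isOuter ho
  exact h (onPath_outer X Y v)

theorem iterate_step_edge (X Y : MarkedDiagram r) (w : GVertex r) (m : ℕ) :
    (step X Y)^[m] (edge X Y ((step X Y)^[m] w)) = edge X Y w := by
  induction m with
  | zero => rfl
  | succ m ih =>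
    rw [Function.iterate_succ_apply, Function.iterate_succ_apply' (step X Y) m w, step, edge_edge,
      step, glue_glue, ih]

theorem not_onPath_iterate {X Y : MarkedDiagram r} {w : GVertex r} (h : ¬ OnPath X Y w) (j : ℕ) :
    ¬ OnPath X Y ((step X Y)^[j] w) := by
  rw [← mk_mem_loops_iff] at h ⊢
  rwa [← SimpleGraph.ConnectedComponent.eq.2 (reachable_iterate_step X Y w j)]

/-- The walk along a loop never runs through the loop in the opposite direction. -/
theorem iterate_step_ne_edge {X Y : MarkedDiagram r} {w : GVertex r} (h : ¬ OnPath X Y w)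
    (k : ℕ) : (step X Y)^[k] w ≠ edge X Y w := by
  intro hk
  rcases Nat.even_or_odd' k with ⟨m, rfl | rfl⟩
  · rw [← iterate_step_edge X Y w m, two_mul, Function.iterate_add_apply] at hk
    exact edge_ne X Y _ ((step_injective X Y).iterate m hk).symm
  · rw [← iterate_step_edge X Y w m, show 2 * m + 1 = m + (m + 1) by ring,
      Function.iterate_add_apply, Function.iterate_succ_apply'] at hk
    have h1 := (step_injective X Y).iterate m hk
    exact not_isOuter_of_not_onPath (fun hp => not_onPath_iterate h m (by
      rwa [onPath_edge_iff] at hp)) h1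

theorem minimalPeriod_step_pos (X Y : MarkedDiagram r) (w : GVertex r) :
    0 < Function.minimalPeriod (step X Y) w :=
  Function.minimalPeriod_pos_of_mem_periodicPts ((step_injective X Y).mem_periodicPts w)

/-- The vertices that the walk starting at `w` passes before crossing the edge of `X` or `Y`
at them. -/
def Ahead (X Y : MarkedDiagram r) (w u : GVertex r) : Prop := ∃ j, (step X Y)^[j] w = u

theorem ahead_step_iff (X Y : MarkedDiagram r) (w u : GVertex r) :
    Ahead X Y w (step X Y u) ↔ Ahead X Y w u := by
  constructor
  · rintro ⟨j, hj⟩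
    refine ⟨j + (Function.minimalPeriod (step X Y) w - 1), step_injective X Y ?_⟩
    have hp := minimalPeriod_step_pos X Y w
    rw [← Function.iterate_succ_apply' (step X Y), Nat.succ_eq_add_one,
      show j + (Function.minimalPeriod (step X Y) w - 1) + 1 =
        j + Function.minimalPeriod (step X Y) w by omega, Function.iterate_add_apply,
      Function.iterate_minimalPeriod, hj]
  · rintro ⟨j, rfl⟩
    exact ⟨j + 1, Function.iterate_succ_apply' _ _ _⟩

theorem ahead_iterate_iff (X Y : MarkedDiagram r) (w u : GVertex r) (j : ℕ) :
    Ahead X Y w ((step X Y)^[j] u) ↔ Ahead X Y w u := by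
  induction j with
  | zero => rfl
  | succ j ih => rw [Function.iterate_succ_apply', ahead_step_iff, ih]

theorem not_ahead_edge {X Y : MarkedDiagram r} {w u : GVertex r} (h : ¬ OnPath X Y w)
    (hu : Ahead X Y w u) : ¬ Ahead X Y w (edge X Y u) := by
  obtain ⟨i, rfl⟩ := hu
  intro hj
  -- `edge (step^i w)` is mapped by `step^i` to `edge w`
  rw [← ahead_iterate_iff X Y w _ i, iterate_step_edge] at hj
  obtain ⟨k, hk⟩ := hj
  exact iterate_step_ne_edge h k hk

/-- The walk from `w` crosses every edge of `X` and `Y` in the component of `w`: it passes one end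
of this edge. -/
theorem ahead_or_ahead_edge {X Y : MarkedDiagram r} {w u : GVertex r}
    (h : (graph X Y).Reachable w u) : Ahead X Y w u ∨ Ahead X Y w (edge X Y u) := by
  refine closed_of_reachable (P := fun u => Ahead X Y w u ∨ Ahead X Y w (edge X Y u))
    ?_ ?_ h (Or.inl ⟨0, rfl⟩)
  · rintro u (hu | hu)
    · exact Or.inr (by rwa [edge_edge])
    · exact Or.inl hu
  · rintro u (hu | hu)
    · refine Or.inr ((ahead_step_iff X Y w _).1 ?_)
      rwa [step, edge_edge, glue_glue]
    · refine Or.inl ?_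
      rwa [glue_eq_step_edge X Y, ahead_step_iff]

theorem ahead_edge_iff {X Y : MarkedDiagram r} {w u : GVertex r} (hw : ¬ OnPath X Y w)
    (h : (graph X Y).Reachable w u) : Ahead X Y w (edge X Y u) ↔ ¬ Ahead X Y w u := by
  constructor
  · intro h1 h2
    exact not_ahead_edge hw h2 h1
  · intro h1
    exact (ahead_or_ahead_edge h).resolve_left h1

theorem ahead_glue_iff {X Y : MarkedDiagram r} {w u : GVertex r} (hw : ¬ OnPath X Y w)
    (h : (graph X Y).Reachable w u) : Ahead X Y w (glue u) ↔ ¬ Ahead X Y w u := by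
  rw [glue_eq_step_edge X Y, ahead_step_iff, ahead_edge_iff hw h]

open Classical in
/-- A product over the vertices of a loop, as a product over the edges of the walk around it. -/
theorem prod_loop {M : Type*} [CommMonoid M] {X Y : MarkedDiagram r} {w : GVertex r}
    (hw : ¬ OnPath X Y w) (f : GVertex r → M) :
    ∏ u with (graph X Y).connectedComponentMk u = (graph X Y).connectedComponentMk w, f u =
      ∏ j ∈ Finset.range (Function.minimalPeriod (step X Y) w),
        (f ((step X Y)^[j] w) * f (edge X Y ((step X Y)^[j] w))) := by
  have hinj : Set.InjOn (fun j => (step X Y)^[j] w)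
      (Finset.range (Function.minimalPeriod (step X Y) w)) := by
    intro i hi j hj hij
    simp only [Finset.coe_range, Set.mem_Iio] at hi hj
    exact Function.iterate_injOn_Iio_minimalPeriod hi hj hij
  have himg : ∀ u, Ahead X Y w u ↔
      u ∈ (Finset.range (Function.minimalPeriod (step X Y) w)).image
        (fun j => (step X Y)^[j] w) := by
    intro u
    simp only [Finset.mem_image, Finset.mem_range]
    constructor
    · rintro ⟨j, rfl⟩
      refine ⟨j % Function.minimalPeriod (step X Y) w,
        Nat.mod_lt _ (minimalPeriod_step_pos X Y w), ?_⟩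
      exact Function.iterate_mod_minimalPeriod_eq
    · rintro ⟨j, _, rfl⟩
      exact ⟨j, rfl⟩
  rw [Finset.prod_mul_distrib, ← Finset.prod_filter_mul_prod_filter_not _ (Ahead X Y w)]
  congr 1
  · rw [← Finset.prod_image hinj]
    refine Finset.prod_congr ?_ fun _ _ => rfl
    ext u
    rw [← himg, Finset.mem_filter, Finset.mem_filter]
    refine ⟨fun h => h.2, fun h => ⟨⟨Finset.mem_univ _, ?_⟩, h⟩⟩
    obtain ⟨j, rfl⟩ := h
    exact (SimpleGraph.ConnectedComponent.eq.2 (reachable_iterate_step X Y w j)).symm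
  · rw [← Finset.prod_image (f := fun u => f (edge X Y u)) hinj]
    refine Finset.prod_bij' (fun u _ => edge X Y u) (fun u _ => edge X Y u) ?_ ?_ ?_ ?_ ?_
    · intro u hu
      rw [Finset.mem_filter, Finset.mem_filter] at hu
      rw [← himg, ahead_edge_iff hw (SimpleGraph.ConnectedComponent.exact hu.1.2.symm)]
      exact hu.2
    · intro u hu
      rw [← himg] at hu
      rw [Finset.mem_filter, Finset.mem_filter]
      refine ⟨⟨Finset.mem_univ _, ?_⟩, not_ahead_edge hw hu⟩
      obtain ⟨j, rfl⟩ := hu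
      exact (SimpleGraph.ConnectedComponent.eq.2
        ((reachable_iterate_step X Y w j).trans (reachable_edge X Y _))).symm
    · intro u _
      exact edge_edge X Y u
    · intro u _
      exact edge_edge X Y u
    · intro u _
      simp only [edge_edge]

theorem num_injective : Function.Injective (Vertex.num (r := r)) := by
  rintro (i | i) (j | j) h <;> simp [Vertex.num] at h ⊢ <;> omega

open Classical in
/-- A product over the vertices that lie on paths, as a product over the edges of all paths. -/
theorem prod_onPath {M : Type*} [CommMonoid M] (X Y : MarkedDiagram r) (f : GVertex r → M) :
    ∏ u with OnPath X Y u, f u =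
      ∏ v : Vertex r with v.num < (pathEnd X Y v).num, ∏ j ∈ Finset.range (pathLength X Y v),
        (f ((step X Y)^[j] (outer v)) * f (edge X Y ((step X Y)^[j] (outer v)))) := by
  have h1 : ∏ u with OnPath X Y u, f u =
      ∏ v : Vertex r, ∏ j ∈ Finset.range (pathLength X Y v), f ((step X Y)^[j] (outer v)) := by
    rw [Finset.prod_sigma']
    symm
    refine Finset.prod_bij (fun p _ => (step X Y)^[p.2] (outer p.1)) ?_ ?_ ?_ ?_
    · rintro ⟨v, j⟩ h
      simp only [Finset.mem_sigma, Finset.mem_range, Finset.mem_univ, true_and] at h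
      exact Finset.mem_filter.2 ⟨Finset.mem_univ _, v, j, h, rfl⟩
    · rintro ⟨v, j⟩ h ⟨v', j'⟩ h' heq
      simp only [Finset.mem_sigma, Finset.mem_range, Finset.mem_univ, true_and] at h h'
      obtain ⟨rfl, rfl⟩ := iterate_step_outer_inj X Y h h' heq
      rfl
    · intro u hu
      obtain ⟨v, j, hj, rfl⟩ := (Finset.mem_filter.1 hu).2
      exact ⟨⟨v, j⟩, by simpa using hj, rfl⟩
    · intro _ _
      rfl
  rw [h1, ← Finset.prod_filter_mul_prod_filter_not _ (fun v => v.num < (pathEnd X Y v).num)]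
  simp only [Finset.prod_mul_distrib]
  congr 1
  have hnum : ∀ v : Vertex r, v.num ≠ (pathEnd X Y v).num := fun v h =>
    pathEnd_ne X Y v (num_injective h.symm)
  refine Finset.prod_bij' (fun v _ => pathEnd X Y v) (fun v _ => pathEnd X Y v) ?_ ?_ ?_ ?_ ?_
  · intro v hv
    have h2 := hnum v
    simp only [Finset.mem_filter, Finset.mem_univ, true_and, pathEnd_pathEnd] at hv ⊢
    omega
  · intro v hv
    simp only [Finset.mem_filter, Finset.mem_univ, true_and, pathEnd_pathEnd] at hv ⊢
    omega
  · intro v _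
    exact pathEnd_pathEnd X Y v
  · intro v _
    exact pathEnd_pathEnd X Y v
  · intro v _
    rw [(pathLength_pathEnd X Y v).1, ← Finset.prod_range_reflect]
    refine Finset.prod_congr rfl fun j hj => ?_
    rw [edge_iterate_step_outer X Y (by
      rw [(pathLength_pathEnd X Y v).1]; simpa using hj), pathEnd_pathEnd,
      (pathLength_pathEnd X Y v).1]

end MarkedDiagram
end UnitaryBrauer

namespace UnitaryBrauer
namespace MarkedDiagram

variable {r : ℕ}

/-! ### The product of the matrices of two diagrams -/

/-- The colouring of `G(X, Y)` with colours `a` in the upper row, `b` in the lower row, and `m` at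
the vertices that are connected with each other. -/
def full (a m b : Fin r → Color r) : GVertex r → Color r :=
  Sum.elim (Sum.elim a m) (Sum.elim m b)

theorem full_glue (a m b : Fin r → Color r) (w : GVertex r) :
    full a m b (glue w) = full a m b w := by
  rcases w with (i | i) | (i | i) <;> rfl

theorem full_outer (a m b : Fin r → Color r) (v : Vertex r) :
    full a m b (outer v) = Sum.elim a b v := by
  rcases v with i | i <;> rfl

theorem twist_glue {g : GVertex r → Color r} (hglue : ∀ w, g (glue w) = g w) {w : GVertex r}
    (hw : ¬ IsOuter w) :
    twist (glower (glue w)) (g (glue w)) = (twist (glower w) (g w)).conj := by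
  rw [hglue, glower_glue hw, twist_not]

/-- The fixed vertex of a component of `G(X, Y)`. -/
noncomputable def base {X Y : MarkedDiagram r} (C : (graph X Y).ConnectedComponent) : GVertex r :=
  Quot.out C

section Consistent

variable {X Y : MarkedDiagram r} {g : GVertex r → Color r}

theorem twist_path (hg : GConsistent X Y g) (hglue : ∀ w, g (glue w) = g w) (v : Vertex r) (j : ℕ)
    (hj : j < pathLength X Y v) :
    twist (glower ((step X Y)^[j] (outer v))) (g ((step X Y)^[j] (outer v))) =
      twist v.isRight (g (outer v)) := by
  induction j with
  | zero => rw [← glower_outer]; rfl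
  | succ j ih =>
    have h1 := not_isOuter_step X Y v (Nat.succ_pos j) hj
    rw [Function.iterate_succ_apply', ← isOuter_edge_iff] at h1
    rw [Function.iterate_succ_apply', step, twist_glue hglue h1, (gConsistent_iff X Y g).1 hg,
      Color.conj_conj, ih (by omega)]

theorem outer_pathEnd_eq_edge (X Y : MarkedDiagram r) (v : Vertex r) :
    outer (pathEnd X Y v) = edge X Y ((step X Y)^[pathLength X Y v - 1] (outer v)) := by
  have := pathLength_pos X Y v
  rw [edge_iterate_step_outer X Y (by omega), Nat.sub_self]
  rfl

theorem star_consistent (hg : GConsistent X Y g) (hglue : ∀ w, g (glue w) = g w) :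
    (star X Y).Consistent (g ∘ outer) := by
  rw [consistent_iff]
  intro v
  have := pathLength_pos X Y v
  change twist (pathEnd X Y v).isRight (g (outer (pathEnd X Y v))) = _
  rw [← glower_outer, outer_pathEnd_eq_edge, (gConsistent_iff X Y g).1 hg,
    twist_path hg hglue v _ (by omega)]
  rfl

/-- The sum of the contributions of a loop over its colourings has the following terms, one for
each colour `s` (in the twisted sense) of a fixed vertex `w`. -/
noncomputable def loopWeight (X Y : MarkedDiagram r) (w : GVertex r) (s : Color r) : ℂ :=
  (-1) ^ moves X Y w (Function.minimalPeriod (step X Y) w) *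
    (twist (glower w) s).eigen ^ marks X Y w (Function.minimalPeriod (step X Y) w)

theorem sum_loopWeight (X Y : MarkedDiagram r) (w : GVertex r) :
    ∑ s, loopWeight X Y w s = (4 * r : ℕ) * (loopSign X Y w : ℤ) := by
  unfold loopWeight loopSign
  simp only
  generalize Function.minimalPeriod (step X Y) w = n
  generalize marks X Y w n = s
  generalize moves X Y w n = h
  rw [← Finset.mul_sum]
  have h1 : ∑ x : Color r, (twist (glower w) x).eigen ^ s = ∑ x : Color r, x.eigen ^ s :=
    (Function.Involutive.bijective (twist_twist (r := r) (glower w))).sum_comp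
      (fun x : Color r => x.eigen ^ s)
  rw [h1, Fintype.sum_prod_type]
  have h2 : ∀ k : Vertex r, ∑ b : Bool, Color.eigen ((k, b) : Color r) ^ s =
      if Odd s then 0 else 2 * (-1 : ℂ) ^ (s / 2) := by
    intro k
    rw [Fintype.sum_bool]
    simp only [Color.eigen, if_true, if_false, Bool.false_eq_true]
    split_ifs with hs
    · rw [hs.neg_pow]
      ring
    · rw [Nat.not_odd_iff_even] at hs
      rw [hs.neg_pow]
      obtain ⟨t, rfl⟩ := hs
      rw [← two_mul t, pow_mul, Complex.I_sq, Nat.mul_div_cancel_left _ two_pos]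
      ring
  simp only [h2, Finset.sum_const, Finset.card_univ, Fintype.card_sum, Fintype.card_fin,
    nsmul_eq_mul]
  split_ifs with hs
  · simp
  · push_cast
    ring

open Classical in
/-- The eigenvalues at the marked vertices of a path combine to the sign of the path and to the
eigenvalue at the end at which the path of `X * Y` is marked. -/
theorem prod_gweight_onPath (hg : GConsistent X Y g) (hglue : ∀ w, g (glue w) = g w) :
    ∏ w with OnPath X Y w, gweight X Y g w =
      ((∏ v : Vertex r with v.num < (pathEnd X Y v).num, pathSign X Y v : ℤ) : ℂ) *
        (star X Y).weight (g ∘ outer) := by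
  have hw : (star X Y).weight (g ∘ outer) =
      ∏ v : Vertex r with v.num < (pathEnd X Y v).num,
        (g (outer (pathEnd X Y v))).eigen ^ (pathMarks X Y v % 2) := by
    unfold weight
    rw [← Finset.prod_filter_mul_prod_filter_not _ (fun v => v.num < (pathEnd X Y v).num)]
    rw [Finset.prod_eq_one, one_mul]
    · symm
      refine Finset.prod_bij' (fun v _ => pathEnd X Y v) (fun v _ => pathEnd X Y v) ?_ ?_ ?_ ?_ ?_
      · intro v hv
        simp only [Finset.mem_filter, Finset.mem_univ, true_and, pathEnd_pathEnd] at hv ⊢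
        omega
      · intro v hv
        have : v.num ≠ (pathEnd X Y v).num := fun h => pathEnd_ne X Y v (num_injective h.symm)
        simp only [Finset.mem_filter, Finset.mem_univ, true_and, pathEnd_pathEnd] at hv ⊢
        omega
      · intro v _
        exact pathEnd_pathEnd X Y v
      · intro v _
        exact pathEnd_pathEnd X Y v
      · intro v hv
        simp only [Finset.mem_filter, Finset.mem_univ, true_and] at hv
        simp only [star, pathEnd_pathEnd, hv, Function.comp_apply, decide_true, Bool.true_and]
        congr 1
        by_cases ho : Odd (pathMarks X Y v)
        · simp [ho, Nat.odd_iff.1 ho]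
        · simp [ho, Nat.not_odd_iff.1 ho]
    · intro v hv
      simp only [Finset.mem_filter, Finset.mem_univ, true_and] at hv
      have : ¬ (pathEnd X Y v).num < v.num := by omega
      simp [star, this]
  rw [hw, prod_onPath, Int.cast_prod, ← Finset.prod_mul_distrib]
  refine Finset.prod_congr rfl fun v _ => ?_
  rw [prod_gweight_walk hg hglue, ← outer_pathEnd]
  change _ * _ ^ pathMarks X Y v = _
  rw [Color.eigen_pow, pathSign]
  push_cast
  ring

theorem mk_base (C : (graph X Y).ConnectedComponent) :
    (graph X Y).connectedComponentMk (base C) = C :=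
  Quot.out_eq C

theorem not_onPath_base {C : (graph X Y).ConnectedComponent} (hC : C ∈ loops X Y) :
    ¬ OnPath X Y (base C) := by
  rw [← mk_mem_loops_iff, mk_base]
  exact hC

open Classical in
theorem prod_gweight_not_onPath (hg : GConsistent X Y g) (hglue : ∀ w, g (glue w) = g w) :
    ∏ w with ¬ OnPath X Y w, gweight X Y g w =
      ∏ C : {C // C ∈ loops X Y},
        loopWeight X Y (base C.1) (twist (glower (base C.1)) (g (base C.1))) := by
  rw [← Finset.prod_fiberwise_of_maps_to (t := loops X Y)
    (g := (graph X Y).connectedComponentMk) (by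
      intro w hw
      rw [mk_mem_loops_iff]
      exact (Finset.mem_filter.1 hw).2)]
  rw [← Finset.prod_coe_sort (loops X Y)]
  refine Finset.prod_congr rfl ?_
  rintro ⟨C, hC⟩ -
  have hw := not_onPath_base hC
  rw [Finset.filter_filter]
  have hf : ∀ w, (¬ OnPath X Y w ∧ (graph X Y).connectedComponentMk w = C) ↔
      (graph X Y).connectedComponentMk w =
        (graph X Y).connectedComponentMk (base C) := by
    intro w
    rw [mk_base]
    refine ⟨fun h => h.2, fun h => ⟨?_, h⟩⟩
    rw [← mk_mem_loops_iff, h]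
    exact hC
  simp only [hf]
  rw [prod_loop hw, prod_gweight_walk hg hglue, Function.iterate_minimalPeriod, loopWeight,
    twist_twist]

open Classical in
theorem prod_gweight (hg : GConsistent X Y g) (hglue : ∀ w, g (glue w) = g w) :
    ∏ w, gweight X Y g w =
      ((∏ v : Vertex r with v.num < (pathEnd X Y v).num, pathSign X Y v : ℤ) : ℂ) *
        (star X Y).weight (g ∘ outer) *
      ∏ C : {C // C ∈ loops X Y},
        loopWeight X Y (base C.1) (twist (glower (base C.1)) (g (base C.1))) := by
  rw [← prod_gweight_onPath hg hglue, ← prod_gweight_not_onPath hg hglue,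
    Finset.prod_filter_mul_prod_filter_not]

end Consistent

/-! ### Extending colourings to the inner vertices -/

open Classical in
/-- The twisted colouring of `G(X, Y)` with twisted colours `c` at the outer vertices and twisted
colours `f` at the base points of the loops. -/
noncomputable def extend (X Y : MarkedDiagram r) (c : Vertex r → Color r)
    (f : {C // C ∈ loops X Y} → Color r) (w : GVertex r) : Color r :=
  if h : OnPath X Y w then c h.choose
  else twist (decide (¬ Ahead X Y (base ((graph X Y).connectedComponentMk w)) w))
    (f ⟨(graph X Y).connectedComponentMk w, (mk_mem_loops_iff X Y w).2 h⟩)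

section Extend

variable {X Y : MarkedDiagram r} {c : Vertex r → Color r} {f : {C // C ∈ loops X Y} → Color r}

theorem extend_path {v : Vertex r} {j : ℕ} (hj : j < pathLength X Y v) :
    extend X Y c f ((step X Y)^[j] (outer v)) = c v := by
  have h : OnPath X Y ((step X Y)^[j] (outer v)) := ⟨v, j, hj, rfl⟩
  rw [extend, dif_pos h]
  obtain ⟨i, hi, hij⟩ := h.choose_spec
  rw [(iterate_step_outer_inj X Y hi hj hij).1]

theorem extend_outer (v : Vertex r) : extend X Y c f (outer v) = c v :=
  extend_path (j := 0) (pathLength_pos X Y v)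

theorem extend_base (C : {C // C ∈ loops X Y}) : extend X Y c f (base C.1) = f C := by
  have h := not_onPath_base C.2
  rw [extend, dif_neg h]
  have h1 : Ahead X Y (base ((graph X Y).connectedComponentMk (base C.1)))
      (base C.1) := by
    rw [mk_base]
    exact ⟨0, rfl⟩
  have h2 : (⟨(graph X Y).connectedComponentMk (base C.1),
      (mk_mem_loops_iff X Y _).2 h⟩ : {C // C ∈ loops X Y}) = C := Subtype.ext (mk_base C.1)
  simp [h1, h2, twist]

theorem extend_of_not_ahead_iff {w u : GVertex r} (hw : ¬ OnPath X Y w)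
    (h : (graph X Y).Reachable w u)
    (hu : Ahead X Y (base ((graph X Y).connectedComponentMk w)) u ↔
      ¬ Ahead X Y (base ((graph X Y).connectedComponentMk w)) w) :
    extend X Y c f u = (extend X Y c f w).conj := by
  have hc : (graph X Y).connectedComponentMk u = (graph X Y).connectedComponentMk w :=
    (SimpleGraph.ConnectedComponent.eq.2 h).symm
  have hu' : ¬ OnPath X Y u := by rwa [← mk_mem_loops_iff, hc, mk_mem_loops_iff]
  rw [extend, extend, dif_neg hw, dif_neg hu']
  have hu2 : Ahead X Y (base ((graph X Y).connectedComponentMk u)) u ↔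
      ¬ Ahead X Y (base ((graph X Y).connectedComponentMk w)) w := by rw [hc, hu]
  have hf : ∀ (C C' : (graph X Y).ConnectedComponent) (hC : C ∈ loops X Y) (hC' : C' ∈ loops X Y),
      C = C' → f ⟨C, hC⟩ = f ⟨C', hC'⟩ := by
    rintro C _ hC hC' rfl
    rfl
  rw [hf _ _ _ ((mk_mem_loops_iff X Y w).2 hw) hc]
  by_cases h3 : Ahead X Y (base ((graph X Y).connectedComponentMk w)) w
  · have h4 := mt hu2.1 (not_not.2 h3)
    simp [h3, h4, twist]
  · have h4 := hu2.2 h3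
    simp [h3, h4, twist]

theorem extend_edge (hc : ∀ v, c (pathEnd X Y v) = (c v).conj) (w : GVertex r) :
    extend X Y c f (edge X Y w) = (extend X Y c f w).conj := by
  by_cases hw : OnPath X Y w
  · obtain ⟨v, j, hj, rfl⟩ := hw
    rw [edge_iterate_step_outer X Y hj, extend_path hj, extend_path, hc]
    rw [(pathLength_pathEnd X Y v).1]
    omega
  · refine extend_of_not_ahead_iff hw (reachable_edge X Y w) (ahead_edge_iff ?_ ?_)
    · rw [← mk_mem_loops_iff, mk_base, mk_mem_loops_iff]
      exact hw
    · exact SimpleGraph.ConnectedComponent.exact (mk_base _)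

theorem extend_glue (hc : ∀ v, c (pathEnd X Y v) = (c v).conj) {w : GVertex r}
    (hout : ¬ IsOuter w) : extend X Y c f (glue w) = (extend X Y c f w).conj := by
  by_cases hw : OnPath X Y w
  · rw [← extend_edge hc]
    obtain ⟨v, j, hj, hjw⟩ := hw.edge
    have h1 : glue w = (step X Y)^[j + 1] (outer v) := by
      rw [Function.iterate_succ_apply', hjw, glue_eq_step_edge X Y]
    rcases Nat.lt_or_ge (j + 1) (pathLength X Y v) with h2 | h2
    · rw [h1, extend_path h2, ← hjw, extend_path hj]
    · have h3 : j + 1 = pathLength X Y v := by omega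
      rw [h3, ← outer_pathEnd] at h1
      refine absurd ?_ hout
      rw [← isOuter_glue_iff, h1]
      exact isOuter_outer _
  · refine extend_of_not_ahead_iff hw (reachable_glue X Y w) (ahead_glue_iff ?_ ?_)
    · rw [← mk_mem_loops_iff, mk_base, mk_mem_loops_iff]
      exact hw
    · exact SimpleGraph.ConnectedComponent.exact (mk_base _)

/-- A compatible colouring is determined by its values at the outer vertices and at the base points
of the loops. -/
theorem eq_extend {g : GVertex r → Color r} (hg : GConsistent X Y g)
    (hglue : ∀ w, g (glue w) = g w) (w : GVertex r) :
    twist (glower w) (g w) = extend X Y (fun v => twist v.isRight (g (outer v)))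
      (fun C => twist (glower (base C.1)) (g (base C.1))) w := by
  have hc : ∀ v, (fun v => twist v.isRight (g (outer v))) (pathEnd X Y v) =
      ((fun v => twist v.isRight (g (outer v))) v).conj :=
    (consistent_iff _ _).1 (star_consistent hg hglue)
  by_cases hw : OnPath X Y w
  · obtain ⟨v, j, hj, rfl⟩ := hw
    rw [extend_path hj, twist_path hg hglue v j hj]
  · refine closed_of_reachable (P := fun w => ¬ OnPath X Y w ∧ twist (glower w) (g w) =
      extend X Y (fun v => twist v.isRight (g (outer v)))
        (fun C => twist (glower (base C.1)) (g (base C.1))) w) ?_ ?_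
        (SimpleGraph.ConnectedComponent.exact (mk_base ((graph X Y).connectedComponentMk w)))
        ⟨?_, ?_⟩ |>.2
    · rintro u ⟨hu, h⟩
      refine ⟨by rwa [onPath_edge_iff], ?_⟩
      rw [extend_edge hc, (gConsistent_iff X Y g).1 hg, h]
    · rintro u ⟨hu, h⟩
      have hu' := not_isOuter_of_not_onPath hu
      refine ⟨by rwa [onPath_glue_iff], ?_⟩
      rw [extend_glue hc hu', twist_glue hglue hu', h]
    · rw [← mk_mem_loops_iff, mk_base, mk_mem_loops_iff]
      exact hw
    · rw [extend_base ⟨(graph X Y).connectedComponentMk w, (mk_mem_loops_iff X Y w).2 hw⟩]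

end Extend

theorem kernel_mul_kernel (X Y : MarkedDiagram r) (a m b : Fin r → Color r) :
    X.kernel (Sum.elim a m) * Y.kernel (Sum.elim m b) =
      open Classical in if GConsistent X Y (full a m b) then ∏ w, gweight X Y (full a m b) w
        else 0 := by
  classical
  have h := gConsistent_iff_and X Y (full a m b)
  have h1 : full a m b ∘ Sum.inl = Sum.elim a m := rfl
  have h2 : full a m b ∘ Sum.inr = Sum.elim m b := rfl
  rw [h1, h2] at h
  unfold kernel
  by_cases hX : X.Consistent (Sum.elim a m) <;> by_cases hY : Y.Consistent (Sum.elim m b) <;>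
    simp only [h, hX, hY, and_true, and_false, if_true, if_false, mul_zero, zero_mul, and_self]
  rw [Fintype.prod_sum_type]
  rfl

open Classical in
/-- The colourings of `G(X, Y)` with given outer colours correspond to the colourings of the
loops. -/
theorem sum_consistent (X Y : MarkedDiagram r) (a b : Fin r → Color r)
    (h : (star X Y).Consistent (Sum.elim a b))
    (F : ({C // C ∈ loops X Y} → Color r) → ℂ) :
    ∑ m with GConsistent X Y (full a m b),
      F (fun C => twist (glower (base C.1)) (full a m b (base C.1))) = ∑ f, F f := by
  have hfo : ∀ m v, full a m b (outer v) = Sum.elim a b v := fun m v => full_outer a m b v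
  refine Finset.sum_bij (fun m _ => fun C => twist (glower (base C.1))
    (full a m b (base C.1))) ?_ ?_ ?_ ?_
  · intro _ _
    exact Finset.mem_univ _
  · intro m hm m' hm' heq
    have e1 := eq_extend (Finset.mem_filter.1 hm).2 (full_glue a m b)
    have e2 := eq_extend (Finset.mem_filter.1 hm').2 (full_glue a m' b)
    funext i
    have h1 := e1 (Sum.inl (Sum.inr i))
    simp only [hfo] at h1 e2
    rw [heq, ← e2] at h1
    exact twist_injective _ h1
  · intro f _
    set c : Vertex r → Color r := fun v => twist v.isRight (Sum.elim a b v) with hcdef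
    have hc : ∀ v, c (pathEnd X Y v) = (c v).conj := (consistent_iff _ _).1 h
    set g : GVertex r → Color r := fun w => twist (glower w) (extend X Y c f w) with hgdef
    have hgl : ∀ w, g (glue w) = g w := by
      intro w
      by_cases hw : IsOuter w
      · rw [hw]
      · simp only [hgdef]
        rw [glower_glue hw, extend_glue hc hw, twist_not, twist_conj, Color.conj_conj]
    have hgo : ∀ v, g (outer v) = Sum.elim a b v := by
      intro v
      simp only [hgdef, extend_outer, hcdef, glower_outer, twist_twist]
    have hfull : full a (fun i => g (Sum.inl (Sum.inr i))) b = g := by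
      funext w
      rcases w with (i | i) | (i | i)
      · exact (hgo (Sum.inl i)).symm
      · rfl
      · exact hgl (Sum.inr (Sum.inl i))
      · exact (hgo (Sum.inr i)).symm
    have hcons : GConsistent X Y g := by
      rw [gConsistent_iff]
      intro w
      simp only [hgdef, twist_twist]
      exact extend_edge hc w
    refine ⟨fun i => g (Sum.inl (Sum.inr i)), ?_, ?_⟩
    · rw [Finset.mem_filter, hfull]
      exact ⟨Finset.mem_univ _, hcons⟩
    · funext C
      simp only [hfull]
      simp only [hgdef, twist_twist, extend_base]
  · intro _ _
    rfl

/-- The matrices of diagrams multiply as the diagrams do, with `4r` in place of `x`: the colours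
along the paths are determined by those of the outer vertices, and every loop contributes the sum
over all its colourings. -/
theorem mat_mul_mat (X Y : MarkedDiagram r) :
    X.mat * Y.mat = (((4 * r : ℕ) : ℂ) ^ (loops X Y).card * (sign X Y : ℤ)) • (star X Y).mat := by
  classical
  ext a b
  rw [Matrix.mul_apply, Matrix.smul_apply]
  simp only [mat, kernel_mul_kernel]
  rw [← Finset.sum_filter]
  by_cases h : (star X Y).Consistent (Sum.elim a b)
  · rw [Finset.sum_congr rfl (g := fun m =>
      (((∏ v : Vertex r with v.num < (pathEnd X Y v).num, pathSign X Y v : ℤ) : ℂ) *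
        (star X Y).weight (Sum.elim a b)) *
      ∏ C : {C // C ∈ loops X Y},
        loopWeight X Y (base C.1) (twist (glower (base C.1)) (full a m b (base C.1))))]
    · rw [← Finset.mul_sum, sum_consistent X Y a b h (fun f => ∏ C : {C // C ∈ loops X Y},
        loopWeight X Y (base C.1) (f C))]
      have h1 : ∑ f : {C // C ∈ loops X Y} → Color r, ∏ C : {C // C ∈ loops X Y},
          loopWeight X Y (base C.1) (f C) =
          ∏ C : {C // C ∈ loops X Y}, ∑ s, loopWeight X Y (base C.1) s := by
        rw [Finset.prod_univ_sum, Fintype.piFinset_univ]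
      rw [h1]
      simp only [sum_loopWeight]
      have hsign : sign X Y = (∏ v : Vertex r with v.num < (pathEnd X Y v).num, pathSign X Y v) *
        ∏ C ∈ loops X Y, loopSign X Y (base C) := rfl
      rw [Finset.prod_mul_distrib, Finset.prod_const, Finset.card_univ, Fintype.card_coe,
        kernel, if_pos h, smul_eq_mul, hsign, ← Finset.prod_coe_sort (loops X Y)]
      push_cast
      ring
    · intro m hm
      have h2 : full a m b ∘ outer = Sum.elim a b := funext (full_outer a m b)
      rw [prod_gweight (Finset.mem_filter.1 hm).2 (full_glue a m b), h2]
  · rw [kernel, if_neg h, smul_zero, Finset.sum_eq_zero]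
    intro m hm
    refine absurd ?_ h
    have h2 : full a m b ∘ outer = Sum.elim a b := funext (full_outer a m b)
    rw [← h2]
    exact star_consistent (Finset.mem_filter.1 hm).2 (full_glue a m b)

end MarkedDiagram
end UnitaryBrauer

namespace UnitaryBrauer
namespace MarkedDiagram

variable {r : ℕ}

/-! ### Faithfulness of the representation, associativity of `D_r(x)` -/

/-- The endomorphism of the functions on `Fin r → Color r` by which a diagram acts. -/
noncomputable def op (X : MarkedDiagram r) : Module.End ℂ ((Fin r → Color r) → ℂ) :=
  Matrix.toLin' X.mat

theorem op_mul_op (X Y : MarkedDiagram r) :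
    X.op * Y.op = (((4 * r : ℕ) : ℂ) ^ (loops X Y).card * (sign X Y : ℤ)) • (star X Y).op := by
  rw [op, op, op, ← map_smul, ← mat_mul_mat, Matrix.toLin'_mul]
  rfl

/-- The end with the smaller number of the edge at `v`. -/
def firstEnd (X : MarkedDiagram r) (v : Vertex r) : Vertex r :=
  if v.num < (X.partner v).num then v else X.partner v

theorem num_partner_ne (X : MarkedDiagram r) (v : Vertex r) : v.num ≠ (X.partner v).num :=
  fun h => X.partner_ne v (num_injective h.symm)

theorem firstEnd_partner (X : MarkedDiagram r) (v : Vertex r) :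
    X.firstEnd (X.partner v) = X.firstEnd v := by
  have := X.num_partner_ne v
  unfold firstEnd
  rw [X.partner_partner]
  split_ifs <;> first | rfl | omega

theorem eq_or_eq_partner_of_firstEnd {X : MarkedDiagram r} {u v : Vertex r}
    (h : X.firstEnd u = X.firstEnd v) : u = v ∨ u = X.partner v := by
  unfold firstEnd at h
  split_ifs at h
  · exact Or.inl h
  · exact Or.inr h
  · exact Or.inr (by rw [← h, X.partner_partner])
  · exact Or.inl (by rw [← X.partner_partner u, h, X.partner_partner])

/-- A colouring that is compatible with `X` and has different colours at different edges. -/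
def separating (X : MarkedDiagram r) (v : Vertex r) : Color r :=
  twist v.isRight (X.firstEnd v, decide (v.num < (X.partner v).num))

theorem consistent_separating (X : MarkedDiagram r) : X.Consistent X.separating := by
  rw [consistent_iff]
  intro v
  have := X.num_partner_ne v
  simp only [separating, twist_twist, firstEnd_partner, X.partner_partner, Color.conj]
  congr 1
  rw [← decide_not]
  congr 1
  rw [eq_iff_iff]
  omega

theorem weight_ne_zero (X : MarkedDiagram r) (c : Vertex r → Color r) : X.weight c ≠ 0 :=
  Finset.prod_ne_zero_iff.2 fun v _ => pow_ne_zero _ (c v).eigen_ne_zero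

theorem kernel_ne_zero_iff (X : MarkedDiagram r) (c : Vertex r → Color r) :
    X.kernel c ≠ 0 ↔ X.Consistent c := by
  unfold kernel
  split_ifs with h <;> simp [h, weight_ne_zero]

theorem partner_eq_of_consistent_separating {X Y : MarkedDiagram r}
    (h : Y.Consistent X.separating) : Y.partner = X.partner := by
  funext v
  rw [consistent_iff] at h
  have h1 := congrArg Prod.fst (h v)
  simp only [separating, twist_twist, Color.conj] at h1
  exact (eq_or_eq_partner_of_firstEnd h1).resolve_left (Y.partner_ne v)

/-- Exchange the eigenvalues on the edge at `v`. -/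
def flipEdge (X : MarkedDiagram r) (v : Vertex r) (c : Vertex r → Color r) (u : Vertex r) :
    Color r :=
  if u = v ∨ u = X.partner v then (c u).conj else c u

theorem consistent_flipEdge {X : MarkedDiagram r} {c : Vertex r → Color r} (h : X.Consistent c)
    (v : Vertex r) : X.Consistent (X.flipEdge v c) := by
  rw [consistent_iff] at h ⊢
  intro u
  have h1 : (X.partner u = v ∨ X.partner u = X.partner v) ↔ (u = v ∨ u = X.partner v) := by
    have h2 : X.partner u = v ↔ u = X.partner v :=
      ⟨fun h => by rw [← h, X.partner_partner], fun h => by rw [h, X.partner_partner]⟩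
    rw [h2, (Function.LeftInverse.injective X.partner_partner).eq_iff, or_comm]
  unfold flipEdge
  simp only [h1]
  split_ifs
  · rw [twist_conj, twist_conj, h u]
  · exact h u

theorem weight_flipEdge (X : MarkedDiagram r) (c : Vertex r → Color r) {Y : MarkedDiagram r}
    (hY : Y.partner = X.partner) {v : Vertex r} (hv : (X.partner v).num < v.num) :
    Y.weight (X.flipEdge v c) = (-1) ^ (Y.marked v).toNat * Y.weight c := by
  have h1 : ∀ u, (X.flipEdge v c u).eigen ^ (Y.marked u).toNat =
      (if u = v then (-1) ^ (Y.marked v).toNat else 1) * (c u).eigen ^ (Y.marked u).toNat := by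
    intro u
    unfold flipEdge
    rcases eq_or_ne u v with rfl | hu
    · simp [Color.eigen_conj, neg_pow (c u).eigen]
    rcases eq_or_ne u (X.partner v) with rfl | hu'
    · have hm : Y.marked (X.partner v) = false := by
        by_contra hm
        rw [Bool.not_eq_false] at hm
        have := Y.num_lt_of_marked _ hm
        rw [hY, X.partner_partner] at this
        omega
      simp [hm, hu]
    · simp [hu, hu']
  unfold weight
  simp only [h1]
  rw [Finset.prod_mul_distrib, Finset.prod_ite_eq' Finset.univ v, if_pos (Finset.mem_univ _)]

/-- The endomorphisms of different diagrams are not proportional. The colourings on which the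
kernel does not vanish reveal the edges, and exchanging the eigenvalues on one edge reveals whether
it is marked. -/
theorem eq_of_op_eq_smul {X Y : MarkedDiagram r} {t : ℂ} (h : X.op = t • Y.op) :
    X = Y := by
  rw [op, op, ← map_smul, (Matrix.toLin' (R := ℂ)).injective.eq_iff] at h
  have hk : ∀ c, X.kernel c = t * Y.kernel c := by
    intro c
    have := congrFun (congrFun h (c ∘ Sum.inl)) (c ∘ Sum.inr)
    simpa [mat, Matrix.smul_apply] using this
  have hc : ∀ c, X.Consistent c → Y.Consistent c := by
    intro c hX
    rw [← kernel_ne_zero_iff] at hX ⊢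
    rw [hk] at hX
    exact right_ne_zero_of_mul hX
  have hp : Y.partner = X.partner :=
    partner_eq_of_consistent_separating (hc _ X.consistent_separating)
  have hw : ∀ c, X.Consistent c → X.weight c = t * Y.weight c := by
    intro c hX
    have := hk c
    rwa [kernel, kernel, if_pos hX, if_pos (hc c hX)] at this
  refine MarkedDiagram.ext hp.symm ?_
  funext v
  by_contra hne
  have hv : (X.partner v).num < v.num := by
    rcases hXm : X.marked v with _ | _
    · rcases hYm : Y.marked v with _ | _
      · exact absurd (hXm.trans hYm.symm) hne
      · rw [← hp]
        exact Y.num_lt_of_marked v hYm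
    · exact X.num_lt_of_marked v hXm
  have h1 := hw _ X.consistent_separating
  have h2 := hw _ (consistent_flipEdge X.consistent_separating v)
  rw [weight_flipEdge X _ rfl hv, weight_flipEdge X _ hp hv, mul_left_comm, ← h1] at h2
  have h3 := mul_right_cancel₀ (X.weight_ne_zero _) h2
  revert hne h3
  cases X.marked v <;> cases Y.marked v <;> norm_num

theorem op_ne_zero (X : MarkedDiagram r) : X.op ≠ 0 := by
  intro h
  rw [op, LinearEquiv.map_eq_zero_iff] at h
  have h1 := (X.kernel_ne_zero_iff _).2 X.consistent_separating
  refine h1 ?_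
  have := congrFun (congrFun h (X.separating ∘ Sum.inl)) (X.separating ∘ Sum.inr)
  simpa [mat] using this

theorem abs_sign_le (X Y : MarkedDiagram r) : |sign X Y| ≤ 1 := by
  have h1 : ∀ n : ℕ, |(-1 : ℤ) ^ n| = 1 := fun n => by rw [abs_pow, abs_neg, abs_one, one_pow]
  unfold sign
  rw [abs_mul, Finset.abs_prod, Finset.abs_prod]
  refine mul_le_one₀ (Finset.prod_le_one (fun _ _ => abs_nonneg _) fun v _ => ?_)
    (Finset.prod_nonneg fun _ _ => abs_nonneg _)
    (Finset.prod_le_one (fun _ _ => abs_nonneg _) fun C _ => ?_)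
  · rw [pathSign, abs_mul, h1, h1, one_mul]
  · unfold loopSign
    dsimp only
    split_ifs
    · simp
    · rw [abs_mul, h1, h1, one_mul]

end MarkedDiagram

namespace DiagramAlgebra

open MarkedDiagram

variable {r : ℕ}

theorem mul_def (a b : DiagramAlgebra r) : a * b = mul a b := rfl

theorem one_def : (1 : DiagramAlgebra r) = basis r (ofPerm 1) := rfl

theorem basis_mul_basis (X Y : MarkedDiagram r) :
    mul (basis r X) (basis r Y) =
      ((RatFunc.X : RatFunc ℝ) ^ (X.loops Y).card * ((X.sign Y : ℤ) : RatFunc ℝ)) •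
        basis r (X.star Y) := by
  rw [mul, Module.Basis.constr_basis, Module.Basis.constr_basis]

/-- The element `d` of `D_r(x)` is, up to a sign or zero, a power of `x` times a diagram, and it
becomes the endomorphism `m` when `x` is specialised to `4r`. -/
def Specializes (d : DiagramAlgebra r) (m : Module.End ℂ ((Fin r → Color r) → ℂ)) : Prop :=
  ∃ (n : ℕ) (e : ℤ) (X : MarkedDiagram r), |e| ≤ 1 ∧
    d = ((RatFunc.X : RatFunc ℝ) ^ n * (e : RatFunc ℝ)) • basis r X ∧
    m = (((4 * r : ℕ) : ℂ) ^ n * (e : ℂ)) • X.op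

theorem specializes_basis (X : MarkedDiagram r) : Specializes (basis r X) X.op :=
  ⟨0, 1, X, by simp, by simp, by simp⟩

theorem specializes_zero : Specializes (0 : DiagramAlgebra r) 0 :=
  ⟨0, 0, ofPerm 1, by simp, by simp, by simp⟩

theorem Specializes.mul {d d' : DiagramAlgebra r}
    {m m' : Module.End ℂ ((Fin r → Color r) → ℂ)} (h : Specializes d m)
    (h' : Specializes d' m') : Specializes (DiagramAlgebra.mul d d') (m * m') := by
  obtain ⟨n, e, X, he, rfl, rfl⟩ := h
  obtain ⟨n', e', X', he', rfl, rfl⟩ := h'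
  refine ⟨n + n' + (loops X X').card, e * e' * sign X X', star X X', ?_, ?_, ?_⟩
  · rw [abs_mul, abs_mul]
    exact mul_le_one₀ (mul_le_one₀ he (abs_nonneg _) he') (abs_nonneg _) (abs_sign_le X X')
  · rw [map_smul, map_smul, LinearMap.smul_apply, basis_mul_basis, smul_smul, smul_smul]
    congr 1
    push_cast
    ring
  · rw [smul_mul_assoc, mul_smul_comm, op_mul_op, smul_smul, smul_smul]
    congr 1
    push_cast
    ring

theorem Specializes.neg {d : DiagramAlgebra r} {m : Module.End ℂ ((Fin r → Color r) → ℂ)}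
    (h : Specializes d m) : Specializes (-d) (-m) := by
  obtain ⟨n, e, X, he, rfl, rfl⟩ := h
  refine ⟨n, -e, X, by rwa [abs_neg], ?_, ?_⟩
  · rw [← neg_smul, Int.cast_neg, mul_neg]
  · rw [Int.cast_neg, mul_neg]
    exact (neg_smul _ _).symm

theorem Specializes.smul {d : DiagramAlgebra r} {m : Module.End ℂ ((Fin r → Color r) → ℂ)}
    (h : Specializes d m) :
    Specializes ((RatFunc.X : RatFunc ℝ) • d) (((4 * r : ℕ) : ℂ) • m) := by
  obtain ⟨n, e, X, he, rfl, rfl⟩ := h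
  refine ⟨n + 1, e, X, he, ?_, ?_⟩
  · rw [smul_smul]
    congr 1
    ring
  · rw [smul_smul]
    congr 1
    ring

/-- Identities between monomials can be checked after specialising `x`, since `4r` is not a root of
unity. -/
theorem Specializes.unique [NeZero r] {d d' : DiagramAlgebra r}
    {m : Module.End ℂ ((Fin r → Color r) → ℂ)} (h : Specializes d m) (h' : Specializes d' m) :
    d = d' := by
  obtain ⟨n, e, X, he, rfl, rfl⟩ := h
  obtain ⟨n', e', X', he', rfl, h⟩ := h'
  have hr := NeZero.pos r
  have hd : ((4 * r : ℕ) : ℂ) ≠ 0 := by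
    rw [Nat.cast_ne_zero]
    omega
  rcases eq_or_ne e 0 with rfl | h0
  · have h1 : e' = 0 := by
      by_contra h1
      rw [Int.cast_zero, mul_zero, zero_smul] at h
      exact smul_ne_zero (mul_ne_zero (pow_ne_zero _ hd) (Int.cast_ne_zero.2 h1)) X'.op_ne_zero
        h.symm
    subst h1
    simp
  · have hs : ((4 * r : ℕ) : ℂ) ^ n * (e : ℂ) ≠ 0 :=
      mul_ne_zero (pow_ne_zero _ hd) (Int.cast_ne_zero.2 h0)
    have hX : X.op = ((((4 * r : ℕ) : ℂ) ^ n * (e : ℂ))⁻¹ *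
        (((4 * r : ℕ) : ℂ) ^ n' * (e' : ℂ))) • X'.op := by
      rw [← smul_smul, ← h, smul_smul, inv_mul_cancel₀ hs, one_smul]
    have ht : (((4 * r : ℕ) : ℂ) ^ n * (e : ℂ))⁻¹ * (((4 * r : ℕ) : ℂ) ^ n' * (e' : ℂ)) ≠ 0 := by
      intro ht
      rw [ht, zero_smul] at hX
      exact X.op_ne_zero hX
    obtain rfl := eq_of_op_eq_smul hX
    have h2 : ((4 * r : ℕ) : ℂ) ^ n * (e : ℂ) = ((4 * r : ℕ) : ℂ) ^ n' * (e' : ℂ) :=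
      smul_left_injective ℂ X.op_ne_zero h
    have h3 : ((4 * r : ℕ) : ℤ) ^ n * e = ((4 * r : ℕ) : ℤ) ^ n' * e' := by exact_mod_cast h2
    have habs : |e| = 1 := le_antisymm he (Int.one_le_abs h0)
    have h0' : e' ≠ 0 := by
      rintro rfl
      simp at ht
    have habs' : |e'| = 1 := le_antisymm he' (Int.one_le_abs h0')
    have h4 := congrArg abs h3
    rw [abs_mul, abs_mul, habs, habs', abs_pow, abs_pow, mul_one, mul_one, Nat.abs_cast] at h4
    have h5 : n = n' := Nat.pow_right_injective (a := 4 * r) (by omega) (by exact_mod_cast h4)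
    subst h5
    have h6 : e = e' := by
      refine mul_left_cancel₀ (pow_ne_zero n ?_) h3
      rw [Nat.cast_ne_zero]
      omega
    rw [h6]

theorem op_ofPerm_apply (π : Equiv.Perm (Fin r)) (f : (Fin r → Color r) → ℂ)
    (a : Fin r → Color r) : (ofPerm π).op f a = f (a ∘ π.symm) := by
  rw [op, Matrix.toLin'_apply, Matrix.mulVec, dotProduct]
  have hc : ∀ b, (ofPerm π).Consistent (Sum.elim a b) ↔ b = a ∘ π.symm := by
    intro b
    unfold Consistent
    rw [Sum.forall]
    simp only [ofPerm, horizontal, Sum.elim_inl, Sum.elim_inr, Sum.isLeft_inl, Sum.isLeft_inr]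
    constructor
    · rintro ⟨_, h⟩
      funext i
      exact (h i).symm
    · rintro rfl
      simp
  have hm : ∀ b, (ofPerm π).mat a b = if b = a ∘ π.symm then 1 else 0 := by
    intro b
    rw [mat, kernel]
    simp only [hc]
    split_ifs
    · simp [weight, ofPerm]
    · rfl
  simp [hm]

theorem specializes_one : Specializes (1 : DiagramAlgebra r) 1 := by
  have : (ofPerm (1 : Equiv.Perm (Fin r))).op = 1 := by
    ext f a
    rw [LinearMap.comp_apply, LinearMap.comp_apply, op_ofPerm_apply]
    rfl
  rw [one_def, ← this]
  exact specializes_basis _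

theorem mul_assoc' [NeZero r] (a b c : DiagramAlgebra r) : a * b * c = a * (b * c) := by
  have h3 : ∀ X Y, mul (mul (basis r X) (basis r Y)) = mul (basis r X) ∘ₗ mul (basis r Y) := by
    intro X Y
    refine (basis r).ext fun Z => ?_
    refine Specializes.unique
      (((specializes_basis X).mul (specializes_basis Y)).mul (specializes_basis Z)) ?_
    rw [mul_assoc]
    exact (specializes_basis X).mul ((specializes_basis Y).mul (specializes_basis Z))
  have h2 : ∀ X, mul ∘ₗ mul (basis r X) =
      LinearMap.llcomp (RatFunc ℝ) _ _ _ (mul (basis r X)) ∘ₗ mul := by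
    intro X
    exact (basis r).ext fun Y => h3 X Y
  have h1 : mul.flip c ∘ₗ mul.flip b = mul.flip (b * c) := by
    refine (basis r).ext fun X => ?_
    exact congrArg (fun f => f c) (congrArg (fun f => f b) (h2 X))
  exact congrArg (fun f => f a) h1

theorem one_mul' [NeZero r] (a : DiagramAlgebra r) : 1 * a = a := by
  have h : mul (1 : DiagramAlgebra r) = LinearMap.id := by
    refine (basis r).ext fun X => ?_
    refine (specializes_one.mul (specializes_basis X)).unique ?_
    rw [one_mul]
    exact specializes_basis X
  exact congrArg (fun f => f a) h

theorem mul_one' [NeZero r] (a : DiagramAlgebra r) : a * 1 = a := by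
  have h : mul.flip (1 : DiagramAlgebra r) = LinearMap.id := by
    refine (basis r).ext fun X => ?_
    refine ((specializes_basis X).mul specializes_one).unique ?_
    rw [mul_one]
    exact specializes_basis X
  exact congrArg (fun f => f a) h

noncomputable instance [NeZero r] : Ring (DiagramAlgebra r) :=
  { (inferInstance : AddCommGroup (DiagramAlgebra r)), (inferInstance : Mul (DiagramAlgebra r)),
    (inferInstance : One (DiagramAlgebra r)) with
    left_distrib := fun a b c => map_add (mul a) b c
    right_distrib := fun a b c => by rw [mul_def, map_add]; rfl
    zero_mul := fun a => by rw [mul_def, map_zero]; rfl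
    mul_zero := fun a => map_zero (mul a)
    mul_assoc := mul_assoc'
    one_mul := one_mul'
    mul_one := mul_one' }

noncomputable instance [NeZero r] : Algebra (RatFunc ℝ) (DiagramAlgebra r) :=
  Algebra.ofModule (fun t a b => by rw [mul_def, map_smul]; rfl)
    (fun t a b => map_smul (mul a) t b)

theorem Specializes.mul' [NeZero r] {d d' : DiagramAlgebra r}
    {m m' : Module.End ℂ ((Fin r → Color r) → ℂ)} (h : Specializes d m)
    (h' : Specializes d' m') : Specializes (d * d') (m * m') :=
  h.mul h'

end DiagramAlgebra
end UnitaryBrauer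

namespace UnitaryBrauer

/-! ### The Coxeter presentation of the symmetric group -/

section Coxeter

open Equiv

/-- Every permutation of `Fin r` is a product of transpositions of neighbours. -/
theorem perm_induction {r : ℕ} {p : Perm (Fin r) → Prop} (one : p 1)
    (mul : ∀ (l : ℕ) (h : l + 1 < r) (π : Perm (Fin r)), p π →
      p (swap ⟨l, by omega⟩ ⟨l + 1, h⟩ * π)) (π : Perm (Fin r)) : p π := by
  cases r with
  | zero => rwa [Subsingleton.elim π 1]
  | succ n =>
    have hπ : π ∈ Submonoid.closure (Set.range fun i : Fin n => swap i.castSucc i.succ) := by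
      rw [Perm.mclosure_swap_castSucc_succ]
      trivial
    induction hπ using Submonoid.closure_induction_left with
    | one => exact one
    | mul_left x hx y _ ih =>
      obtain ⟨i, rfl⟩ := hx
      exact mul i (by omega) y ih

/-- The elements `s 0, …, s (r - 2)` satisfy the relations between the transpositions of
neighbours. -/
structure IsCoxeter {G : Type*} [Monoid G] (r : ℕ) (s : ℕ → G) : Prop where
  sq : ∀ l, l + 1 < r → s l * s l = 1
  comm : ∀ l m, l + 2 ≤ m → m + 1 < r → s l * s m = s m * s l
  braid : ∀ l, l + 2 < r → s l * s (l + 1) * s l = s (l + 1) * s l * s (l + 1)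

/-- The product `s j * s (j + 1) * ⋯ * s (k - 1)`. -/
def ascending {G : Type*} [Monoid G] (s : ℕ → G) (j : ℕ) : ℕ → G
  | 0 => 1
  | k + 1 => if j ≤ k then ascending s j k * s k else 1

section

variable {G : Type*} [Monoid G] {s : ℕ → G} {r : ℕ}

theorem ascending_succ {j k : ℕ} (h : j ≤ k) :
    ascending s j (k + 1) = ascending s j k * s k := by
  rw [ascending, if_pos h]

theorem ascending_self (j : ℕ) : ascending s j j = 1 := by
  cases j with
  | zero => rfl
  | succ j => rw [ascending, if_neg (by omega)]

theorem ascending_eq_mul {j k : ℕ} (h : j < k) :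
    ascending s j k = s j * ascending s (j + 1) k := by
  induction k, h using Nat.le_induction with
  | base => rw [ascending_succ le_rfl, ascending_self, ascending_self, one_mul, mul_one]
  | succ k hk ih =>
    rw [ascending_succ (j := j) (by omega), ascending_succ (j := j + 1) (by omega), ih, mul_assoc]

theorem IsCoxeter.mul_ascending_of_lt (hs : IsCoxeter r s) {l j k : ℕ} (hlj : l + 2 ≤ j)
    (hjk : j ≤ k) (hk : k < r) : s l * ascending s j k = ascending s j k * s l := by
  induction k, hjk using Nat.le_induction with
  | base => rw [ascending_self, one_mul, mul_one]
  | succ k hjk ih =>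
    rw [ascending_succ hjk, ← mul_assoc, ih (by omega), mul_assoc,
      hs.comm l k (by omega) (by omega), mul_assoc]

theorem IsCoxeter.mul_ascending_of_gt (hs : IsCoxeter r s) {l j k : ℕ} (hjk : j ≤ k)
    (hk : k + 1 ≤ l) (hl : l + 1 < r) : s l * ascending s j k = ascending s j k * s l := by
  induction k, hjk using Nat.le_induction with
  | base => rw [ascending_self, one_mul, mul_one]
  | succ k hjk ih =>
    rw [ascending_succ hjk, ← mul_assoc, ih (by omega), mul_assoc,
      ← hs.comm k l (by omega) (by omega), mul_assoc]

theorem IsCoxeter.mul_ascending (hs : IsCoxeter r s) {l j k : ℕ} (hjl : j ≤ l) (hlk : l + 1 < k)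
    (hk : k < r) : s (l + 1) * ascending s j k = ascending s j k * s l := by
  induction k, hlk using Nat.le_induction with
  | base =>
    rw [ascending_succ (by omega), ascending_succ hjl, ← mul_assoc, ← mul_assoc,
      hs.mul_ascending_of_gt hjl le_rfl (by omega), mul_assoc, mul_assoc, ← mul_assoc (s (l + 1)),
      ← hs.braid l (by omega)]
    simp only [mul_assoc]
  | succ k hlk ih =>
    rw [ascending_succ (by omega), ← mul_assoc, ih (by omega), mul_assoc,
      hs.comm l k (by omega) (by omega), mul_assoc]

end

theorem isCoxeter_swap (r : ℕ) : IsCoxeter r (fun l => (swap l (l + 1) : Perm ℕ)) where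
  sq l _ := swap_mul_self _ _
  comm l m h _ := Perm.Disjoint.commute fun i => by
    by_cases hi : i = l ∨ i = l + 1
    · exact Or.inr (swap_apply_of_ne_of_ne (by omega) (by omega))
    · exact Or.inl (swap_apply_of_ne_of_ne (by omega) (by omega))
  braid l _ := by
    have h1 := swap_mul_swap_mul_swap (x := l) (y := l + 1) (z := l + 2) (by omega) (by omega)
    have h2 := swap_mul_swap_mul_swap (x := l + 2) (y := l + 1) (z := l) (by omega) (by omega)
    rw [swap_comm (l + 1) l, swap_comm (l + 2) (l + 1), swap_comm l (l + 2)] at h2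
    exact h2.trans h1.symm

/-- A transposition of neighbours in `Fin r`, as a permutation of `ℕ`. -/
theorem extendDomain_swap {r l : ℕ} (h : l + 1 < r) :
    (swap (⟨l, by omega⟩ : Fin r) ⟨l + 1, h⟩).extendDomain Fin.equivSubtype =
      swap l (l + 1) := by
  ext i
  by_cases hi : i < r
  · have h1 := Perm.extendDomain_apply_subtype (swap (⟨l, by omega⟩ : Fin r) ⟨l + 1, h⟩)
      Fin.equivSubtype hi
    rw [h1]
    simp only [Fin.equivSubtype_symm_apply, swap_apply_def, Fin.mk.injEq]
    split_ifs <;> simp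
  · have h1 := Perm.extendDomain_apply_not_subtype (swap (⟨l, by omega⟩ : Fin r) ⟨l + 1, h⟩)
      Fin.equivSubtype hi
    rw [h1, swap_apply_of_ne_of_ne (by omega) (by omega)]

theorem ascending_swap_apply {j k : ℕ} (h : j ≤ k) :
    ascending (fun l => (swap l (l + 1) : Perm ℕ)) j k k = j := by
  induction k, h using Nat.le_induction with
  | base => rw [ascending_self]; rfl
  | succ k hjk ih => rw [ascending_succ hjk, Perm.mul_apply, swap_apply_right, ih]

theorem ascending_swap_apply_of_lt {j k i : ℕ} (h : j ≤ k) (hi : k < i) :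
    ascending (fun l => (swap l (l + 1) : Perm ℕ)) j k i = i := by
  induction k, h using Nat.le_induction with
  | base => rw [ascending_self]; rfl
  | succ k hjk ih =>
    rw [ascending_succ hjk, Perm.mul_apply, swap_apply_of_ne_of_ne (by omega) (by omega),
      ih (by omega)]

/-- The value at a permutation of `0, …, k - 1` of the homomorphism that maps the transpositions of
neighbours to the elements `s l`. -/
def coxeterLift {G : Type*} [Monoid G] (s : ℕ → G) : ℕ → Perm ℕ → G
  | 0, _ => 1
  | k + 1, π => ascending s (π k) k *
      coxeterLift s k ((ascending (fun l => (swap l (l + 1) : Perm ℕ)) (π k) k)⁻¹ * π)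

section

variable {G : Type*} [Monoid G] {s : ℕ → G} {r : ℕ}

theorem coxeterLift_one (k : ℕ) : coxeterLift s k 1 = 1 := by
  induction k with
  | zero => rfl
  | succ k ih =>
    rw [coxeterLift, Perm.one_apply, ascending_self, ascending_self, one_mul, inv_one, one_mul, ih]

theorem IsCoxeter.coxeterLift_swap_mul (hs : IsCoxeter r s) {k : ℕ} (hk : k ≤ r) {π : Perm ℕ}
    (hπ : ∀ i, k ≤ i → π i = i) {l : ℕ} (hl : l + 1 < k) :
    coxeterLift s k (swap l (l + 1) * π) = s l * coxeterLift s k π := by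
  induction k generalizing π l with
  | zero => omega
  | succ k ih =>
    have hj : π k ≤ k := by
      by_contra h
      have h1 := hπ (π k) (by omega)
      have := π.injective h1
      omega
    have ht := isCoxeter_swap r
    have hπ' : ∀ i, k ≤ i →
        ((ascending (fun l => (swap l (l + 1) : Perm ℕ)) (π k) k)⁻¹ * π) i = i := by
      intro i hi
      rw [Perm.mul_apply, Perm.inv_eq_iff_eq]
      rcases hi.eq_or_lt with rfl | hi
      · rw [ascending_swap_apply hj]
      · rw [ascending_swap_apply_of_lt hj hi, hπ i (by omega)]
    -- the permutation that remains after removing the first factor, in case `l ≠ π k, π k - 1`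
    have conj : ∀ m, swap l (l + 1) * ascending (fun l => (swap l (l + 1) : Perm ℕ)) (π k) k =
        ascending (fun l => (swap l (l + 1) : Perm ℕ)) (π k) k * swap m (m + 1) →
        (ascending (fun l => (swap l (l + 1) : Perm ℕ)) (π k) k)⁻¹ * (swap l (l + 1) * π) =
          swap m (m + 1) * ((ascending (fun l => (swap l (l + 1) : Perm ℕ)) (π k) k)⁻¹ * π) := by
      intro m h
      rw [inv_mul_eq_iff_eq_mul, ← mul_assoc, ← h, mul_assoc, mul_inv_cancel_left]
    rw [coxeterLift, coxeterLift, Perm.mul_apply]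
    rcases lt_trichotomy (π k) l with h | h | h
    · obtain ⟨m, rfl⟩ : ∃ m, l = m + 1 := ⟨l - 1, by omega⟩
      rw [swap_apply_of_ne_of_ne (by omega) (by omega),
        conj m (ht.mul_ascending (by omega) (by omega) (by omega)),
        ih (by omega) hπ' (by omega), ← mul_assoc, ← mul_assoc,
        hs.mul_ascending (by omega) (by omega) (by omega)]
    · rw [h, swap_apply_left, ascending_eq_mul (s := s) (j := l) (by omega),
        ascending_eq_mul (s := fun l => (swap l (l + 1) : Perm ℕ)) (j := l) (by omega),
        mul_inv_rev, swap_inv, ← mul_assoc (s l), ← mul_assoc (s l), hs.sq l (by omega), one_mul,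
        mul_assoc]
    · rcases (show l + 1 ≤ π k from h).eq_or_lt with h | h
      · rw [← h, swap_apply_right, ascending_eq_mul (s := s) (j := l) (by omega),
          ascending_eq_mul (s := fun l => (swap l (l + 1) : Perm ℕ)) (j := l) (by omega),
          mul_inv_rev, swap_inv, mul_assoc (s l), mul_assoc, swap_mul_self_mul]
      · rw [swap_apply_of_ne_of_ne (by omega) (by omega),
          conj l (ht.mul_ascending_of_lt (by omega) (by omega) (by omega)),
          ih (by omega) hπ' (by omega), ← mul_assoc, ← mul_assoc,
          hs.mul_ascending_of_lt (by omega) (by omega) (by omega)]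

/-- The homomorphism from the symmetric group given by elements that satisfy the Coxeter
relations. -/
noncomputable def IsCoxeter.hom (hs : IsCoxeter r s) : Perm (Fin r) →* G :=
  have one : coxeterLift s r ((1 : Perm (Fin r)).extendDomain Fin.equivSubtype) = 1 := by
    rw [Perm.extendDomain_one, coxeterLift_one]
  have key : ∀ (l : ℕ) (h : l + 1 < r) (π : Perm (Fin r)),
      coxeterLift s r
          ((swap (⟨l, by omega⟩ : Fin r) ⟨l + 1, h⟩ * π).extendDomain Fin.equivSubtype) =
        s l * coxeterLift s r (π.extendDomain Fin.equivSubtype) := by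
    intro l h π
    rw [← Perm.extendDomain_mul]
    rw [extendDomain_swap, hs.coxeterLift_swap_mul le_rfl _ h]
    intro i hi
    exact Perm.extendDomain_apply_not_subtype _ _ (by omega)
  { toFun := fun π => coxeterLift s r (π.extendDomain Fin.equivSubtype)
    map_one' := one
    map_mul' := fun π τ => by
      induction π using perm_induction with
      | one => rw [one_mul, one, one_mul]
      | mul l h π ih => rw [mul_assoc, key, key, ih, mul_assoc] }

theorem IsCoxeter.hom_swap (hs : IsCoxeter r s) {l : ℕ} (h : l + 1 < r) :
    hs.hom (swap ⟨l, by omega⟩ ⟨l + 1, h⟩) = s l := by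
  change coxeterLift s r _ = _
  rw [extendDomain_swap h, ← mul_one (swap l (l + 1)),
    hs.coxeterLift_swap_mul le_rfl (fun _ _ => rfl) h, coxeterLift_one, mul_one]

end

end Coxeter

end UnitaryBrauer

namespace UnitaryBrauer

/-! ### Systems of permutations, complex structures and contractions -/

open Equiv

/-- The symmetric form of the relations of the unitary Brauer algebra: an action of the symmetric
group together with elements `J i` (mark the `i`-th strand) and `c i j` (horizontal edges between
the `i`-th and the `j`-th vertex of both rows), which are permuted by the symmetric group. The
values `c i i` are irrelevant. -/
structure BrauerSystem {k : Type*} [CommRing k] (A : Type*) [Ring A] [Algebra k A] (r : ℕ)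
    (x : k) where
  perm : Perm (Fin r) →* A
  J : Fin r → A
  c : Fin r → Fin r → A
  perm_J : ∀ π i, perm π * J i = J (π i) * perm π
  perm_c : ∀ π i j, i ≠ j → perm π * c i j = c (π i) (π j) * perm π
  J_sq : ∀ i, J i * J i = -1
  J_comm : ∀ i j, J i * J j = J j * J i
  c_sq : ∀ i j, i ≠ j → c i j * c i j = x • c i j
  swap_c : ∀ i j, i ≠ j → perm (swap i j) * c i j = c i j
  c_swap : ∀ i j, i ≠ j → c i j * perm (swap i j) = c i j
  c_mul_c : ∀ i j l, i ≠ j → j ≠ l → i ≠ l → c i j * c j l = perm (swap i l) * c j l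
  c_J_c : ∀ i j, i ≠ j → c i j * J i * c i j = 0
  J_c : ∀ i j, i ≠ j → J i * c i j = -(J j * c i j)
  c_J : ∀ i j, i ≠ j → c i j * J i = -(c i j * J j)
  J_c_comm : ∀ i j l, i ≠ j → l ≠ i → l ≠ j → J l * c i j = c i j * J l
  c_comm : ∀ i j l m, i ≠ j → l ≠ m → i ≠ l → i ≠ m → j ≠ l → j ≠ m →
    c i j * c l m = c l m * c i j

/-! ### Involutions -/

section Involution

theorem involution_apply {α : Type*} {p : Perm α} (hp : p * p = 1) (i : α) : p (p i) = i := by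
  rw [← Perm.mul_apply, hp, Perm.one_apply]

variable {α : Type*} [DecidableEq α] {p : Perm α} {i j : α}

theorem swap_mul_involution (hp : p * p = 1) (hi : p i = i) (hj : p j = j) :
    swap i j * p * (swap i j * p) = 1 := by
  rw [mul_assoc, ← mul_assoc p, mul_swap_eq_swap_mul, hi, hj, mul_assoc (swap i j) p p, hp,
    mul_one, swap_mul_self]

theorem swap_mul_involution_of_moved (hp : p * p = 1) :
    swap i (p i) * p * (swap i (p i) * p) = 1 := by
  rw [mul_assoc, ← mul_assoc p, mul_swap_eq_swap_mul, involution_apply hp, mul_assoc (swap (p i) i),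
    hp, mul_one, swap_comm, swap_mul_self]

theorem swap_mul_apply_self : (swap i (p i) * p) i = i := by
  rw [Perm.mul_apply, swap_apply_right]

theorem swap_mul_apply_image (hp : p * p = 1) : (swap i (p i) * p) (p i) = p i := by
  rw [Perm.mul_apply, involution_apply hp, swap_apply_left]

theorem swap_mul_apply_of_ne (hp : p * p = 1) {l : α} (h1 : l ≠ i) (h2 : l ≠ p i) :
    (swap i (p i) * p) l = p l := by
  rw [Perm.mul_apply, swap_apply_of_ne_of_ne]
  · intro h
    exact h2 (by rw [← h, involution_apply hp])
  · exact fun h => h1 (p.injective h)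

end Involution

namespace BrauerSystem

variable {k : Type*} [CommRing k] {A : Type*} [Ring A] [Algebra k A] {r : ℕ} {x : k}
  (B : BrauerSystem A r x)

theorem c_symm {i j : Fin r} (h : i ≠ j) : B.c i j = B.c j i := by
  have h1 := B.perm_c (swap i j) i j h
  rw [B.swap_c i j h, swap_apply_left, swap_apply_right, swap_comm, B.c_swap j i h.symm] at h1
  exact h1

/-! ### Products of disjoint contractions -/

/-- The first elements of the pairs formed by an involution. -/
def firsts (p : Perm (Fin r)) : Finset (Fin r) := Finset.univ.filter fun i => i < p i

theorem mem_firsts {p : Perm (Fin r)} {i : Fin r} : i ∈ firsts p ↔ i < p i := by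
  simp [firsts]

theorem commute_firsts {p : Perm (Fin r)} (hp : p * p = 1) :
    Set.Pairwise (firsts p : Set (Fin r))
      (Function.onFun Commute fun i => B.c i (p i)) := by
  intro i hi j hj hij
  rw [Finset.mem_coe, mem_firsts] at hi hj
  have hi' := involution_apply hp i
  have hj' := involution_apply hp j
  refine B.c_comm _ _ _ _ hi.ne hj.ne hij ?_ ?_ (fun h => hij (p.injective h))
  · intro h
    rw [h, hj'] at hi
    exact lt_asymm hi hj
  · intro h
    rw [← h, hi'] at hj
    exact lt_asymm hi hj

/-- The product of the contractions `c i (p i)` over all pairs `{i, p i}` formed by an involution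
`p`. -/
noncomputable def cup (p : Perm (Fin r)) : A :=
  if hp : p * p = 1 then (firsts p).noncommProd (fun i => B.c i (p i)) (B.commute_firsts hp) else 0

theorem cup_one : B.cup 1 = 1 := by
  have h : firsts (1 : Perm (Fin r)) = ∅ := by
    ext i
    simp [mem_firsts]
  rw [cup, dif_pos (one_mul 1)]
  simp only [h]
  exact Finset.noncommProd_empty _ _

theorem cup_swap_mul_aux {p : Perm (Fin r)} (hp : p * p = 1) {i j : Fin r} (hij : i < j)
    (hi : p i = i) (hj : p j = j) :
    B.cup (swap i j * p) = B.c i j * B.cup p ∧ B.cup (swap i j * p) = B.cup p * B.c i j := by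
  have hq := swap_mul_involution hp hi hj
  have happ : ∀ l, l ≠ i → l ≠ j → (swap i j * p) l = p l := by
    intro l h1 h2
    rw [Perm.mul_apply, swap_apply_of_ne_of_ne]
    · exact fun h => h1 (p.injective (h.trans hi.symm))
    · exact fun h => h2 (p.injective (h.trans hj.symm))
  have hqi : (swap i j * p) i = j := by rw [Perm.mul_apply, hi, swap_apply_left]
  have hqj : (swap i j * p) j = i := by rw [Perm.mul_apply, hj, swap_apply_right]
  have hins : firsts (swap i j * p) = insert i (firsts p) := by
    ext l
    rw [Finset.mem_insert, mem_firsts, mem_firsts]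
    rcases eq_or_ne l i with rfl | h1
    · simp [hqi, hij]
    rcases eq_or_ne l j with rfl | h2
    · simp [hqj, hj, h1, hij.le]
    · simp [happ l h1 h2, h1]
  have hni : i ∉ firsts p := by simp [mem_firsts, hi]
  have hcongr : (firsts p).noncommProd (fun l => B.c l ((swap i j * p) l))
      ((B.commute_firsts hq).mono (by rw [hins]; simp)) = B.cup p := by
    rw [cup, dif_pos hp]
    refine Finset.noncommProd_congr rfl (fun l hl => ?_) _
    rw [mem_firsts] at hl
    rw [happ]
    · rintro rfl
      exact hl.ne hi.symm
    · rintro rfl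
      exact hl.ne hj.symm
  have hcup : B.cup (swap i j * p) = (insert i (firsts p)).noncommProd
      (fun l => B.c l ((swap i j * p) l)) (hins ▸ B.commute_firsts hq) := by
    rw [cup, dif_pos hq]
    exact Finset.noncommProd_congr hins (fun _ _ => rfl) _
  rw [hcup]
  constructor
  · rw [Finset.noncommProd_insert_of_notMem _ _ _ _ hni, hcongr, hqi]
  · rw [Finset.noncommProd_insert_of_notMem' _ _ _ _ hni, hcongr, hqi]

theorem c_mul_cup_of_fixed {p : Perm (Fin r)} (hp : p * p = 1) {i j : Fin r} (hij : i ≠ j)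
    (hi : p i = i) (hj : p j = j) : B.c i j * B.cup p = B.cup (swap i j * p) := by
  rcases hij.lt_or_gt with h | h
  · exact (B.cup_swap_mul_aux hp h hi hj).1.symm
  · rw [B.c_symm hij, swap_comm]
    exact (B.cup_swap_mul_aux hp h hj hi).1.symm

theorem cup_mul_c_of_fixed {p : Perm (Fin r)} (hp : p * p = 1) {i j : Fin r} (hij : i ≠ j)
    (hi : p i = i) (hj : p j = j) : B.cup p * B.c i j = B.cup (swap i j * p) := by
  rcases hij.lt_or_gt with h | h
  · exact (B.cup_swap_mul_aux hp h hi hj).2.symm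
  · rw [B.c_symm hij, swap_comm]
    exact (B.cup_swap_mul_aux hp h hj hi).2.symm

theorem cup_eq_c_mul {p : Perm (Fin r)} (hp : p * p = 1) {i : Fin r} (hi : p i ≠ i) :
    B.cup p = B.c i (p i) * B.cup (swap i (p i) * p) := by
  rw [B.c_mul_cup_of_fixed (swap_mul_involution_of_moved hp) hi.symm swap_mul_apply_self
    (swap_mul_apply_image hp), swap_mul_self_mul]

theorem cup_eq_mul_c {p : Perm (Fin r)} (hp : p * p = 1) {i : Fin r} (hi : p i ≠ i) :
    B.cup p = B.cup (swap i (p i) * p) * B.c i (p i) := by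
  rw [B.cup_mul_c_of_fixed (swap_mul_involution_of_moved hp) hi.symm swap_mul_apply_self
    (swap_mul_apply_image hp), swap_mul_self_mul]

theorem J_mul_cup_of_fixed {p : Perm (Fin r)} (hp : p * p = 1) {i : Fin r} (hi : p i = i) :
    B.J i * B.cup p = B.cup p * B.J i := by
  rw [cup, dif_pos hp]
  refine Finset.noncommProd_commute _ _ _ _ fun l hl => ?_
  rw [mem_firsts] at hl
  refine B.J_c_comm _ _ _ hl.ne ?_ ?_
  · rintro rfl
    exact hl.ne hi.symm
  · rintro rfl
    rw [involution_apply hp] at hi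
    exact hl.ne hi

theorem J_mul_cup {p : Perm (Fin r)} (hp : p * p = 1) {i : Fin r} (hi : p i ≠ i) :
    B.J i * B.cup p = -(B.J (p i) * B.cup p) := by
  rw [B.cup_eq_c_mul hp hi, ← mul_assoc, ← mul_assoc, B.J_c _ _ hi.symm, neg_mul]

theorem cup_mul_J {p : Perm (Fin r)} (hp : p * p = 1) {i : Fin r} (hi : p i ≠ i) :
    B.cup p * B.J i = -(B.cup p * B.J (p i)) := by
  rw [B.cup_eq_mul_c hp hi, mul_assoc, mul_assoc, B.c_J _ _ hi.symm, mul_neg]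

/-- Contractions with a common vertex. -/
theorem c_mul_cup_of_moved {p : Perm (Fin r)} (hp : p * p = 1) {i j : Fin r} (hij : i ≠ j)
    (hi : p i ≠ i) (hj : p i ≠ j) :
    B.c i j * B.cup p = B.perm (swap j (p i)) * B.cup p := by
  rw [B.cup_eq_c_mul hp hi, ← mul_assoc, ← mul_assoc, B.c_symm hij,
    B.c_mul_c _ _ _ hij.symm hi.symm hj.symm]

/-! ### Permutations of the pairs of an involution -/

theorem perm_swap_mul_cup {p : Perm (Fin r)} (hp : p * p = 1) {i : Fin r} (hi : p i ≠ i) :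
    B.perm (swap i (p i)) * B.cup p = B.cup p := by
  rw [B.cup_eq_c_mul hp hi, ← mul_assoc, B.swap_c _ _ hi.symm]

theorem perm_swap_swap_mul_c_mul_c {a b a' b' : Fin r} (hab : a ≠ b) (hab' : a' ≠ b')
    (h1 : a ≠ a') (h2 : a ≠ b') (h3 : b ≠ a') (h4 : b ≠ b') :
    B.perm (swap a a' * swap b b') * (B.c a b * B.c a' b') = B.c a b * B.c a' b' := by
  -- both transpositions turn the product into `c a b' * c a b * c a' b'`
  have e1 : B.perm (swap b b') * (B.c a b * B.c a' b') = B.c a b' * B.c a b * B.c a' b' := by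
    rw [← mul_assoc, B.c_symm h2, B.c_mul_c _ _ _ h2.symm hab h4.symm, swap_comm]
  have e2 : B.perm (swap a a') * (B.c a b * B.c a' b') = B.c a b' * B.c a b * B.c a' b' := by
    rw [B.c_comm _ _ _ _ hab hab' h1 h2 h3 h4, mul_assoc,
      B.c_comm _ _ _ _ hab hab' h1 h2 h3 h4, ← mul_assoc, ← mul_assoc, B.c_symm hab',
      B.c_mul_c _ _ _ h2 hab'.symm h1]
  rw [map_mul, mul_assoc, e1, ← e2, ← mul_assoc, ← map_mul, swap_mul_self, map_one, one_mul]

theorem perm_swap_swap_mul_cup {p : Perm (Fin r)} (hp : p * p = 1) {a a' : Fin r} (ha : p a ≠ a)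
    (ha' : p a' ≠ a') (h1 : a ≠ a') (h2 : a' ≠ p a) :
    B.perm (swap a a' * swap (p a) (p a')) * B.cup p = B.cup p := by
  have h3 : p a ≠ p a' := fun h => h1 (p.injective h)
  have h4 : a ≠ p a' := fun h => h2 (by rw [h, involution_apply hp])
  have hq := swap_mul_involution_of_moved (i := a) hp
  have hqa : (swap a (p a) * p) a' = p a' := swap_mul_apply_of_ne hp h1.symm h2
  rw [B.cup_eq_c_mul hp ha, B.cup_eq_c_mul hq (i := a') (by rwa [hqa]), hqa,
    ← mul_assoc (B.c a (p a)), ← mul_assoc,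
    B.perm_swap_swap_mul_c_mul_c ha.symm ha'.symm h1 h4 h2.symm h3]

/-- A permutation that only permutes the pairs of an involution, and the elements of these pairs,
is absorbed by the product of the corresponding contractions. -/
theorem perm_mul_cup {p : Perm (Fin r)} (hp : p * p = 1) {π : Perm (Fin r)}
    (hcomm : ∀ i, π (p i) = p (π i)) (hfix : ∀ i, p i = i → π i = i) :
    B.perm π * B.cup p = B.cup p := by
  induction hn : π.support.card using Nat.strong_induction_on generalizing π with
  | _ n ih =>
    by_cases hπ : π = 1
    · rw [hπ, map_one, one_mul]
    obtain ⟨a, ha⟩ : ∃ a, π a ≠ a := by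
      by_contra! h
      exact hπ (Equiv.ext h)
    have hpa : p a ≠ a := fun h => ha (hfix a h)
    -- it suffices to split off a factor that corrects `π` at `a`
    have reduce : ∀ τ : Perm (Fin r), B.perm τ * B.cup p = B.cup p → τ * τ = 1 →
        (∀ i, τ (p i) = p (τ i)) → (∀ i, π i = i → τ i = i) → τ (π a) = a →
        B.perm π * B.cup p = B.cup p := by
      intro τ h1 h2 h3 h4 h5
      have h6 : B.perm (τ * π) * B.cup p = B.cup p := by
        refine ih _ ?_ (fun i => ?_) (fun i hi => ?_) rfl
        · rw [← hn]
          refine Finset.card_lt_card ⟨fun i hi => ?_, fun h => ?_⟩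
          · rw [Perm.mem_support] at hi ⊢
            intro h
            exact hi (by rw [Perm.mul_apply, h, h4 i h])
          · have := h (Perm.mem_support.2 ha)
            rw [Perm.mem_support, Perm.mul_apply] at this
            exact this h5
        · rw [Perm.mul_apply, Perm.mul_apply, hcomm, h3]
        · rw [Perm.mul_apply, hfix i hi, h4 i (hfix i hi)]
      calc B.perm π * B.cup p = B.perm (τ * (τ * π)) * B.cup p := by
            rw [← mul_assoc, h2, one_mul]
        _ = B.cup p := by rw [map_mul, mul_assoc, h6, h1]
    have hpp := involution_apply hp
    have hpinj : ∀ i j, p i = p j ↔ i = j := fun i j => p.injective.eq_iff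
    rcases eq_or_ne (π a) (p a) with h | h
    · refine reduce (swap a (p a)) (B.perm_swap_mul_cup hp hpa) (swap_mul_self _ _) ?_ ?_ ?_
      · intro i
        have := Perm.ext_iff.1 (mul_swap_eq_swap_mul p a (p a)) i
        rw [Perm.mul_apply, Perm.mul_apply, hpp, swap_comm (p a)] at this
        exact this.symm
      · intro i hi
        refine swap_apply_of_ne_of_ne ?_ ?_
        · rintro rfl
          exact ha hi
        · rintro rfl
          rw [hcomm, hpinj] at hi
          exact ha hi
      · rw [h, swap_apply_right]
    · have hpa' : p (π a) ≠ π a := fun h' => ha (π.injective (hfix _ h'))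
      have h3 : p a ≠ p (π a) := fun h' => ha (p.injective h').symm
      have h4 : a ≠ p (π a) := fun h' => h (by conv_rhs => rw [h', hpp])
      have hdis : (swap a (π a)).Disjoint (swap (p a) (p (π a))) := by
        intro i
        by_cases hi : i = a ∨ i = π a
        · refine Or.inr (swap_apply_of_ne_of_ne ?_ ?_) <;> rcases hi with rfl | rfl
          · exact hpa.symm
          · exact h
          · exact h4
          · exact hpa'.symm
        · rw [not_or] at hi
          exact Or.inl (swap_apply_of_ne_of_ne hi.1 hi.2)
      refine reduce (swap a (π a) * swap (p a) (p (π a)))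
        (B.perm_swap_swap_mul_cup hp hpa hpa' (Ne.symm ha) h) ?_ ?_ ?_ ?_
      · rw [mul_assoc, ← mul_assoc (swap (p a) _), ← hdis.commute.eq, mul_assoc, swap_mul_self,
          mul_one, swap_mul_self]
      · intro i
        have e : p * (swap a (π a) * swap (p a) (p (π a))) =
            swap a (π a) * swap (p a) (p (π a)) * p := by
          rw [← mul_assoc, mul_swap_eq_swap_mul p a, mul_assoc, mul_swap_eq_swap_mul p (p a), hpp,
            hpp, ← mul_assoc, hdis.commute.eq]
        exact (Perm.ext_iff.1 e i).symm
      · intro i hi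
        have e1 : i ≠ a := by rintro rfl; exact ha hi
        have e2 : i ≠ π a := by rintro rfl; exact ha (π.injective hi)
        have e3 : i ≠ p a := by
          rintro rfl
          rw [hcomm, hpinj] at hi
          exact ha hi
        have e4 : i ≠ p (π a) := by
          rintro rfl
          rw [hcomm, hpinj] at hi
          exact ha (π.injective hi)
        rw [Perm.mul_apply, swap_apply_of_ne_of_ne e3 e4, swap_apply_of_ne_of_ne e1 e2]
      · rw [Perm.mul_apply, swap_apply_of_ne_of_ne h hpa'.symm, swap_apply_right]

end BrauerSystem

end UnitaryBrauer

namespace UnitaryBrauer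

open Equiv

namespace BrauerSystem

variable {k : Type*} [CommRing k] {A : Type*} [Ring A] [Algebra k A] {r : ℕ} {x : k}
  (B : BrauerSystem A r x)

/-! ### Monomials span -/

/-- The products of the elements `J i`. -/
def markers : Submonoid A := Submonoid.closure (Set.range B.J)

theorem J_mem_markers (i : Fin r) : B.J i ∈ B.markers := Submonoid.subset_closure ⟨i, rfl⟩

theorem neg_mem_markers (i : Fin r) {u : A} (hu : u ∈ B.markers) : -u ∈ B.markers := by
  have h : -u = B.J i * B.J i * u := by rw [B.J_sq, neg_one_mul]
  rw [h]
  exact mul_mem (mul_mem (B.J_mem_markers i) (B.J_mem_markers i)) hu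

/-- The products `u * perm π * cup p * v` with products `u`, `v` of elements `J i`. -/
def monomials : Set A :=
  {a | ∃ u ∈ B.markers, ∃ v ∈ B.markers, ∃ π p : Perm (Fin r), p * p = 1 ∧
    a = u * B.perm π * B.cup p * v}

theorem perm_mul_marker (π : Perm (Fin r)) {u : A} (hu : u ∈ B.markers) :
    ∃ u' ∈ B.markers, B.perm π * u = u' * B.perm π := by
  induction hu using Submonoid.closure_induction with
  | mem u h =>
    obtain ⟨i, rfl⟩ := h
    exact ⟨_, B.J_mem_markers (π i), B.perm_J π i⟩
  | one => exact ⟨1, one_mem _, by rw [one_mul, mul_one]⟩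
  | mul u v _ _ ihu ihv =>
    obtain ⟨u', hu', h1⟩ := ihu
    obtain ⟨v', hv', h2⟩ := ihv
    exact ⟨u' * v', mul_mem hu' hv', by rw [← mul_assoc, h1, mul_assoc, h2, mul_assoc]⟩

theorem c_mul_marker {i j : Fin r} (hij : i ≠ j) {u : A} (hu : u ∈ B.markers) :
    ∃ u' ∈ B.markers, B.c i j * u = u' * B.c i j ∨ B.c i j * u = u' * B.c i j * B.J i := by
  induction hu using Submonoid.closure_induction_right with
  | one => exact ⟨1, one_mem _, Or.inl (by rw [one_mul, mul_one])⟩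
  | mul_right u hu v hv ih =>
    obtain ⟨l, rfl⟩ := hv
    obtain ⟨u', hu', h | h⟩ := ih
    · rcases eq_or_ne l i with rfl | hli
      · exact ⟨u', hu', Or.inr (by rw [← mul_assoc, h])⟩
      rcases eq_or_ne l j with rfl | hlj
      · refine ⟨-u', B.neg_mem_markers i hu', Or.inr ?_⟩
        rw [← mul_assoc, h, mul_assoc, mul_assoc, B.c_J _ _ hij, neg_mul_neg]
      · refine ⟨u' * B.J l, mul_mem hu' (B.J_mem_markers l), Or.inl ?_⟩
        rw [← mul_assoc, h, mul_assoc, mul_assoc, B.J_c_comm _ _ _ hij hli hlj]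
    · rcases eq_or_ne l i with rfl | hli
      · refine ⟨-u', B.neg_mem_markers l hu', Or.inl ?_⟩
        rw [← mul_assoc, h, mul_assoc, B.J_sq, mul_neg_one, neg_mul]
      rcases eq_or_ne l j with rfl | hlj
      · refine ⟨u', hu', Or.inl ?_⟩
        rw [← mul_assoc, h, mul_assoc, B.J_comm, ← mul_assoc, mul_assoc u',
          ← neg_eq_iff_eq_neg.2 (B.c_J _ _ hij), mul_neg, neg_mul, mul_assoc, mul_assoc, B.J_sq]
        simp
      · refine ⟨u' * B.J l, mul_mem hu' (B.J_mem_markers l), Or.inr ?_⟩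
        rw [← mul_assoc, h, mul_assoc, B.J_comm, ← mul_assoc, mul_assoc u',
          ← B.J_c_comm _ _ _ hij hli hlj]
        simp only [mul_assoc]

theorem map_span_le {f : A →ₗ[k] A} (h : ∀ a ∈ B.monomials, f a ∈ Submodule.span k B.monomials)
    {a : A} (ha : a ∈ Submodule.span k B.monomials) : f a ∈ Submodule.span k B.monomials :=
  (Submodule.span_le (p := (Submodule.span k B.monomials).comap f)).2 h ha

theorem marker_mul_mem_span {u a : A} (hu : u ∈ B.markers)
    (ha : a ∈ Submodule.span k B.monomials) : u * a ∈ Submodule.span k B.monomials := by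
  refine B.map_span_le (f := LinearMap.mulLeft k u) ?_ ha
  rintro _ ⟨u', hu', v, hv, π, p, hp, rfl⟩
  exact Submodule.subset_span ⟨u * u', mul_mem hu hu', v, hv, π, p, hp, by
    rw [LinearMap.mulLeft_apply]; simp only [mul_assoc]⟩

theorem mul_marker_mem_span {v a : A} (hv : v ∈ B.markers)
    (ha : a ∈ Submodule.span k B.monomials) : a * v ∈ Submodule.span k B.monomials := by
  refine B.map_span_le (f := LinearMap.mulRight k v) ?_ ha
  rintro _ ⟨u, hu, v', hv', π, p, hp, rfl⟩
  exact Submodule.subset_span ⟨u, hu, v' * v, mul_mem hv' hv, π, p, hp, by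
    rw [LinearMap.mulRight_apply]; simp only [mul_assoc]⟩

theorem perm_mul_mem_span (τ : Perm (Fin r)) {a : A}
    (ha : a ∈ Submodule.span k B.monomials) :
    B.perm τ * a ∈ Submodule.span k B.monomials := by
  refine B.map_span_le (f := LinearMap.mulLeft k (B.perm τ)) ?_ ha
  rintro _ ⟨u, hu, v, hv, π, p, hp, rfl⟩
  obtain ⟨u', hu', h⟩ := B.perm_mul_marker τ hu
  refine Submodule.subset_span ⟨u', hu', v, hv, τ * π, p, hp, ?_⟩
  rw [LinearMap.mulLeft_apply, ← mul_assoc, ← mul_assoc, ← mul_assoc, h, map_mul]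
  simp only [mul_assoc]

theorem cup_mem_span {p : Perm (Fin r)} (hp : p * p = 1) :
    B.cup p ∈ Submodule.span k B.monomials :=
  Submodule.subset_span ⟨1, one_mem _, 1, one_mem _, 1, p, hp, by
    rw [map_one, one_mul, one_mul, mul_one]⟩

theorem c_mul_cup_mem_span {i j : Fin r} (hij : i ≠ j) {p : Perm (Fin r)} (hp : p * p = 1) :
    B.c i j * B.cup p ∈ Submodule.span k B.monomials ∧
      B.c i j * B.J i * B.cup p ∈ Submodule.span k B.monomials := by
  have hpp := involution_apply hp
  by_cases hi : p i = i
  · rw [mul_assoc, B.J_mul_cup_of_fixed hp hi, ← mul_assoc]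
    suffices h : B.c i j * B.cup p ∈ Submodule.span k B.monomials from
      ⟨h, B.mul_marker_mem_span (B.J_mem_markers i) h⟩
    by_cases hj : p j = j
    · rw [B.c_mul_cup_of_fixed hp hij hi hj]
      exact B.cup_mem_span (swap_mul_involution hp hi hj)
    · rw [B.c_symm hij, B.c_mul_cup_of_moved hp hij.symm hj]
      · exact B.perm_mul_mem_span _ (B.cup_mem_span hp)
      · intro h
        rw [← h, hpp] at hi
        exact hij (hi.symm ▸ h.symm)
  · by_cases hj : p i = j
    · subst hj
      rw [B.cup_eq_c_mul hp hi, ← mul_assoc, ← mul_assoc, B.c_J_c _ _ hij, B.c_sq _ _ hij,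
        zero_mul, smul_mul_assoc, ← B.cup_eq_c_mul hp hi]
      exact ⟨Submodule.smul_mem _ _ (B.cup_mem_span hp), zero_mem _⟩
    · have h : B.c i j * B.cup p ∈ Submodule.span k B.monomials := by
        rw [B.c_mul_cup_of_moved hp hij hi hj]
        exact B.perm_mul_mem_span _ (B.cup_mem_span hp)
      refine ⟨h, ?_⟩
      rw [mul_assoc, B.J_mul_cup hp hi, mul_neg, ← mul_assoc,
        ← B.J_c_comm _ _ _ hij hi hj, mul_assoc]
      exact neg_mem (B.marker_mul_mem_span (B.J_mem_markers _) h)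

theorem c_mul_mem_span {i j : Fin r} (hij : i ≠ j) {a : A}
    (ha : a ∈ Submodule.span k B.monomials) :
    B.c i j * a ∈ Submodule.span k B.monomials := by
  refine B.map_span_le (f := LinearMap.mulLeft k (B.c i j)) ?_ ha
  rintro _ ⟨u, hu, v, hv, π, p, hp, rfl⟩
  rw [LinearMap.mulLeft_apply]
  obtain ⟨i', rfl⟩ := π.surjective i
  obtain ⟨j', rfl⟩ := π.surjective j
  have hij' : i' ≠ j' := fun h => hij (by rw [h])
  have hmem := B.c_mul_cup_mem_span hij' hp
  obtain ⟨u', hu', h | h⟩ := B.c_mul_marker hij hu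
  · have e : B.c (π i') (π j') * (u * B.perm π * B.cup p * v) =
        u' * (B.perm π * (B.c i' j' * B.cup p)) * v := by
      rw [← mul_assoc (B.perm π), B.perm_c _ _ _ hij']
      simp only [← mul_assoc]
      rw [h]
    rw [e]
    exact B.mul_marker_mem_span hv (B.marker_mul_mem_span hu' (B.perm_mul_mem_span π hmem.1))
  · have e : B.c (π i') (π j') * (u * B.perm π * B.cup p * v) =
        u' * (B.perm π * (B.c i' j' * B.J i' * B.cup p)) * v := by
      rw [← mul_assoc (B.perm π), ← mul_assoc (B.perm π), B.perm_c _ _ _ hij',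
        mul_assoc (B.c (π i') (π j')) (B.perm π), B.perm_J]
      simp only [← mul_assoc]
      rw [h]
    rw [e]
    exact B.mul_marker_mem_span hv (B.marker_mul_mem_span hu' (B.perm_mul_mem_span π hmem.2))

/-- The monomials span an algebra that is generated by permutations, elements `J i` and
contractions. -/
theorem span_monomials_eq_top {s : Set A} (hs : Algebra.adjoin k s = ⊤)
    (h : ∀ g ∈ s, (∃ π, g = B.perm π) ∨ (∃ i, g = B.J i) ∨ ∃ i j, i ≠ j ∧ g = B.c i j) :
    Submodule.span k B.monomials = ⊤ := by
  have key : ∀ b : A, ∀ a ∈ Submodule.span k B.monomials,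
      b * a ∈ Submodule.span k B.monomials := by
    intro b
    have hb : b ∈ Algebra.adjoin k s := by rw [hs]; trivial
    induction hb using Algebra.adjoin_induction with
    | mem g hg =>
      intro a ha
      rcases h g hg with ⟨π, rfl⟩ | ⟨i, rfl⟩ | ⟨i, j, hij, rfl⟩
      · exact B.perm_mul_mem_span π ha
      · exact B.marker_mul_mem_span (B.J_mem_markers i) ha
      · exact B.c_mul_mem_span hij ha
    | algebraMap t =>
      intro a ha
      rw [← Algebra.smul_def]
      exact Submodule.smul_mem _ t ha
    | add b b' _ _ ih ih' =>
      intro a ha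
      rw [add_mul]
      exact add_mem (ih a ha) (ih' a ha)
    | mul b b' _ _ ih ih' =>
      intro a ha
      rw [mul_assoc]
      exact ih _ (ih' a ha)
  rw [eq_top_iff]
  intro b _
  rw [← mul_one b]
  refine key b 1 ?_
  rw [← B.cup_one]
  exact B.cup_mem_span (one_mul 1)

/-! ### Monomials and diagrams -/

/-- The product of the elements `J i` with `i ∈ s`. -/
noncomputable def marker (s : Finset (Fin r)) : A :=
  s.noncommProd B.J fun i _ j _ _ => B.J_comm i j

theorem marker_empty : B.marker ∅ = 1 := Finset.noncommProd_empty _ _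

theorem J_mul_marker (i : Fin r) (s : Finset (Fin r)) : B.J i * B.marker s =
    B.marker s * B.J i :=
  Finset.noncommProd_commute _ _ _ _ fun j _ => B.J_comm i j

theorem marker_insert {i : Fin r} {s : Finset (Fin r)} (h : i ∉ s) :
    B.marker (insert i s) = B.J i * B.marker s :=
  Finset.noncommProd_insert_of_notMem _ _ _ _ h

theorem J_mul_marker_eq (i : Fin r) (s : Finset (Fin r)) :
    B.J i * B.marker s = B.marker (symmDiff s {i}) ∨
      B.J i * B.marker s = -B.marker (symmDiff s {i}) := by
  by_cases h : i ∈ s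
  · right
    have h1 : symmDiff s {i} = s.erase i := by
      ext j
      simp only [Finset.mem_symmDiff, Finset.mem_singleton, Finset.mem_erase]
      constructor
      · rintro (⟨h1, h2⟩ | ⟨rfl, h2⟩)
        · exact ⟨h2, h1⟩
        · exact absurd h h2
      · rintro ⟨h1, h2⟩
        exact Or.inl ⟨h2, h1⟩
    conv_lhs => rw [← Finset.insert_erase h, B.marker_insert (Finset.notMem_erase i s)]
    rw [h1, ← mul_assoc, B.J_sq, neg_one_mul]
  · left
    have h1 : symmDiff s {i} = insert i s := by
      ext j
      simp only [Finset.mem_symmDiff, Finset.mem_singleton, Finset.mem_insert]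
      constructor
      · rintro (⟨h1, _⟩ | ⟨h1, _⟩)
        · exact Or.inr h1
        · exact Or.inl h1
      · rintro (rfl | h1)
        · exact Or.inr ⟨rfl, h⟩
        · exact Or.inl ⟨h1, fun h2 => h (h2 ▸ h1)⟩
    rw [h1, B.marker_insert h]

end BrauerSystem

namespace MarkedDiagram

variable {r : ℕ}

/-- The edges of the diagram `X` are those of the product of the permutation `π` and the horizontal
edges given by the involution `p`: below the permutation, every pair `{i, p i}` is joined in either
row. -/
structure IsProduct (X : MarkedDiagram r) (π p : Perm (Fin r)) : Prop where
  involution : p * p = 1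
  vertical : ∀ i, p i = i → X.partner (Sum.inr i) = Sum.inl (π i)
  lower : ∀ i, p i ≠ i → X.partner (Sum.inr i) = Sum.inr (p i)
  upper : ∀ i, p i ≠ i → X.partner (Sum.inl (π i)) = Sum.inl (π (p i))

theorem IsProduct.vertical' {X : MarkedDiagram r} {π p : Perm (Fin r)} (h : X.IsProduct π p)
    {i : Fin r} (hi : p i = i) : X.partner (Sum.inl (π i)) = Sum.inr i := by
  rw [← h.vertical i hi, X.partner_partner]

/-- The unmarked diagram of the product of a permutation and the horizontal edges given by an
involution. -/
def ofProduct (π p : Perm (Fin r)) (hp : p * p = 1) : MarkedDiagram r where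
  partner := Sum.elim
    (fun j => if p (π.symm j) = π.symm j then Sum.inr (π.symm j) else
      Sum.inl (π (p (π.symm j))))
    (fun i => if p i = i then Sum.inl (π i) else Sum.inr (p i))
  partner_partner v := by
    have hpp := involution_apply hp
    rcases v with j | i
    · by_cases h : p (π.symm j) = π.symm j
      · simp [h]
      · have h' : π.symm j ≠ p (π.symm j) := Ne.symm h
        simp [h, h', hpp]
    · by_cases h : p i = i
      · simp [h]
      · have h' : i ≠ p i := Ne.symm h
        simp [h, h', hpp]
  partner_ne v := by
    rcases v with j | i
    · by_cases h : p (π.symm j) = π.symm j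
      · simp [h]
      · have h' : π (p (π.symm j)) ≠ j := fun h' => h (by
          rw [Equiv.eq_symm_apply]; exact h')
        simp [h, h']
    · by_cases h : p i = i <;> simp [h]
  marked _ := false
  num_lt_of_marked v h := by simp at h

theorem isProduct_ofProduct (π p : Perm (Fin r)) (hp : p * p = 1) :
    (ofProduct π p hp).IsProduct π p where
  involution := hp
  vertical i hi := by simp [ofProduct, hi]
  lower i hi := by simp [ofProduct, hi]
  upper i hi := by simp [ofProduct, hi]

/-- Change whether the rightmost or bottommost end `e` of an edge is marked. -/
def toggle (X : MarkedDiagram r) (e : Vertex r) (he : (X.partner e).num < e.num) :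
    MarkedDiagram r where
  partner := X.partner
  partner_partner := X.partner_partner
  partner_ne := X.partner_ne
  marked v := if v = e then !X.marked v else X.marked v
  num_lt_of_marked v h := by
    by_cases hv : v = e
    · rwa [hv]
    · rw [if_neg hv] at h
      exact X.num_lt_of_marked v h

theorem IsProduct.toggle {X : MarkedDiagram r} {π p : Perm (Fin r)} (h : X.IsProduct π p)
    (e : Vertex r) (he : (X.partner e).num < e.num) : (X.toggle e he).IsProduct π p :=
  ⟨h.involution, h.vertical, h.lower, h.upper⟩

/-- The marked vertices of the upper row. -/
def upperMarks (X : MarkedDiagram r) : Finset (Fin r) :=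
  Finset.univ.filter fun i => X.marked (Sum.inl i) = true

/-- The marked vertices of the lower row. -/
def lowerMarks (X : MarkedDiagram r) : Finset (Fin r) :=
  Finset.univ.filter fun i => X.marked (Sum.inr i) = true

theorem marks_toggle_inl (X : MarkedDiagram r) (i : Fin r)
    (he : (X.partner (Sum.inl i)).num < Vertex.num (Sum.inl i)) :
    (X.toggle (Sum.inl i) he).upperMarks = symmDiff X.upperMarks {i} ∧
      (X.toggle (Sum.inl i) he).lowerMarks = X.lowerMarks := by
  constructor
  · ext j
    by_cases h : j = i
    · subst h
      simp [upperMarks, toggle, Finset.mem_symmDiff]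
    · simp [upperMarks, toggle, Finset.mem_symmDiff, h]
  · ext j
    simp [lowerMarks, toggle]

theorem marks_toggle_inr (X : MarkedDiagram r) (i : Fin r)
    (he : (X.partner (Sum.inr i)).num < Vertex.num (Sum.inr i)) :
    (X.toggle (Sum.inr i) he).upperMarks = X.upperMarks ∧
      (X.toggle (Sum.inr i) he).lowerMarks = symmDiff X.lowerMarks {i} := by
  constructor
  · ext j
    simp [upperMarks, toggle]
  · ext j
    by_cases h : j = i
    · subst h
      simp [lowerMarks, toggle, Finset.mem_symmDiff]
    · simp [lowerMarks, toggle, Finset.mem_symmDiff, h]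

theorem num_inl_lt_num_inr (i j : Fin r) :
    Vertex.num (Sum.inl i) < Vertex.num (Sum.inr j) := by
  simp only [Vertex.num]
  omega

end MarkedDiagram

namespace BrauerSystem

open MarkedDiagram

variable {k : Type*} [CommRing k] {A : Type*} [Ring A] [Algebra k A] {r : ℕ} {x : k}
  (B : BrauerSystem A r x)

/-- The monomial that stands for the diagram `X` with edges given by `π` and `p`. -/
noncomputable def normal (X : MarkedDiagram r) (π p : Perm (Fin r)) : A :=
  B.marker X.upperMarks * B.perm π * B.cup p * B.marker X.lowerMarks

theorem J_mul_normal (X : MarkedDiagram r) (π p : Perm (Fin r)) (i : Fin r)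
    (he : (X.partner (Sum.inl i)).num < Vertex.num (Sum.inl i)) :
    B.J i * B.normal X π p = B.normal (X.toggle _ he) π p ∨
      B.J i * B.normal X π p = -B.normal (X.toggle _ he) π p := by
  obtain ⟨h1, h2⟩ := X.marks_toggle_inl i he
  simp only [normal, h1, h2, ← mul_assoc]
  rcases B.J_mul_marker_eq i X.upperMarks with h | h
  · exact Or.inl (by rw [h])
  · exact Or.inr (by rw [h]; simp only [neg_mul])

theorem normal_mul_J (X : MarkedDiagram r) (π p : Perm (Fin r)) (i : Fin r)
    (he : (X.partner (Sum.inr i)).num < Vertex.num (Sum.inr i)) :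
    B.normal X π p * B.J i = B.normal (X.toggle _ he) π p ∨
      B.normal X π p * B.J i = -B.normal (X.toggle _ he) π p := by
  obtain ⟨h1, h2⟩ := X.marks_toggle_inr i he
  simp only [normal, h1, h2]
  rw [mul_assoc _ (B.marker X.lowerMarks), ← B.J_mul_marker]
  rcases B.J_mul_marker_eq i X.lowerMarks with h | h
  · exact Or.inl (by rw [h])
  · exact Or.inr (by rw [h, mul_neg])

/-- The elements that stand for diagrams with edges given by `π` and `p`, up to sign. -/
def IsNormal (π p : Perm (Fin r)) (a : A) : Prop :=
  ∃ X : MarkedDiagram r, X.IsProduct π p ∧ (a = B.normal X π p ∨ a = -B.normal X π p)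

variable {B}

theorem IsNormal.neg {π p : Perm (Fin r)} {a : A} (h : B.IsNormal π p a) :
    B.IsNormal π p (-a) := by
  obtain ⟨X, hX, rfl | rfl⟩ := h
  · exact ⟨X, hX, Or.inr rfl⟩
  · exact ⟨X, hX, Or.inl (neg_neg _)⟩

theorem isNormal_of_eq_or {π p : Perm (Fin r)} {a b : A} (hb : B.IsNormal π p b)
    (h : a = b ∨ a = -b) : B.IsNormal π p a := by
  rcases h with rfl | rfl
  · exact hb
  · exact hb.neg

theorem isNormal_normal {π p : Perm (Fin r)} {X : MarkedDiagram r} (hX : X.IsProduct π p) :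
    B.IsNormal π p (B.normal X π p) := ⟨X, hX, Or.inl rfl⟩

theorem isNormal_normal_mul_J {π p : Perm (Fin r)} {X : MarkedDiagram r} (hX : X.IsProduct π p)
    (i : Fin r) : B.IsNormal π p (B.normal X π p * B.J i) := by
  have key : ∀ i, (X.partner (Sum.inr i)).num < Vertex.num (Sum.inr i) →
      B.IsNormal π p (B.normal X π p * B.J i) := fun i he =>
    isNormal_of_eq_or (isNormal_normal (hX.toggle _ he)) (B.normal_mul_J X π p i he)
  by_cases hi : p i = i
  · refine key i ?_
    rw [hX.vertical i hi]
    exact num_inl_lt_num_inr _ _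
  · by_cases he : (X.partner (Sum.inr i)).num < Vertex.num (Sum.inr i)
    · exact key i he
    · -- the mark is moved to the other end of the horizontal edge
      have h1 : B.normal X π p * B.J i = -(B.normal X π p * B.J (p i)) := by
        simp only [normal]
        rw [mul_assoc _ (B.marker _), ← B.J_mul_marker, mul_assoc _ (B.marker _),
          ← B.J_mul_marker, ← mul_assoc, mul_assoc _ (B.cup p), B.cup_mul_J hX.involution hi]
        simp only [mul_neg, neg_mul, mul_assoc]
      rw [h1]
      refine (key (p i) ?_).neg
      have h2 := num_partner_ne X (Sum.inr i)
      rw [hX.lower i hi] at he h2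
      have h3 := hX.lower i hi
      rw [← h3, X.partner_partner, h3]
      omega

theorem isNormal_J_mul_normal {π p : Perm (Fin r)} {X : MarkedDiagram r} (hX : X.IsProduct π p)
    (j : Fin r) : B.IsNormal π p (B.J j * B.normal X π p) := by
  have key : ∀ i, (X.partner (Sum.inl i)).num < Vertex.num (Sum.inl i) →
      B.IsNormal π p (B.J i * B.normal X π p) := fun i he =>
    isNormal_of_eq_or (isNormal_normal (hX.toggle _ he)) (B.J_mul_normal X π p i he)
  obtain ⟨i, rfl⟩ := π.surjective j
  have h0 : ∀ i, B.J (π i) * B.normal X π p =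
      B.marker X.upperMarks * B.perm π * (B.J i * B.cup p) * B.marker X.lowerMarks := by
    intro i
    rw [normal, ← mul_assoc, ← mul_assoc, ← mul_assoc, B.J_mul_marker,
      mul_assoc (B.marker X.upperMarks), ← B.perm_J]
    simp only [mul_assoc]
  by_cases hi : p i = i
  · have h1 : B.J (π i) * B.normal X π p = B.normal X π p * B.J i := by
      rw [h0, B.J_mul_cup_of_fixed hX.involution hi, normal, mul_assoc _ (B.marker X.lowerMarks),
        ← B.J_mul_marker]
      simp only [mul_assoc]
    rw [h1]
    exact isNormal_normal_mul_J hX i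
  · by_cases he : (X.partner (Sum.inl (π i))).num < Vertex.num (Sum.inl (π i))
    · exact key _ he
    · have h1 : B.J (π i) * B.normal X π p = -(B.J (π (p i)) * B.normal X π p) := by
        rw [h0, h0, B.J_mul_cup hX.involution hi, mul_neg, neg_mul]
      rw [h1]
      refine (key (π (p i)) ?_).neg
      have h2 := num_partner_ne X (Sum.inl (π i))
      have h3 := hX.upper i hi
      rw [← h3, X.partner_partner, h3]
      rw [h3] at he h2
      omega

/-- Every monomial stands for a diagram, up to sign. -/
theorem isNormal_monomial {u v : A} (hu : u ∈ B.markers) (hv : v ∈ B.markers)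
    {π p : Perm (Fin r)} (hp : p * p = 1) : B.IsNormal π p (u * B.perm π * B.cup p * v) := by
  have h1 : B.IsNormal π p (B.perm π * B.cup p) := by
    refine ⟨ofProduct π p hp, isProduct_ofProduct π p hp, Or.inl ?_⟩
    have hu : (ofProduct π p hp).upperMarks = ∅ := by ext; simp [upperMarks, ofProduct]
    have hl : (ofProduct π p hp).lowerMarks = ∅ := by ext; simp [lowerMarks, ofProduct]
    rw [normal, hu, hl, marker_empty, one_mul, mul_one]
  have h2 : B.IsNormal π p (u * (B.perm π * B.cup p)) := by
    induction hu using Submonoid.closure_induction_left with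
    | one => rwa [one_mul]
    | mul_left a ha b hb ih =>
      obtain ⟨i, rfl⟩ := ha
      obtain ⟨X, hX, h⟩ := ih
      refine isNormal_of_eq_or (isNormal_J_mul_normal hX i) ?_
      rw [mul_assoc]
      rcases h with h | h
      · exact Or.inl (by rw [h])
      · exact Or.inr (by rw [h, mul_neg])
  rw [mul_assoc u]
  induction hv using Submonoid.closure_induction_right with
  | one => rwa [mul_one]
  | mul_right b hb a ha ih =>
    obtain ⟨i, rfl⟩ := ha
    obtain ⟨X, hX, h⟩ := ih
    refine isNormal_of_eq_or (isNormal_normal_mul_J hX i) ?_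
    rw [← mul_assoc]
    rcases h with h | h
    · exact Or.inl (by rw [h])
    · exact Or.inr (by rw [h, neg_mul])

variable (B)

/-- The element that stands for a diagram does not depend on the choice of the permutation. -/
theorem normal_eq {X : MarkedDiagram r} {π p π' p' : Perm (Fin r)} (h : X.IsProduct π p)
    (h' : X.IsProduct π' p') : B.normal X π p = B.normal X π' p' := by
  have hpp : p = p' := by
    ext1 i
    by_cases h1 : p i = i <;> by_cases h2 : p' i = i
    · rw [h1, h2]
    · have := (h.vertical i h1).symm.trans (h'.lower i h2)
      simp at this
    · have := (h.lower i h1).symm.trans (h'.vertical i h2)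
      simp at this
    · exact Sum.inr_injective ((h.lower i h1).symm.trans (h'.lower i h2))
  subst hpp
  have hπ : π = π' * (π'⁻¹ * π) := by rw [mul_inv_cancel_left]
  have hfix : ∀ i, p i = i → (π'⁻¹ * π) i = i := by
    intro i hi
    rw [Perm.mul_apply, Perm.inv_eq_iff_eq]
    exact Sum.inl_injective ((h.vertical i hi).symm.trans (h'.vertical i hi))
  have hcomm : ∀ i, (π'⁻¹ * π) (p i) = p ((π'⁻¹ * π) i) := by
    intro i
    by_cases hi : p i = i
    · rw [hi, hfix i hi, hi]
    · have h1 : p ((π'⁻¹ * π) i) ≠ (π'⁻¹ * π) i := by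
        intro h1
        have h2 := (π'⁻¹ * π).injective (hfix _ h1)
        rw [h2] at h1
        exact hi h1
      have h2 := h.upper i hi
      rw [show π i = π' ((π'⁻¹ * π) i) by rw [← Perm.mul_apply, mul_inv_cancel_left],
        h'.upper _ h1] at h2
      rw [Perm.mul_apply _ _ (p i), Perm.inv_eq_iff_eq]
      exact (Sum.inl_injective h2).symm
  rw [normal, normal, mul_assoc _ (B.perm π), hπ, map_mul, mul_assoc (B.perm π'),
    B.perm_mul_cup h.involution hcomm hfix, ← mul_assoc]

end BrauerSystem

end UnitaryBrauer

namespace UnitaryBrauer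

open Equiv

namespace MarkedDiagram

variable {r : ℕ}

/-! ### Every diagram is a product of a permutation and horizontal edges -/

/-- The involution of the lower vertices that is given by the horizontal edges of the lower row. -/
def lowerInvolution (X : MarkedDiagram r) : Perm (Fin r) :=
  Function.Involutive.toPerm (fun i => Sum.elim (fun _ => i) id (X.partner (Sum.inr i))) (by
    intro i
    rcases h : X.partner (Sum.inr i) with j | j
    · simp [h]
    · have h' : X.partner (Sum.inr j) = Sum.inr i := by rw [← h, X.partner_partner]
      have e : Sum.elim (fun _ => i) id (X.partner (Sum.inr i)) = j := by rw [h]; rfl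
      simp only [e, h']
      rfl)

/-- The involution of the upper vertices that is given by the horizontal edges of the upper row. -/
def upperInvolution (X : MarkedDiagram r) : Perm (Fin r) :=
  Function.Involutive.toPerm (fun i => Sum.elim id (fun _ => i) (X.partner (Sum.inl i))) (by
    intro i
    rcases h : X.partner (Sum.inl i) with j | j
    · have h' : X.partner (Sum.inl j) = Sum.inl i := by rw [← h, X.partner_partner]
      have e : Sum.elim id (fun _ => i) (X.partner (Sum.inl i)) = j := by rw [h]; rfl
      simp only [e, h']
      rfl
    · simp [h])

theorem lowerInvolution_apply (X : MarkedDiagram r) (i : Fin r) :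
    X.lowerInvolution i = Sum.elim (fun _ => i) id (X.partner (Sum.inr i)) := rfl

theorem upperInvolution_apply (X : MarkedDiagram r) (i : Fin r) :
    X.upperInvolution i = Sum.elim id (fun _ => i) (X.partner (Sum.inl i)) := rfl

theorem lowerInvolution_mul_self (X : MarkedDiagram r) :
    X.lowerInvolution * X.lowerInvolution = 1 := by
  ext1 i
  exact Function.Involutive.toPerm_involutive _ i

theorem upperInvolution_mul_self (X : MarkedDiagram r) :
    X.upperInvolution * X.upperInvolution = 1 := by
  ext1 i
  exact Function.Involutive.toPerm_involutive _ i

theorem lowerInvolution_eq_self_iff (X : MarkedDiagram r) (i : Fin r) :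
    X.lowerInvolution i = i ↔ ∃ j, X.partner (Sum.inr i) = Sum.inl j := by
  rw [lowerInvolution_apply]
  rcases h : X.partner (Sum.inr i) with j | j
  · simp
  · simp only [Sum.elim_inr, id, reduceCtorEq, exists_false, iff_false]
    rintro rfl
    exact X.partner_ne _ h

theorem upperInvolution_eq_self_iff (X : MarkedDiagram r) (i : Fin r) :
    X.upperInvolution i = i ↔ ∃ j, X.partner (Sum.inl i) = Sum.inr j := by
  rw [upperInvolution_apply]
  rcases h : X.partner (Sum.inl i) with j | j
  · simp only [Sum.elim_inl, id, reduceCtorEq, exists_false, iff_false]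
    rintro rfl
    exact X.partner_ne _ h
  · simp

theorem card_support_lower_eq_upper (X : MarkedDiagram r) :
    X.lowerInvolution.support.card = X.upperInvolution.support.card := by
  have h : (X.lowerInvolution.supportᶜ).card = (X.upperInvolution.supportᶜ).card := by
    have hl : ∀ i, i ∈ X.lowerInvolution.supportᶜ ↔ ∃ j, X.partner (Sum.inr i) = Sum.inl j := by
      intro i
      rw [Finset.mem_compl, Perm.notMem_support, lowerInvolution_eq_self_iff]
    have hu : ∀ i, i ∈ X.upperInvolution.supportᶜ ↔ ∃ j, X.partner (Sum.inl i) = Sum.inr j := by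
      intro i
      rw [Finset.mem_compl, Perm.notMem_support, upperInvolution_eq_self_iff]
    have hs : ∀ i j, X.partner (Sum.inr i) = Sum.inl j ↔ X.partner (Sum.inl j) = Sum.inr i :=
      fun i j => ⟨fun h => by rw [← h, X.partner_partner], fun h => by
        rw [← h, X.partner_partner]⟩
    refine Finset.card_bij (fun i hi => ((hl i).1 hi).choose) ?_ ?_ ?_
    · intro i hi
      rw [hu]
      exact ⟨i, (hs _ _).1 ((hl i).1 hi).choose_spec⟩
    · intro i hi i' hi' h
      have h1 := ((hl i).1 hi).choose_spec
      have h2 := ((hl i').1 hi').choose_spec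
      rw [← h, hs] at h2
      rw [hs] at h1
      exact Sum.inr_injective (h1.symm.trans h2)
    · intro j hj
      obtain ⟨i, hi⟩ := (hu j).1 hj
      rw [← hs] at hi
      have hi' := (hl i).2 ⟨j, hi⟩
      exact ⟨i, hi', Sum.inl_injective (((hl i).1 hi').choose_spec.symm.trans hi)⟩
  have h1 := Finset.card_compl X.lowerInvolution.support
  have h2 := Finset.card_compl X.upperInvolution.support
  have h3 := Finset.card_le_univ X.lowerInvolution.support
  have h4 := Finset.card_le_univ X.upperInvolution.support
  omega

end MarkedDiagram

theorem cycleType_involution {α : Type*} [Fintype α] [DecidableEq α] {p : Perm α}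
    (hp : p * p = 1) : p.cycleType = Multiset.replicate (p.support.card / 2) 2 := by
  have h : ∀ c ∈ p.cycleType, c = 2 := by
    have : p ^ 2 = 1 := by rw [sq, hp]
    exact (Perm.pow_prime_eq_one_iff (p := 2)).1 this
  have h1 := Multiset.eq_replicate_card.2 h
  have h2 := Perm.sum_cycleType p
  rw [h1, Multiset.sum_replicate, smul_eq_mul] at h2
  rw [← h2, Nat.mul_div_cancel _ two_pos]
  exact h1

namespace MarkedDiagram

variable {r : ℕ}

theorem exists_isProduct (X : MarkedDiagram r) : ∃ π p, X.IsProduct π p := by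
  set p := X.lowerInvolution with hpdef
  set q := X.upperInvolution with hqdef
  have hp := X.lowerInvolution_mul_self
  have hq := X.upperInvolution_mul_self
  -- an equivalence that carries the pairs of the lower row to those of the upper row
  obtain ⟨g, hg⟩ : ∃ g : Perm (Fin r), ∀ i, g (p i) = q (g i) := by
    have h : IsConj p q := by
      rw [Perm.isConj_iff_cycleType_eq, cycleType_involution hp, cycleType_involution hq,
        X.card_support_lower_eq_upper]
    obtain ⟨g, hg⟩ := isConj_iff.1 h
    refine ⟨g, fun i => ?_⟩
    rw [← hg, Perm.mul_apply, Perm.mul_apply, Perm.inv_eq_iff_eq.2 rfl]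
  -- combined with the vertical edges
  let f : Fin r → Fin r := fun i => Sum.elim id (fun _ => g i) (X.partner (Sum.inr i))
  have hfix : ∀ i, p i = i → X.partner (Sum.inr i) = Sum.inl (f i) := by
    intro i hi
    obtain ⟨j, hj⟩ := (X.lowerInvolution_eq_self_iff i).1 hi
    simp only [f]
    rw [hj]
    rfl
  have hmov : ∀ i, p i ≠ i → f i = g i ∧ X.partner (Sum.inr i) = Sum.inr (p i) := by
    intro i hi
    rcases h : X.partner (Sum.inr i) with j | j
    · exact absurd ((X.lowerInvolution_eq_self_iff i).2 ⟨j, h⟩) hi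
    · refine ⟨by simp only [f, h, Sum.elim_inr], ?_⟩
      rw [hpdef, lowerInvolution_apply, h]
      rfl
  have hqf : ∀ i, p i = i → q (f i) = f i := by
    intro i hi
    refine (X.upperInvolution_eq_self_iff _).2 ⟨i, ?_⟩
    rw [← hfix i hi, X.partner_partner]
  have hqg : ∀ i, p i ≠ i → q (g i) ≠ g i := by
    intro i hi h
    rw [← hg] at h
    exact hi (g.injective h)
  have hf : Function.Injective f := by
    intro i j hij
    by_cases hi : p i = i <;> by_cases hj : p j = j
    · have h1 := hfix i hi
      rw [hij, ← hfix j hj] at h1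
      exact Sum.inr_injective (Function.LeftInverse.injective X.partner_partner h1)
    · have h1 := hqf i hi
      rw [hij, (hmov j hj).1] at h1
      exact absurd h1 (hqg j hj)
    · have h1 := hqf j hj
      rw [← hij, (hmov i hi).1] at h1
      exact absurd h1 (hqg i hi)
    · rw [(hmov i hi).1, (hmov j hj).1] at hij
      exact g.injective hij
  refine ⟨Equiv.ofBijective f (Finite.injective_iff_bijective.1 hf), p, hp, hfix,
    fun i hi => (hmov i hi).2, fun i hi => ?_⟩
  have hi' : p (p i) ≠ p i := fun h => hi (p.injective h)
  simp only [Equiv.ofBijective_apply]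
  rw [(hmov i hi).1, (hmov (p i) hi').1, hg]
  have h1 := hqg i hi
  rcases h : X.partner (Sum.inl (g i)) with j | j
  · rw [hqdef, upperInvolution_apply, h]
    rfl
  · exact absurd ((X.upperInvolution_eq_self_iff _).2 ⟨j, h⟩) h1

end MarkedDiagram

/-! ### The operators on functions of colourings -/

section Operators

variable {r : ℕ}

/-- Give the vertices `i` and `j` the dual colours `s` and `s.conj`. -/
def recolor (a : Fin r → Color r) (i j : Fin r) (s : Color r) : Fin r → Color r :=
  Function.update (Function.update a i s) j s.conj

theorem recolor_left {a : Fin r → Color r} {i j : Fin r} (h : i ≠ j) (s : Color r) :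
    recolor a i j s i = s := by
  simp [recolor, h]

theorem recolor_right (a : Fin r → Color r) (i j : Fin r) (s : Color r) :
    recolor a i j s j = s.conj := by
  simp [recolor]

theorem recolor_of_ne (a : Fin r → Color r) {i j l : Fin r} (s : Color r) (hi : l ≠ i)
    (hj : l ≠ j) : recolor a i j s l = a l := by
  simp [recolor, hi, hj]

theorem recolor_ext {a b : Fin r → Color r} {i j : Fin r} (s : Color r)
    (h : ∀ l, l ≠ i → l ≠ j → a l = b l) : recolor a i j s = recolor b i j s := by
  funext l
  by_cases hj : l = j
  · rw [hj, recolor_right, recolor_right]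
  by_cases hi : l = i
  · subst hi
    rw [recolor_left hj, recolor_left hj]
  · rw [recolor_of_ne _ _ hi hj, recolor_of_ne _ _ hi hj, h l hi hj]

/-- The action of the symmetric group on functions of colourings. -/
def permOp (r : ℕ) : Perm (Fin r) →* Module.End ℂ ((Fin r → Color r) → ℂ) where
  toFun π := LinearMap.funLeft ℂ ℂ fun a => a ∘ π
  map_one' := rfl
  map_mul' _ _ := rfl

/-- The complex structure on the `i`-th factor. -/
noncomputable def complexOp (i : Fin r) : Module.End ℂ ((Fin r → Color r) → ℂ) where
  toFun f a := (a i).eigen * f a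
  map_add' f g := by ext a; simp [mul_add]
  map_smul' t f := by ext a; simp [mul_left_comm]

/-- The contraction of the `i`-th and the `j`-th factor, followed by the insertion of the invariant
tensor. -/
noncomputable def contractOp (i j : Fin r) : Module.End ℂ ((Fin r → Color r) → ℂ) where
  toFun f a := if a i = (a j).conj then ∑ s, f (recolor a i j s) else 0
  map_add' f g := by
    ext a
    simp only [Pi.add_apply]
    split_ifs <;> simp [Finset.sum_add_distrib]
  map_smul' t f := by
    ext a
    simp only [Pi.smul_apply, RingHom.id_apply]
    split_ifs <;> simp [Finset.mul_sum]

theorem permOp_apply (π : Perm (Fin r)) (f : (Fin r → Color r) → ℂ) (a : Fin r → Color r) :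
    permOp r π f a = f (a ∘ π) := rfl

theorem complexOp_apply (i : Fin r) (f : (Fin r → Color r) → ℂ) (a : Fin r → Color r) :
    complexOp i f a = (a i).eigen * f a := rfl

theorem contractOp_apply (i j : Fin r) (f : (Fin r → Color r) → ℂ) (a : Fin r → Color r) :
    contractOp i j f a = if a i = (a j).conj then ∑ s, f (recolor a i j s) else 0 := rfl

theorem eq_conj_iff {s t : Color r} : s = t.conj ↔ t = s.conj :=
  ⟨fun h => by rw [h, Color.conj_conj], fun h => by rw [h, Color.conj_conj]⟩

theorem end_ext {f g : Module.End ℂ ((Fin r → Color r) → ℂ)} (h : ∀ u a, f u a = g u a) : f = g :=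
  LinearMap.ext fun u => funext fun a => h u a

theorem sum_eigen : ∑ s : Color r, s.eigen = 0 := by
  rw [Fintype.sum_prod_type]
  simp [Color.eigen]

/-- Permutations, complex structures and contractions act on the functions of colourings, with the
parameter `4r`. -/
noncomputable def operatorSystem (r : ℕ) :
    BrauerSystem (Module.End ℂ ((Fin r → Color r) → ℂ)) r ((4 * r : ℕ) : ℂ) where
  perm := permOp r
  J := complexOp
  c := contractOp
  perm_J π i := rfl
  perm_c π i j h := end_ext fun u a => by
    simp only [Module.End.mul_apply, permOp_apply, contractOp_apply, Function.comp_apply]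
    congr 1
    refine Finset.sum_congr rfl fun s _ => congrArg u (funext fun l => ?_)
    have h' : π i ≠ π j := fun e => h (π.injective e)
    rw [Function.comp_apply]
    by_cases hj : l = j
    · rw [hj, recolor_right, recolor_right]
    by_cases hi : l = i
    · rw [hi, recolor_left h, recolor_left h']
    · rw [recolor_of_ne _ _ hi hj, recolor_of_ne _ _ (fun e => hi (π.injective e))
        (fun e => hj (π.injective e)), Function.comp_apply]
  J_sq i := end_ext fun u a => by
    rw [Module.End.mul_apply, complexOp_apply, complexOp_apply, ← mul_assoc, ← sq,
      Color.eigen_sq, neg_one_mul]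
    rfl
  J_comm i j := end_ext fun u a => by
    simp only [Module.End.mul_apply, complexOp_apply]
    ring
  c_sq i j h := end_ext fun u a => by
    have h1 : ∀ s t, recolor (recolor a i j s) i j t = recolor a i j t := fun s t =>
      recolor_ext t fun l hi hj => recolor_of_ne _ _ hi hj
    rw [LinearMap.smul_apply]
    simp only [Module.End.mul_apply, contractOp_apply, Pi.smul_apply, recolor_left h,
      recolor_right, Color.conj_conj, h1, if_true, Finset.sum_const, Finset.card_univ]
    split_ifs
    · rw [nsmul_eq_mul, smul_eq_mul]
      congr 2
      simp [Fintype.card_prod, Fintype.card_sum]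
      ring
    · rw [smul_zero]
  swap_c i j h := end_ext fun u a => by
    simp only [Module.End.mul_apply, permOp_apply, contractOp_apply, Function.comp_apply,
      swap_apply_left, swap_apply_right]
    rw [if_congr eq_conj_iff (Finset.sum_congr rfl fun s _ => congrArg u ?_) rfl]
    exact recolor_ext s fun l hi hj => by
      rw [Function.comp_apply, swap_apply_of_ne_of_ne hi hj]
  c_swap i j h := end_ext fun u a => by
    simp only [Module.End.mul_apply, permOp_apply, contractOp_apply]
    congr 1
    rw [← (Function.Involutive.bijective (Color.conj_conj (r := r))).sum_comp]
    refine Finset.sum_congr rfl fun s _ => congrArg u (funext fun l => ?_)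
    rw [Function.comp_apply]
    by_cases hj : l = j
    · rw [hj, swap_apply_right, recolor_left h, recolor_right]
    by_cases hi : l = i
    · rw [hi, swap_apply_left, recolor_left h, recolor_right, Color.conj_conj]
    · rw [swap_apply_of_ne_of_ne hi hj, recolor_of_ne _ _ hi hj, recolor_of_ne _ _ hi hj]
  c_mul_c i j l hij hjl hil := end_ext fun u a => by
    simp only [Module.End.mul_apply, permOp_apply, contractOp_apply, Function.comp_apply,
      recolor_right, recolor_of_ne _ _ hil.symm hjl.symm, swap_apply_right,
      swap_apply_of_ne_of_ne hij.symm hjl, Color.conj_injective.eq_iff]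
    rw [Finset.sum_ite_eq' Finset.univ (a l), if_pos (Finset.mem_univ _),
      if_congr eq_conj_iff (Finset.sum_congr rfl fun s _ => congrArg u ?_) rfl]
    refine recolor_ext s fun m hj hl => ?_
    rw [Function.comp_apply]
    by_cases hi : m = i
    · rw [hi, swap_apply_left, recolor_left hij]
    · rw [swap_apply_of_ne_of_ne hi hl, recolor_of_ne _ _ hi hj]
  c_J_c i j h := end_ext fun u a => by
    have h1 : ∀ s t, recolor (recolor a i j s) i j t = recolor a i j t := fun s t =>
      recolor_ext t fun l hi hj => recolor_of_ne _ _ hi hj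
    simp only [Module.End.mul_apply, contractOp_apply, complexOp_apply, recolor_left h,
      recolor_right, Color.conj_conj, h1, if_true]
    rw [← Finset.sum_mul, sum_eigen, zero_mul, ite_self]
    rfl
  J_c i j h := end_ext fun u a => by
    rw [LinearMap.neg_apply, Pi.neg_apply]
    simp only [Module.End.mul_apply, contractOp_apply, complexOp_apply]
    split_ifs with h1
    · rw [h1, Color.eigen_conj, neg_mul]
    · simp
  c_J i j h := end_ext fun u a => by
    rw [LinearMap.neg_apply, Pi.neg_apply]
    simp only [Module.End.mul_apply, contractOp_apply, complexOp_apply, recolor_left h,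
      recolor_right, Color.eigen_conj]
    split_ifs
    · rw [← Finset.sum_neg_distrib]
      exact Finset.sum_congr rfl fun s _ => by ring
    · simp
  J_c_comm i j l h hi hj := end_ext fun u a => by
    simp only [Module.End.mul_apply, contractOp_apply, complexOp_apply, recolor_of_ne _ _ hi hj]
    split_ifs
    · rw [Finset.mul_sum]
    · rw [mul_zero]
  c_comm i j l m hij hlm hil him hjl hjm := end_ext fun u a => by
    have h1 : ∀ s t, recolor (recolor a i j s) l m t = recolor (recolor a l m t) i j s := by
      intro s t
      funext n
      by_cases hi : n = i
      · rw [hi, recolor_left hij, recolor_of_ne _ _ hil him, recolor_left hij]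
      by_cases hj : n = j
      · rw [hj, recolor_right, recolor_of_ne _ _ hjl hjm, recolor_right]
      by_cases hl : n = l
      · rw [hl, recolor_left hlm, recolor_of_ne _ _ hil.symm hjl.symm, recolor_left hlm]
      by_cases hm : n = m
      · rw [hm, recolor_right, recolor_of_ne _ _ him.symm hjm.symm, recolor_right]
      · rw [recolor_of_ne _ _ hl hm, recolor_of_ne _ _ hi hj, recolor_of_ne _ _ hi hj,
          recolor_of_ne _ _ hl hm]
    simp only [Module.End.mul_apply, contractOp_apply, recolor_of_ne _ _ hil him,
      recolor_of_ne _ _ hjl hjm, recolor_of_ne _ _ hil.symm hjl.symm,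
      recolor_of_ne _ _ him.symm hjm.symm, h1]
    split_ifs
    · exact Finset.sum_comm
    · simp
    · simp
    · rfl

end Operators

end UnitaryBrauer

namespace UnitaryBrauer

open Equiv

/-! ### The operators of diagrams in normal form -/

section Operators

variable {r : ℕ}

/-- The colourings `a` of the upper and `b` of the lower row are compatible with the horizontal
edges given by the involution `p` and with the vertical straight edges at the fixed points. -/
def CupConsistent (p : Perm (Fin r)) (a b : Fin r → Color r) : Prop :=
  (∀ i, p i = i → a i = b i) ∧
    ∀ i, p i ≠ i → a (p i) = (a i).conj ∧ b (p i) = (b i).conj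

theorem cupConsistent_iff {p : Perm (Fin r)} (hp : p * p = 1) {i : Fin r} (hi : p i ≠ i)
    (a b : Fin r → Color r) (s : Color r) :
    CupConsistent (swap i (p i) * p) (recolor a i (p i) s) b ∧ a i = (a (p i)).conj ↔
      s = b i ∧ CupConsistent p a b := by
  have hpp := involution_apply hp
  have hqi : (swap i (p i) * p) i = i := swap_mul_apply_self
  have hqj : (swap i (p i) * p) (p i) = p i := swap_mul_apply_image hp
  have hq : ∀ l, l ≠ i → l ≠ p i → (swap i (p i) * p) l = p l := fun l h1 h2 =>
    swap_mul_apply_of_ne hp h1 h2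
  have hne : ∀ l, l ≠ i → l ≠ p i → p l ≠ i ∧ p l ≠ p i := fun l h1 h2 =>
    ⟨fun h => h2 (by rw [← h, hpp]), fun h => h1 (p.injective h)⟩
  constructor
  · rintro ⟨⟨h1, h2⟩, h3⟩
    have e1 := h1 i hqi
    have e2 := h1 (p i) hqj
    rw [recolor_left hi.symm] at e1
    rw [recolor_right] at e2
    refine ⟨e1, fun l hl => ?_, fun l hl => ?_⟩
    · have hli : l ≠ i := by rintro rfl; exact hi hl
      have hlj : l ≠ p i := by rintro rfl; exact hi (p.injective hl)
      have e3 := h1 l (by rw [hq l hli hlj, hl])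
      rwa [recolor_of_ne _ _ hli hlj] at e3
    · by_cases hli : l = i
      · subst hli
        exact ⟨eq_conj_iff.1 h3, by rw [← e2, e1]⟩
      by_cases hlj : l = p i
      · subst hlj
        rw [hpp]
        exact ⟨h3, by rw [← e2, Color.conj_conj, e1]⟩
      · have e3 := h2 l (by rwa [hq l hli hlj])
        rwa [hq l hli hlj, recolor_of_ne _ _ hli hlj,
          recolor_of_ne _ _ (hne l hli hlj).1 (hne l hli hlj).2] at e3
  · rintro ⟨rfl, h1, h2⟩
    refine ⟨⟨fun l hl => ?_, fun l hl => ?_⟩, eq_conj_iff.1 (h2 i hi).1⟩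
    · by_cases hli : l = i
      · rw [hli, recolor_left hi.symm]
      by_cases hlj : l = p i
      · rw [hlj, recolor_right, (h2 i hi).2]
      · rw [hq l hli hlj] at hl
        rw [recolor_of_ne _ _ hli hlj, h1 l hl]
    · have hli : l ≠ i := by rintro rfl; exact hl hqi
      have hlj : l ≠ p i := by rintro rfl; exact hl hqj
      rw [hq l hli hlj] at hl ⊢
      rw [recolor_of_ne _ _ hli hlj, recolor_of_ne _ _ (hne l hli hlj).1 (hne l hli hlj).2]
      exact h2 l hl

open Classical in
theorem cup_operatorSystem_apply {p : Perm (Fin r)} (hp : p * p = 1)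
    (f : (Fin r → Color r) → ℂ) (a : Fin r → Color r) :
    (operatorSystem r).cup p f a = ∑ b, if CupConsistent p a b then f b else 0 := by
  induction hn : p.support.card using Nat.strong_induction_on generalizing p a with
  | _ n ih =>
    by_cases h1 : p = 1
    · subst h1
      have h : ∀ b, CupConsistent (1 : Perm (Fin r)) a b ↔ b = a := by
        intro b
        constructor
        · rintro ⟨h, _⟩
          exact funext fun i => (h i rfl).symm
        · rintro rfl
          exact ⟨fun _ _ => rfl, fun i hi => absurd rfl hi⟩
      rw [BrauerSystem.cup_one]
      simp only [h]
      rw [Finset.sum_ite_eq' Finset.univ a, if_pos (Finset.mem_univ _)]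
      rfl
    · obtain ⟨i, hi⟩ : ∃ i, p i ≠ i := by
        by_contra! h
        exact h1 (Equiv.ext h)
      have hcard : (swap i (p i) * p).support.card < n := by
        rw [← hn]
        exact Perm.card_support_swap_mul hi
      have hq := swap_mul_involution_of_moved (i := i) hp
      rw [BrauerSystem.cup_eq_c_mul _ hp hi, Module.End.mul_apply]
      change contractOp i (p i) _ a = _
      rw [contractOp_apply]
      have h2 : ∀ s, (operatorSystem r).cup (swap i (p i) * p) f (recolor a i (p i) s) =
          ∑ b, if CupConsistent (swap i (p i) * p) (recolor a i (p i) s) b then f b else 0 :=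
        fun s => ih _ hcard hq _ rfl
      simp only [h2]
      rw [Finset.sum_comm]
      have h3 : ∀ b s, (if a i = (a (p i)).conj then
          (if CupConsistent (swap i (p i) * p) (recolor a i (p i) s) b then f b else 0) else 0) =
          if s = b i then (if CupConsistent p a b then f b else 0) else 0 := by
        intro b s
        rw [← ite_and, ← ite_and]
        refine if_congr ?_ rfl rfl
        rw [and_comm, cupConsistent_iff hp hi]
      calc (if a i = (a (p i)).conj then ∑ b, ∑ s,
            (if CupConsistent (swap i (p i) * p) (recolor a i (p i) s) b then f b else 0) else 0)
          = ∑ b, ∑ s, (if a i = (a (p i)).conj then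
            (if CupConsistent (swap i (p i) * p) (recolor a i (p i) s) b then f b else 0)
              else 0) := by
            split_ifs
            · rfl
            · simp
        _ = _ := by
            simp only [h3]
            exact Finset.sum_congr rfl fun b _ => by
              rw [Finset.sum_ite_eq' Finset.univ (b i), if_pos (Finset.mem_univ _)]

theorem marker_operatorSystem_apply (s : Finset (Fin r)) (f : (Fin r → Color r) → ℂ)
    (a : Fin r → Color r) :
    (operatorSystem r).marker s f a = (∏ i ∈ s, (a i).eigen) * f a := by
  induction s using Finset.induction_on with
  | empty => rw [BrauerSystem.marker_empty, Finset.prod_empty, one_mul]; rfl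
  | insert i s hi ih =>
    rw [BrauerSystem.marker_insert _ hi, Module.End.mul_apply]
    change complexOp i _ a = _
    rw [complexOp_apply, ih, Finset.prod_insert hi, mul_assoc]

namespace MarkedDiagram

theorem IsProduct.consistent_iff {X : MarkedDiagram r} {π p : Perm (Fin r)}
    (h : X.IsProduct π p) (a b : Fin r → Color r) :
    X.Consistent (Sum.elim a b) ↔ CupConsistent p (a ∘ π) b := by
  constructor
  · intro hc
    refine ⟨fun i hi => ?_, fun i hi => ⟨?_, ?_⟩⟩
    · have := hc (Sum.inr i)
      simpa [horizontal, h.vertical i hi] using this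
    · have := hc (Sum.inl (π i))
      simpa [horizontal, h.upper i hi] using this
    · have := hc (Sum.inr i)
      simpa [horizontal, h.lower i hi] using this
  · rintro ⟨h1, h2⟩ v
    rcases v with j | i
    · obtain ⟨i, rfl⟩ := π.surjective j
      by_cases hi : p i = i
      · simpa [horizontal, h.vertical' hi] using (h1 i hi).symm
      · simpa [horizontal, h.upper i hi] using (h2 i hi).1
    · by_cases hi : p i = i
      · simpa [horizontal, h.vertical i hi] using h1 i hi
      · simpa [horizontal, h.lower i hi] using (h2 i hi).2

theorem weight_elim (X : MarkedDiagram r) (a b : Fin r → Color r) :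
    X.weight (Sum.elim a b) =
      (∏ i ∈ X.upperMarks, (a i).eigen) * ∏ i ∈ X.lowerMarks, (b i).eigen := by
  rw [weight, Fintype.prod_sum_type, upperMarks, lowerMarks, Finset.prod_filter,
    Finset.prod_filter]
  congr 1
  · refine Finset.prod_congr rfl fun i _ => ?_
    cases X.marked (Sum.inl i) <;> simp
  · refine Finset.prod_congr rfl fun i _ => ?_
    cases X.marked (Sum.inr i) <;> simp

/-- The monomial that stands for a diagram acts like the diagram. -/
theorem normal_operatorSystem {X : MarkedDiagram r} {π p : Perm (Fin r)}
    (h : X.IsProduct π p) : (operatorSystem r).normal X π p = X.op := by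
  classical
  refine end_ext fun f a => ?_
  rw [BrauerSystem.normal, Module.End.mul_apply, Module.End.mul_apply, Module.End.mul_apply,
    marker_operatorSystem_apply]
  change _ * permOp r π _ a = _
  rw [permOp_apply, cup_operatorSystem_apply h.involution, op, Matrix.toLin'_apply, Matrix.mulVec,
    dotProduct, Finset.mul_sum]
  refine Finset.sum_congr rfl fun b _ => ?_
  rw [marker_operatorSystem_apply, mat, kernel]
  simp only [h.consistent_iff]
  split_ifs
  · rw [weight_elim, mul_assoc]
  · rw [mul_zero, zero_mul]

theorem op_sigma (l : ℕ) (hl : 1 ≤ l ∧ l < r) :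
    (sigma l hl).op = permOp r (swap ⟨l - 1, by omega⟩ ⟨l, hl.2⟩) :=
  end_ext fun f a => by
    rw [sigma, DiagramAlgebra.op_ofPerm_apply, symm_swap, permOp_apply]

theorem op_diagJ (h : 0 < r) : (diagJ h).op = complexOp ⟨0, h⟩ := by
  have hX : (diagJ h).IsProduct 1 1 :=
    ⟨one_mul 1, fun _ _ => rfl, fun _ hi => absurd rfl hi, fun _ hi => absurd rfl hi⟩
  have hu : (diagJ h).upperMarks = ∅ := by
    ext
    simp [upperMarks, diagJ]
  have hl : (diagJ h).lowerMarks = insert ⟨0, h⟩ ∅ := by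
    ext
    simp [lowerMarks, diagJ]
  rw [← normal_operatorSystem hX, BrauerSystem.normal, hu, hl,
    BrauerSystem.marker_insert _ (Finset.notMem_empty _), BrauerSystem.marker_empty,
    BrauerSystem.cup_one, map_one, one_mul, one_mul, one_mul, mul_one]
  rfl

theorem op_diagC (h : 1 < r) : (diagC h).op = contractOp ⟨0, by omega⟩ ⟨1, h⟩ := by
  have h01 : (⟨0, by omega⟩ : Fin r) ≠ ⟨1, h⟩ := by simp
  have h0 : 0 < r := by omega
  have hX : (diagC h).IsProduct 1 (swap ⟨0, h0⟩ ⟨1, h⟩) := by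
    refine ⟨swap_mul_self _ _, fun i hi => ?_, fun i hi => ?_, fun i hi => ?_⟩
    all_goals
      rcases eq_or_ne i ⟨0, h0⟩ with rfl | hi0
      · simp_all [diagC]
      rcases eq_or_ne i ⟨1, h⟩ with rfl | hi1
      · simp_all [diagC]
    · simp [diagC, hi0, hi1]
    · exact absurd (swap_apply_of_ne_of_ne hi0 hi1) hi
    · exact absurd (swap_apply_of_ne_of_ne hi0 hi1) hi
  have hu : (diagC h).upperMarks = ∅ := by
    ext
    simp [upperMarks, diagC]
  have hl : (diagC h).lowerMarks = ∅ := by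
    ext
    simp [lowerMarks, diagC]
  rw [← normal_operatorSystem hX, BrauerSystem.normal, hu, hl, BrauerSystem.marker_empty,
    ← mul_one (swap _ _), ← BrauerSystem.c_mul_cup_of_fixed _ (one_mul 1) h01 rfl rfl,
    BrauerSystem.cup_one, map_one, one_mul, one_mul, mul_one, mul_one]
  rfl

end MarkedDiagram

end Operators

end UnitaryBrauer

namespace UnitaryBrauer

open Equiv

/-! ### From the generators and relations to a system -/

theorem pos_of_four_le {r : ℕ} (hr : 4 ≤ r) : 0 < r := by omega

theorem one_lt_of_four_le {r : ℕ} (hr : 4 ≤ r) : 1 < r := by omega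

/-- The elements `s l`, `J` and `c` satisfy the defining relations of the generators `σ_l`, `J_1`
and `c_{12}`, with parameter `x`. -/
structure SatisfiesRelations {k : Type*} [CommRing k] {A : Type*} [Ring A] [Algebra k A] {r : ℕ}
    (hr : 4 ≤ r) (x : k) (s : ∀ l, 1 ≤ l ∧ l < r → A) (J c : A) : Prop where
  sq : ∀ l hl, s l hl * s l hl = 1
  comm : ∀ l m hl hm, l + 2 ≤ m → s l hl * s m hm = s m hm * s l hl
  braid : ∀ l hl hl', s l hl * s (l + 1) hl' * s l hl = s (l + 1) hl' * s l hl * s (l + 1) hl'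
  J_sq : J * J = -1
  J_comm : ∀ l hl, 2 ≤ l → J * s l hl = s l hl * J
  J_swap : J * s 1 (by omega) * (J * s 1 (by omega)) * (J * s 1 (by omega) * (J * s 1 (by omega))) =
    1
  c_sq : c * c = x • c
  c_comm : ∀ l hl, 3 ≤ l → c * s l hl = s l hl * c
  c_swap : c * s 1 (by omega) = c
  swap_c : s 1 (by omega) * c = c
  c_swap_c : c * s 2 (by omega) * c = c
  c_J_c : c * J * c = 0
  J_c : s 1 (by omega) * J * c = -(J * c)
  c_J : c * (J * s 1 (by omega)) = -(c * J)
  J_c_comm : s 2 (by omega) * s 1 (by omega) * J * s 1 (by omega) * s 2 (by omega) * c =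
    c * s 2 (by omega) * s 1 (by omega) * J * s 1 (by omega) * s 2 (by omega)
  c_c_comm : c * s 2 (by omega) * s 1 (by omega) * s 3 (by omega) * s 2 (by omega) *
      c * s 2 (by omega) * s 3 (by omega) * s 1 (by omega) * s 2 (by omega) =
    s 2 (by omega) * s 1 (by omega) * s 3 (by omega) * s 2 (by omega) *
      c * s 2 (by omega) * s 3 (by omega) * s 1 (by omega) * s 2 (by omega) * c

section Symmetric

variable {r : ℕ}

theorem swap_braid {α : Type*} [DecidableEq α] {a b c : α} (h1 : a ≠ b) (h2 : a ≠ c)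
    (h3 : b ≠ c) : swap a b * swap b c * swap a b = swap b c * swap a b * swap b c := by
  have e1 := swap_mul_swap_mul_swap (x := a) (y := b) (z := c) h1 h2
  have e2 := swap_mul_swap_mul_swap (x := c) (y := b) (z := a) h3.symm h2.symm
  rw [swap_comm b a, swap_comm c b, swap_comm a c] at e2
  exact e2.trans e1.symm

theorem swap_swap_comm {α : Type*} [DecidableEq α] {a b c d : α} (h1 : a ≠ c) (h2 : a ≠ d)
    (h3 : b ≠ c) (h4 : b ≠ d) : swap a b * swap c d = swap c d * swap a b := by
  rw [mul_swap_eq_swap_mul, swap_apply_of_ne_of_ne h1.symm h3.symm,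
    swap_apply_of_ne_of_ne h2.symm h4.symm]

/-- A permutation with one more prescribed value. -/
theorem exists_perm_apply_eq {α : Type*} [DecidableEq α] (g : Perm α) (a b : α) :
    ∃ g' : Perm α, g' a = b ∧ ∀ z, z ≠ a → g z ≠ b → g' z = g z := by
  refine ⟨swap (g a) b * g, by rw [Perm.mul_apply, swap_apply_left], fun z h1 h2 => ?_⟩
  rw [Perm.mul_apply, swap_apply_of_ne_of_ne (fun h => h1 (g.injective h)) h2]

theorem exists_perm_two {α : Type*} [DecidableEq α] {a b i j : α} (hab : a ≠ b) (hij : i ≠ j) :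
    ∃ g : Perm α, g a = i ∧ g b = j := by
  obtain ⟨g, hg, _⟩ := exists_perm_apply_eq 1 a i
  obtain ⟨g', hg', h'⟩ := exists_perm_apply_eq g b j
  exact ⟨g', (h' a hab (by rwa [hg])).trans hg, hg'⟩

theorem exists_perm_three {α : Type*} [DecidableEq α] {a b c i j l : α} (hab : a ≠ b) (hac : a ≠ c)
    (hbc : b ≠ c) (hij : i ≠ j) (hil : i ≠ l) (hjl : j ≠ l) :
    ∃ g : Perm α, g a = i ∧ g b = j ∧ g c = l := by
  obtain ⟨g, hga, hgb⟩ := exists_perm_two hab hij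
  obtain ⟨g', hg', h'⟩ := exists_perm_apply_eq g c l
  exact ⟨g', (h' a hac (by rwa [hga])).trans hga, (h' b hbc (by rwa [hgb])).trans hgb, hg'⟩

theorem exists_perm_four {α : Type*} [DecidableEq α] {a b c d i j l m : α} (hab : a ≠ b)
    (hac : a ≠ c) (had : a ≠ d) (hbc : b ≠ c) (hbd : b ≠ d) (hcd : c ≠ d) (hij : i ≠ j)
    (hil : i ≠ l) (him : i ≠ m) (hjl : j ≠ l) (hjm : j ≠ m) (hlm : l ≠ m) :
    ∃ g : Perm α, g a = i ∧ g b = j ∧ g c = l ∧ g d = m := by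
  obtain ⟨g, hga, hgb, hgc⟩ := exists_perm_three hab hac hbc hij hil hjl
  obtain ⟨g', hg', h'⟩ := exists_perm_apply_eq g d m
  exact ⟨g', (h' a had (by rwa [hga])).trans hga, (h' b hbd (by rwa [hgb])).trans hgb,
    (h' c hcd (by rwa [hgc])).trans hgc, hg'⟩

/-- The transpositions of neighbours among `m, m + 1, …` generate all permutations that fix the
numbers below `m`. -/
theorem mem_of_swap_mem (H : Submonoid (Perm (Fin r))) (m : ℕ)
    (h : ∀ l (hl : l + 1 < r), m ≤ l → swap ⟨l, by omega⟩ ⟨l + 1, hl⟩ ∈ H) {π : Perm (Fin r)}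
    (hπ : ∀ i : Fin r, (i : ℕ) < m → π i = i) : π ∈ H := by
  have h1 : ∀ i j (hj : j < r) (hij : i < j), m ≤ i →
      swap (⟨i, by omega⟩ : Fin r) ⟨j, hj⟩ ∈ H := by
    intro i j hj hij hi
    induction j, hij using Nat.le_induction with
    | base => exact h i hj hi
    | succ j hij ih =>
      have e := swap_mul_swap_mul_swap (x := (⟨i, by omega⟩ : Fin r)) (y := ⟨j, by omega⟩)
        (z := ⟨j + 1, hj⟩) (by simp; omega) (by simp; omega)
      rw [swap_comm, ← e]
      exact mul_mem (mul_mem (h j hj (by omega)) (ih (by omega))) (h j hj (by omega))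
  have h2 : ∀ i j : Fin r, i ≠ j → m ≤ (i : ℕ) → m ≤ (j : ℕ) → swap i j ∈ H := by
    intro i j hij hi hj
    rcases Nat.lt_or_gt_of_ne (fun h => hij (Fin.ext h)) with h | h
    · exact h1 i j j.2 h hi
    · rw [swap_comm]
      exact h1 j i i.2 h hj
  induction hn : π.support.card using Nat.strong_induction_on generalizing π with
  | _ n ih =>
    by_cases hπ1 : π = 1
    · rw [hπ1]
      exact one_mem H
    obtain ⟨a, ha⟩ : ∃ a, π a ≠ a := by
      by_contra! h
      exact hπ1 (Equiv.ext h)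
    have ha1 : m ≤ (a : ℕ) := not_lt.1 fun h => ha (hπ a h)
    have ha2 : m ≤ (π a : ℕ) := not_lt.1 fun h => ha (π.injective (hπ _ h))
    rw [← swap_mul_self_mul a (π a) π]
    refine mul_mem (h2 _ _ ha.symm ha1 ha2) (ih _ ?_ (fun i hi => ?_) rfl)
    · rw [← hn]
      exact Perm.card_support_swap_mul ha
    · rw [Perm.mul_apply, hπ i hi, swap_apply_of_ne_of_ne] <;>
      · rintro rfl
        omega

end Symmetric

namespace BrauerSystem

variable {k : Type*} [CommRing k] {A : Type*} [Ring A] [Algebra k A] {r : ℕ} {x : k}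

/-- The elements of a system that correspond to the generators satisfy the defining relations. -/
theorem satisfiesRelations (B : BrauerSystem A r x) (hr : 4 ≤ r) :
    SatisfiesRelations hr x
      (fun l hl => B.perm (swap (⟨l - 1, by omega⟩ : Fin r) ⟨l, hl.2⟩))
      (B.J ⟨0, pos_of_four_le hr⟩) (B.c ⟨0, pos_of_four_le hr⟩ ⟨1, one_lt_of_four_le hr⟩) := by
  have h01 : (⟨0, pos_of_four_le hr⟩ : Fin r) ≠ ⟨1, one_lt_of_four_le hr⟩ := by simp
  have h02 : (⟨0, pos_of_four_le hr⟩ : Fin r) ≠ ⟨2, by omega⟩ := by simp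
  have h03 : (⟨0, pos_of_four_le hr⟩ : Fin r) ≠ ⟨3, by omega⟩ := by simp
  have h12 : (⟨1, one_lt_of_four_le hr⟩ : Fin r) ≠ ⟨2, by omega⟩ := by simp
  have h13 : (⟨1, one_lt_of_four_le hr⟩ : Fin r) ≠ ⟨3, by omega⟩ := by simp
  have h23 : (⟨2, by omega⟩ : Fin r) ≠ ⟨3, by omega⟩ := by simp
  set i0 : Fin r := ⟨0, pos_of_four_le hr⟩ with hi0
  set i1 : Fin r := ⟨1, one_lt_of_four_le hr⟩ with hi1
  set i2 : Fin r := ⟨2, by omega⟩ with hi2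
  set i3 : Fin r := ⟨3, by omega⟩ with hi3
  have hsq : ∀ i j, B.perm (swap i j) * B.perm (swap i j) = 1 := fun i j => by
    rw [← map_mul, swap_mul_self, map_one]
  have hsq' : ∀ i j a, B.perm (swap i j) * (B.perm (swap i j) * a) = a := fun i j a => by
    rw [← mul_assoc, hsq, one_mul]
  have hJ : B.perm (swap i0 i1) * B.J i0 = B.J i1 * B.perm (swap i0 i1) := by
    rw [B.perm_J, swap_apply_left]
  have hJ2 : B.perm (swap i1 i2) * B.J i1 = B.J i2 * B.perm (swap i1 i2) := by
    rw [B.perm_J, swap_apply_left]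
  refine ⟨?_, ?_, ?_, B.J_sq _, ?_, ?_, B.c_sq _ _ h01, ?_, B.c_swap _ _ h01, B.swap_c _ _ h01, ?_,
    B.c_J_c _ _ h01, ?_, ?_, ?_, ?_⟩
  · intro l hl
    exact hsq _ _
  · intro l m hl hm hlm
    rw [← map_mul, ← map_mul, swap_swap_comm] <;> simp only [ne_eq, Fin.mk.injEq] <;> omega
  · intro l hl hl'
    simp only [Nat.add_sub_cancel]
    rw [← map_mul, ← map_mul, ← map_mul, ← map_mul, swap_braid] <;>
      simp only [ne_eq, Fin.mk.injEq] <;> omega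
  · intro l hl h2
    rw [B.perm_J, swap_apply_of_ne_of_ne] <;> simp only [hi0, ne_eq, Fin.mk.injEq] <;> omega
  · change B.J i0 * B.perm (swap i0 i1) * (B.J i0 * B.perm (swap i0 i1)) *
      (B.J i0 * B.perm (swap i0 i1) * (B.J i0 * B.perm (swap i0 i1))) = 1
    have e : B.J i0 * B.perm (swap i0 i1) * (B.J i0 * B.perm (swap i0 i1)) =
        B.J i0 * B.J i1 := by
      rw [mul_assoc, ← mul_assoc (B.perm _), hJ, mul_assoc (B.J i1), hsq, mul_one]
    rw [e, mul_assoc, ← mul_assoc (B.J i1), B.J_comm i1 i0, mul_assoc (B.J i0), B.J_sq,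
      mul_neg_one, mul_neg, B.J_sq, neg_neg]
  · intro l hl h3
    rw [B.perm_c _ _ _ h01, swap_apply_of_ne_of_ne, swap_apply_of_ne_of_ne] <;>
      simp only [hi0, hi1, ne_eq, Fin.mk.injEq] <;> omega
  · change B.c i0 i1 * B.perm (swap i1 i2) * B.c i0 i1 = B.c i0 i1
    have e1 : B.perm (swap i1 i2) * B.c i0 i1 = B.c i0 i2 * B.perm (swap i1 i2) := by
      rw [B.perm_c _ _ _ h01, swap_apply_left, swap_apply_of_ne_of_ne h01 h02]
    have e2 : B.perm (swap i1 i2) * B.c i0 i2 = B.c i0 i1 * B.perm (swap i1 i2) := by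
      rw [B.perm_c _ _ _ h02, swap_apply_right, swap_apply_of_ne_of_ne h01 h02]
    rw [mul_assoc, e1, ← mul_assoc, B.c_symm h01, B.c_mul_c _ _ _ h01.symm h02 h12, e2, mul_assoc,
      hsq, mul_one, B.c_symm h01]
  · change B.perm (swap i0 i1) * B.J i0 * B.c i0 i1 = _
    rw [hJ, mul_assoc, B.swap_c _ _ h01, B.J_c _ _ h01, neg_neg]
  · change B.c i0 i1 * (B.J i0 * B.perm (swap i0 i1)) = _
    have e : B.perm (swap i0 i1) * B.J i1 = B.J i0 * B.perm (swap i0 i1) := by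
      rw [B.perm_J, swap_apply_right]
    rw [← e, ← mul_assoc, B.c_swap _ _ h01, B.c_J _ _ h01, neg_neg]
  · change B.perm (swap i1 i2) * B.perm (swap i0 i1) * B.J i0 * B.perm (swap i0 i1) *
      B.perm (swap i1 i2) * B.c i0 i1 = B.c i0 i1 * B.perm (swap i1 i2) * B.perm (swap i0 i1) *
        B.J i0 * B.perm (swap i0 i1) * B.perm (swap i1 i2)
    have e : B.perm (swap i1 i2) * (B.perm (swap i0 i1) * (B.J i0 * (B.perm (swap i0 i1) *
        B.perm (swap i1 i2)))) = B.J i2 := by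
      rw [← mul_assoc (B.perm (swap i0 i1)), hJ, mul_assoc (B.J i1), hsq', ← mul_assoc, hJ2,
        mul_assoc, hsq, mul_one]
    simp only [mul_assoc]
    rw [e]
    simp only [← mul_assoc] at e ⊢
    rw [e, B.J_c_comm _ _ _ h01 h02.symm h12.symm]
  · change B.c i0 i1 * B.perm (swap i1 i2) * B.perm (swap i0 i1) * B.perm (swap i2 i3) *
      B.perm (swap i1 i2) * B.c i0 i1 * B.perm (swap i1 i2) * B.perm (swap i2 i3) *
      B.perm (swap i0 i1) * B.perm (swap i1 i2) =
      B.perm (swap i1 i2) * B.perm (swap i0 i1) * B.perm (swap i2 i3) *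
      B.perm (swap i1 i2) * B.c i0 i1 * B.perm (swap i1 i2) * B.perm (swap i2 i3) *
      B.perm (swap i0 i1) * B.perm (swap i1 i2) * B.c i0 i1
    have e : B.perm (swap i1 i2) * (B.perm (swap i0 i1) * (B.perm (swap i2 i3) *
        (B.perm (swap i1 i2) * (B.c i0 i1 * (B.perm (swap i1 i2) * (B.perm (swap i2 i3) *
        (B.perm (swap i0 i1) * B.perm (swap i1 i2)))))))) = B.c i2 i3 := by
      have e1 : B.perm (swap i1 i2 * swap i0 i1 * swap i2 i3 * swap i1 i2) * B.c i0 i1 =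
          B.c i2 i3 * B.perm (swap i1 i2 * swap i0 i1 * swap i2 i3 * swap i1 i2) := by
        rw [B.perm_c _ _ _ h01]
        congr 2
      rw [map_mul, map_mul, map_mul] at e1
      simp only [mul_assoc] at e1
      rw [← mul_assoc (B.perm (swap i1 i2)) (B.c i0 i1), ← mul_assoc (B.perm (swap i2 i3)),
        ← mul_assoc (B.perm (swap i0 i1)), ← mul_assoc (B.perm (swap i1 i2)), e1]
      simp only [mul_assoc, hsq', hsq, mul_one]
    simp only [mul_assoc]
    rw [e]
    simp only [← mul_assoc] at e ⊢
    rw [e, B.c_comm _ _ _ _ h01 h23 h02 h03 h12 h13]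

end BrauerSystem

end UnitaryBrauer

namespace UnitaryBrauer

open Equiv

namespace SatisfiesRelations

variable {k : Type*} [CommRing k] {A : Type*} [Ring A] [Algebra k A] {r : ℕ} {hr : 4 ≤ r} {x : k}
  {s : ∀ l, 1 ≤ l ∧ l < r → A} {J c : A}

theorem isCoxeter (h : SatisfiesRelations hr x s J c) :
    IsCoxeter r (fun l => if hl : l + 1 < r then s (l + 1) ⟨by omega, hl⟩ else 1) where
  sq l hl := by
    rw [dif_pos hl, h.sq]
  comm l m hlm hm := by
    rw [dif_pos (show l + 1 < r by omega), dif_pos hm, h.comm _ _ _ _ (by omega)]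
  braid l hl := by
    rw [dif_pos (show l + 1 < r by omega), dif_pos (show l + 1 + 1 < r by omega), h.braid]

/-- The action of the symmetric group. -/
noncomputable def perm (h : SatisfiesRelations hr x s J c) : Perm (Fin r) →* A := h.isCoxeter.hom

variable (h : SatisfiesRelations hr x s J c)

theorem perm_swap_neighbours {l : ℕ} (hl : l + 1 < r) :
    h.perm (swap ⟨l, by omega⟩ ⟨l + 1, hl⟩) = s (l + 1) ⟨by omega, hl⟩ := by
  rw [perm, IsCoxeter.hom_swap _ hl, dif_pos hl]

/-- The permutations whose images commute with an element. -/
noncomputable def commuting (a : A) : Submonoid (Perm (Fin r)) :=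
  (Submonoid.centralizer {a}).comap h.perm

theorem mem_commuting {a : A} {π : Perm (Fin r)} :
    π ∈ h.commuting a ↔ a * h.perm π = h.perm π * a := by
  rw [commuting, Submonoid.mem_comap, Submonoid.mem_centralizer_iff]
  simp

theorem perm_mul_J {π : Perm (Fin r)} (hπ : π ⟨0, pos_of_four_le hr⟩ = ⟨0, pos_of_four_le hr⟩) :
    J * h.perm π = h.perm π * J := by
  rw [← mem_commuting]
  refine mem_of_swap_mem _ 1 (fun l hl hl1 => ?_) (fun i hi => ?_)
  · rw [mem_commuting, h.perm_swap_neighbours hl, h.J_comm _ _ (by omega)]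
  · rwa [show i = ⟨0, pos_of_four_le hr⟩ from Fin.ext (by simpa using hi)]

theorem perm_mul_c {π : Perm (Fin r)} (h0 : π ⟨0, pos_of_four_le hr⟩ = ⟨0, pos_of_four_le hr⟩)
    (h1 : π ⟨1, one_lt_of_four_le hr⟩ = ⟨1, one_lt_of_four_le hr⟩) :
    c * h.perm π = h.perm π * c := by
  rw [← mem_commuting]
  refine mem_of_swap_mem _ 2 (fun l hl hl1 => ?_) (fun i hi => ?_)
  · rw [mem_commuting, h.perm_swap_neighbours hl, h.c_comm _ _ (by omega)]
  · rcases (show (i : ℕ) = 0 ∨ (i : ℕ) = 1 by omega) with hi | hi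
    · rwa [show i = ⟨0, pos_of_four_le hr⟩ from Fin.ext hi]
    · rwa [show i = ⟨1, one_lt_of_four_le hr⟩ from Fin.ext hi]

theorem perm_mul_perm_inv (π : Perm (Fin r)) : h.perm π * h.perm π⁻¹ = 1 := by
  rw [← map_mul, mul_inv_cancel, map_one]

theorem perm_mul_right_cancel (π : Perm (Fin r)) {a b : A} (hab : a * h.perm π = b * h.perm π) :
    a = b := by
  have := congrArg (· * h.perm π⁻¹) hab
  simpa only [mul_assoc, perm_mul_perm_inv, mul_one] using this

/-- The conjugate of `J` that belongs to the `i`-th strand. -/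
noncomputable def conjJ (i : Fin r) : A :=
  h.perm (swap ⟨0, pos_of_four_le hr⟩ i) * J * h.perm (swap ⟨0, pos_of_four_le hr⟩ i)⁻¹

theorem perm_mul_J_eq (π : Perm (Fin r)) :
    h.perm π * J = h.conjJ (π ⟨0, pos_of_four_le hr⟩) * h.perm π := by
  set τ := swap ⟨0, pos_of_four_le hr⟩ (π ⟨0, pos_of_four_le hr⟩) with hτ
  have e : J * h.perm (τ⁻¹ * π) = h.perm (τ⁻¹ * π) * J :=
    h.perm_mul_J (by rw [Perm.mul_apply, hτ, swap_inv, swap_apply_right])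
  rw [conjJ, ← hτ, mul_assoc _ (h.perm τ⁻¹), ← map_mul, mul_assoc, e, ← mul_assoc, ← map_mul,
    mul_inv_cancel_left]

theorem perm_mul_conjJ (π : Perm (Fin r)) (i : Fin r) :
    h.perm π * h.conjJ i = h.conjJ (π i) * h.perm π := by
  set τ := swap ⟨0, pos_of_four_le hr⟩ i with hτ
  have h0 : τ ⟨0, pos_of_four_le hr⟩ = i := swap_apply_left _ _
  refine h.perm_mul_right_cancel τ ?_
  have e := h.perm_mul_J_eq τ
  rw [h0] at e
  rw [mul_assoc, ← e, ← mul_assoc, ← map_mul, h.perm_mul_J_eq, Perm.mul_apply, h0, map_mul,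
    mul_assoc]

open Classical in
/-- The conjugate of `c` with horizontal edges between the `i`-th and the `j`-th vertices. -/
noncomputable def conjC (i j : Fin r) : A :=
  if hπ : ∃ π : Perm (Fin r), π ⟨0, pos_of_four_le hr⟩ = i ∧ π ⟨1, one_lt_of_four_le hr⟩ = j then
    h.perm hπ.choose * c * h.perm hπ.choose⁻¹ else 0

theorem perm_mul_c_eq (π : Perm (Fin r)) :
    h.perm π * c = h.conjC (π ⟨0, pos_of_four_le hr⟩) (π ⟨1, one_lt_of_four_le hr⟩) * h.perm π := by
  have hex : ∃ τ : Perm (Fin r), τ ⟨0, pos_of_four_le hr⟩ = π ⟨0, pos_of_four_le hr⟩ ∧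
      τ ⟨1, one_lt_of_four_le hr⟩ = π ⟨1, one_lt_of_four_le hr⟩ := ⟨π, rfl, rfl⟩
  rw [conjC, dif_pos hex]
  obtain ⟨e0, e1⟩ := hex.choose_spec
  set τ := hex.choose
  have e : c * h.perm (τ⁻¹ * π) = h.perm (τ⁻¹ * π) * c :=
    h.perm_mul_c (by rw [Perm.mul_apply, Perm.inv_eq_iff_eq, e0])
      (by rw [Perm.mul_apply, Perm.inv_eq_iff_eq, e1])
  rw [mul_assoc _ (h.perm τ⁻¹), ← map_mul, mul_assoc, e, ← mul_assoc, ← map_mul,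
    mul_inv_cancel_left]

theorem perm_mul_conjC (π : Perm (Fin r)) {i j : Fin r} (hij : i ≠ j) :
    h.perm π * h.conjC i j = h.conjC (π i) (π j) * h.perm π := by
  obtain ⟨τ, rfl, rfl⟩ := exists_perm_two
    (show (⟨0, pos_of_four_le hr⟩ : Fin r) ≠ ⟨1, one_lt_of_four_le hr⟩ by simp) hij
  refine h.perm_mul_right_cancel τ ?_
  rw [mul_assoc, ← h.perm_mul_c_eq, ← mul_assoc, ← map_mul, h.perm_mul_c_eq, Perm.mul_apply,
    Perm.mul_apply, map_mul, mul_assoc]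

theorem perm_mul_perm_swap (π : Perm (Fin r)) (i j : Fin r) :
    h.perm π * h.perm (swap i j) = h.perm (swap (π i) (π j)) * h.perm π := by
  rw [← map_mul, ← map_mul, mul_swap_eq_swap_mul]

theorem conjJ_zero : h.conjJ ⟨0, pos_of_four_le hr⟩ = J := by
  have := h.perm_mul_J_eq 1
  rw [map_one, one_mul, mul_one] at this
  exact this.symm

theorem conjC_zero_one : h.conjC ⟨0, pos_of_four_le hr⟩ ⟨1, one_lt_of_four_le hr⟩ = c := by
  have := h.perm_mul_c_eq 1
  rw [map_one, one_mul, mul_one] at this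
  exact this.symm

/-- The conjugates of the generators form a system. By conjugation, it suffices to check each of the
relations for the first few indices. -/
noncomputable def system : BrauerSystem A r x :=
  have h01 : (⟨0, pos_of_four_le hr⟩ : Fin r) ≠ ⟨1, one_lt_of_four_le hr⟩ := by simp
  have h02 : (⟨0, pos_of_four_le hr⟩ : Fin r) ≠ ⟨2, by omega⟩ := by simp
  have h03 : (⟨0, pos_of_four_le hr⟩ : Fin r) ≠ ⟨3, by omega⟩ := by simp
  have h12 : (⟨1, one_lt_of_four_le hr⟩ : Fin r) ≠ ⟨2, by omega⟩ := by simp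
  have h13 : (⟨1, one_lt_of_four_le hr⟩ : Fin r) ≠ ⟨3, by omega⟩ := by simp
  have h23 : (⟨2, by omega⟩ : Fin r) ≠ ⟨3, by omega⟩ := by simp
  have s1 : h.perm (swap ⟨0, pos_of_four_le hr⟩ ⟨1, one_lt_of_four_le hr⟩) = s 1 (by omega) :=
    h.perm_swap_neighbours (l := 0) (by omega)
  have s2 : h.perm (swap ⟨1, one_lt_of_four_le hr⟩ ⟨2, by omega⟩) = s 2 (by omega) :=
    h.perm_swap_neighbours (l := 1) (by omega)
  have s3 : h.perm (swap ⟨2, by omega⟩ ⟨3, by omega⟩) = s 3 (by omega) :=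
    h.perm_swap_neighbours (l := 2) (by omega)
  have hs1 : s 1 (by omega) * s 1 (by omega) = 1 := h.sq _ _
  have hs2 : s 2 (by omega) * s 2 (by omega) = 1 := h.sq _ _
  have hs3 : s 3 (by omega) * s 3 (by omega) = 1 := h.sq _ _
  have hs1' : ∀ a, s 1 (by omega) * (s 1 (by omega) * a) = a := fun a => by
    rw [← mul_assoc, hs1, one_mul]
  have hs2' : ∀ a, s 2 (by omega) * (s 2 (by omega) * a) = a := fun a => by
    rw [← mul_assoc, hs2, one_mul]
  have hs3' : ∀ a, s 3 (by omega) * (s 3 (by omega) * a) = a := fun a => by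
    rw [← mul_assoc, hs3, one_mul]
  have J1 : h.conjJ ⟨1, one_lt_of_four_le hr⟩ = s 1 (by omega) * J * s 1 (by omega) := by
    have e := h.perm_mul_J_eq (swap ⟨0, pos_of_four_le hr⟩ ⟨1, one_lt_of_four_le hr⟩)
    rw [swap_apply_left, s1] at e
    rw [e, mul_assoc, hs1, mul_one]
  have J2 : h.conjJ ⟨2, by omega⟩ =
      s 2 (by omega) * s 1 (by omega) * J * s 1 (by omega) * s 2 (by omega) := by
    have e := h.perm_mul_conjJ (swap ⟨1, one_lt_of_four_le hr⟩ ⟨2, by omega⟩)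
      ⟨1, one_lt_of_four_le hr⟩
    rw [swap_apply_left, s2, J1] at e
    have e' := congrArg (· * s 2 (by omega)) e
    simp only [mul_assoc, hs2, mul_one] at e'
    simp only [mul_assoc, e']
  have c12 : h.conjC ⟨1, one_lt_of_four_le hr⟩ ⟨2, by omega⟩ =
      s 1 (by omega) * s 2 (by omega) * c * s 2 (by omega) * s 1 (by omega) := by
    have e := h.perm_mul_c_eq
      (swap ⟨0, pos_of_four_le hr⟩ ⟨1, one_lt_of_four_le hr⟩ *
        swap ⟨1, one_lt_of_four_le hr⟩ ⟨2, by omega⟩)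
    rw [Perm.mul_apply, Perm.mul_apply, swap_apply_of_ne_of_ne h01 h02, swap_apply_left,
      swap_apply_left, swap_apply_of_ne_of_ne h02.symm h12.symm, map_mul, s1, s2] at e
    rw [e, mul_assoc, mul_assoc, mul_assoc, hs2', hs1, mul_one]
  have c23 : h.conjC ⟨2, by omega⟩ ⟨3, by omega⟩ =
      s 2 (by omega) * s 1 (by omega) * s 3 (by omega) * s 2 (by omega) *
        c * s 2 (by omega) * s 3 (by omega) * s 1 (by omega) * s 2 (by omega) := by
    have e1 := h.perm_mul_c_eq (swap ⟨1, one_lt_of_four_le hr⟩ ⟨2, by omega⟩ *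
      (swap ⟨0, pos_of_four_le hr⟩ ⟨1, one_lt_of_four_le hr⟩ * (swap ⟨2, by omega⟩ ⟨3, by omega⟩ *
        swap ⟨1, one_lt_of_four_le hr⟩ ⟨2, by omega⟩)))
    have e2 : ∀ i, (swap ⟨1, one_lt_of_four_le hr⟩ ⟨2, by omega⟩ *
      (swap ⟨0, pos_of_four_le hr⟩ ⟨1, one_lt_of_four_le hr⟩ * (swap ⟨2, by omega⟩ ⟨3, by omega⟩ *
        swap ⟨1, one_lt_of_four_le hr⟩ ⟨2, by omega⟩)) : Perm (Fin r)) i =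
      swap ⟨1, one_lt_of_four_le hr⟩ ⟨2, by omega⟩
      (swap ⟨0, pos_of_four_le hr⟩ ⟨1, one_lt_of_four_le hr⟩ (swap ⟨2, by omega⟩ ⟨3, by omega⟩
        (swap ⟨1, one_lt_of_four_le hr⟩ ⟨2, by omega⟩ i))) := fun _ => rfl
    rw [e2, e2, swap_apply_of_ne_of_ne h01 h02, swap_apply_of_ne_of_ne h02 h03, swap_apply_left,
      swap_apply_left, swap_apply_left,
      swap_apply_of_ne_of_ne h03.symm h13.symm, swap_apply_of_ne_of_ne h13.symm h23.symm,
      map_mul, map_mul, map_mul, s1, s2, s3] at e1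
    have e3 := congrArg
      (· * (s 2 (by omega) * s 3 (by omega) * s 1 (by omega) * s 2 (by omega))) e1
    simp only [mul_assoc, hs1', hs2', hs3', hs2, mul_one] at e3
    simp only [mul_assoc, e3]
  { perm := h.perm
    J := h.conjJ
    c := h.conjC
    perm_J := h.perm_mul_conjJ
    perm_c := fun π i j => h.perm_mul_conjC π
    J_sq := fun i => by
      obtain ⟨g, rfl, _⟩ := exists_perm_apply_eq 1 (⟨0, pos_of_four_le hr⟩ : Fin r) i
      refine h.perm_mul_right_cancel g ?_
      rw [mul_assoc, ← h.perm_mul_J_eq, ← mul_assoc, ← h.perm_mul_J_eq, mul_assoc, h.J_sq,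
        mul_neg_one, neg_one_mul]
    J_comm := fun i j => by
      rcases eq_or_ne i j with rfl | hij
      · rfl
      obtain ⟨g, rfl, rfl⟩ := exists_perm_two h01 hij
      refine h.perm_mul_right_cancel g ?_
      rw [mul_assoc, ← h.perm_mul_conjJ, ← mul_assoc, ← h.perm_mul_J_eq, mul_assoc (h.conjJ _),
        ← h.perm_mul_J_eq, ← mul_assoc, ← h.perm_mul_conjJ, mul_assoc, mul_assoc]
      congr 1
      -- `a = J * s 1 * J * s 1` and `b = s 1 * J * s 1 * J` satisfy `a * a = 1 = b * a`
      have e1 := h.J_swap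
      have e3 : s 1 (by omega) * J * (s 1 (by omega) * J) *
          (J * s 1 (by omega) * (J * s 1 (by omega))) = 1 := by
        simp only [mul_assoc]
        rw [← mul_assoc J J, h.J_sq, neg_one_mul, mul_neg, hs1', mul_neg, ← mul_assoc J J, h.J_sq,
          neg_one_mul, mul_neg, mul_neg, neg_neg, hs1]
      have e4 := left_inv_eq_right_inv e3 e1
      rw [J1]
      simp only [← mul_assoc] at e4 ⊢
      exact e4.symm
    c_sq := fun i j hij => by
      obtain ⟨g, rfl, rfl⟩ := exists_perm_two h01 hij
      refine h.perm_mul_right_cancel g ?_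
      rw [mul_assoc, ← h.perm_mul_c_eq, ← mul_assoc, ← h.perm_mul_c_eq, mul_assoc, h.c_sq,
        mul_smul_comm, smul_mul_assoc, h.perm_mul_c_eq]
    swap_c := fun i j hij => by
      obtain ⟨g, rfl, rfl⟩ := exists_perm_two h01 hij
      refine h.perm_mul_right_cancel g ?_
      rw [mul_assoc, ← h.perm_mul_c_eq, ← mul_assoc, ← h.perm_mul_perm_swap, mul_assoc, s1,
        h.swap_c]
    c_swap := fun i j hij => by
      obtain ⟨g, rfl, rfl⟩ := exists_perm_two h01 hij
      refine h.perm_mul_right_cancel g ?_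
      rw [mul_assoc, ← h.perm_mul_perm_swap, ← mul_assoc, ← h.perm_mul_c_eq, mul_assoc, s1,
        h.c_swap]
    c_mul_c := fun i j l hij hjl hil => by
      obtain ⟨g, rfl, rfl, rfl⟩ := exists_perm_three h01 h02 h12 hij hil hjl
      refine h.perm_mul_right_cancel g ?_
      rw [mul_assoc, ← h.perm_mul_conjC _ h12, ← mul_assoc, ← h.perm_mul_c_eq,
        mul_assoc _ _ (h.perm g), ← h.perm_mul_conjC _ h12, ← mul_assoc (h.perm (swap _ _)),
        ← h.perm_mul_perm_swap, mul_assoc, mul_assoc]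
      congr 1
      have e1 : h.perm (swap ⟨0, pos_of_four_le hr⟩ ⟨2, by omega⟩) =
          s 1 (by omega) * s 2 (by omega) * s 1 (by omega) := by
        have e := swap_mul_swap_mul_swap h12.symm h02.symm
        rw [swap_comm (⟨1, one_lt_of_four_le hr⟩ : Fin r) ⟨0, pos_of_four_le hr⟩,
          swap_comm (⟨2, by omega⟩ : Fin r) ⟨1, one_lt_of_four_le hr⟩] at e
        rw [← e, map_mul, map_mul, s1, s2]
      have e2 : c * (s 2 (by omega) * c) = c := by rw [← mul_assoc, h.c_swap_c]
      have e3 : c * s 1 (by omega) = c := h.c_swap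
      have e4 : s 1 (by omega) * c = c := h.swap_c
      rw [c12, e1]
      simp only [mul_assoc, hs1', hs2']
      rw [← mul_assoc c (s 1 _), e3, ← mul_assoc (s 2 _) c, ← mul_assoc c (s 2 _ * c), e2,
        ← mul_assoc (s 1 _) c, e4]
    c_J_c := fun i j hij => by
      obtain ⟨g, rfl, rfl⟩ := exists_perm_two h01 hij
      refine h.perm_mul_right_cancel g ?_
      rw [mul_assoc, ← h.perm_mul_c_eq, mul_assoc, ← mul_assoc _ (h.perm g), ← h.perm_mul_J_eq,
        ← mul_assoc, ← mul_assoc, ← h.perm_mul_c_eq, mul_assoc, mul_assoc, ← mul_assoc c, h.c_J_c,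
        mul_zero, zero_mul]
    J_c := fun i j hij => by
      obtain ⟨g, rfl, rfl⟩ := exists_perm_two h01 hij
      refine h.perm_mul_right_cancel g ?_
      rw [mul_assoc, ← h.perm_mul_c_eq, ← mul_assoc, ← h.perm_mul_J_eq, neg_mul,
        mul_assoc (h.conjJ _), ← h.perm_mul_c_eq, ← mul_assoc (h.conjJ _),
        ← h.perm_mul_conjJ, mul_assoc, mul_assoc,
        ← mul_neg]
      congr 1
      have e1 : s 1 (by omega) * J * c = -(J * c) := h.J_c
      have e2 : s 1 (by omega) * c = c := h.swap_c
      rw [J1, mul_assoc (s 1 _ * J), e2, e1, neg_neg]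
    c_J := fun i j hij => by
      obtain ⟨g, rfl, rfl⟩ := exists_perm_two h01 hij
      refine h.perm_mul_right_cancel g ?_
      rw [mul_assoc, ← h.perm_mul_J_eq, ← mul_assoc, ← h.perm_mul_c_eq, neg_mul,
        mul_assoc (h.conjC _ _), ← h.perm_mul_conjJ, ← mul_assoc (h.conjC _ _),
        ← h.perm_mul_c_eq, mul_assoc, mul_assoc,
        ← mul_neg]
      congr 1
      have e1 : c * (J * s 1 (by omega)) = -(c * J) := h.c_J
      have e2 : c * s 1 (by omega) = c := h.c_swap
      rw [J1, ← mul_assoc, ← mul_assoc, e2, mul_assoc, e1, neg_neg]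
    J_c_comm := fun i j l hij hli hlj => by
      obtain ⟨g, rfl, rfl, rfl⟩ := exists_perm_three h01 h02 h12 hij hli.symm hlj.symm
      refine h.perm_mul_right_cancel g ?_
      rw [mul_assoc, ← h.perm_mul_c_eq, ← mul_assoc, ← h.perm_mul_conjJ, mul_assoc (h.conjC _ _),
        ← h.perm_mul_conjJ, ← mul_assoc (h.conjC _ _), ← h.perm_mul_c_eq, mul_assoc, mul_assoc]
      congr 1
      rw [J2, h.J_c_comm]
      simp only [mul_assoc]
    c_comm := fun i j l m hij hlm hil him hjl hjm => by
      obtain ⟨g, rfl, rfl, rfl, rfl⟩ :=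
        exists_perm_four h01 h02 h03 h12 h13 h23 hij hil him hjl hjm hlm
      refine h.perm_mul_right_cancel g ?_
      rw [mul_assoc, ← h.perm_mul_conjC _ h23, ← mul_assoc, ← h.perm_mul_c_eq,
        mul_assoc (h.conjC (g ⟨2, _⟩) _), ← h.perm_mul_c_eq, ← mul_assoc (h.conjC (g ⟨2, _⟩) _),
        ← h.perm_mul_conjC _ h23, mul_assoc, mul_assoc]
      congr 1
      rw [c23, ← h.c_c_comm]
      simp only [mul_assoc] }

end SatisfiesRelations

end UnitaryBrauer

namespace UnitaryBrauer

open Equiv DiagramAlgebra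

/-! ### The homomorphism from the presented algebra to the diagram algebra -/

namespace DiagramAlgebra

variable {r : ℕ}

theorem specializes_sigma (l : ℕ) (hl : 1 ≤ l ∧ l < r) :
    Specializes (basis r (MarkedDiagram.sigma l hl))
      ((operatorSystem r).perm (swap ⟨l - 1, by omega⟩ ⟨l, hl.2⟩)) := by
  change Specializes _ (permOp r _)
  rw [← MarkedDiagram.op_sigma]
  exact specializes_basis _

theorem specializes_diagJ (h : 0 < r) :
    Specializes (basis r (MarkedDiagram.diagJ h)) ((operatorSystem r).J ⟨0, h⟩) := by
  change Specializes _ (complexOp _)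
  rw [← MarkedDiagram.op_diagJ]
  exact specializes_basis _

theorem specializes_diagC (h : 1 < r) :
    Specializes (basis r (MarkedDiagram.diagC h))
      ((operatorSystem r).c ⟨0, by omega⟩ ⟨1, h⟩) := by
  change Specializes _ (contractOp _ _)
  rw [← MarkedDiagram.op_diagC]
  exact specializes_basis _

/-- The basis diagrams satisfy the relations because their operators do. -/
theorem satisfiesRelations [NeZero r] (hr : 4 ≤ r) :
    SatisfiesRelations hr (RatFunc.X : RatFunc ℝ)
      (fun l hl => basis r (MarkedDiagram.sigma l hl))
      (basis r (MarkedDiagram.diagJ (pos_of_four_le hr)))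
      (basis r (MarkedDiagram.diagC (one_lt_of_four_le hr))) := by
  have H := (operatorSystem r).satisfiesRelations hr
  have hs := specializes_sigma (r := r)
  have hJ := specializes_diagJ (r := r) (by omega)
  have hc := specializes_diagC (r := r) (by omega)
  have huniq : ∀ {d d' : DiagramAlgebra r} {m m' : Module.End ℂ ((Fin r → Color r) → ℂ)},
      Specializes d m → Specializes d' m' → m = m' → d = d' := by
    rintro d d' m _ h h' rfl
    exact h.unique h'
  have h1 := hs 1 (by omega)
  have h2 := hs 2 (by omega)
  have h3 := hs 3 (by omega)
  constructor
  · exact fun l hl => huniq ((hs l hl).mul' (hs l hl)) specializes_one (H.sq l hl)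
  · exact fun l m hl hm h => huniq ((hs l hl).mul' (hs m hm)) ((hs m hm).mul' (hs l hl))
      (H.comm l m hl hm h)
  · exact fun l hl hl' => huniq (((hs l hl).mul' (hs _ hl')).mul' (hs l hl))
      (((hs _ hl').mul' (hs l hl)).mul' (hs _ hl')) (H.braid l hl hl')
  · exact huniq (hJ.mul' hJ) specializes_one.neg H.J_sq
  · exact fun l hl h => huniq (hJ.mul' (hs l hl)) ((hs l hl).mul' hJ) (H.J_comm l hl h)
  · have h := (hJ.mul' h1).mul' (hJ.mul' h1)
    exact huniq (h.mul' h) specializes_one H.J_swap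
  · exact huniq (hc.mul' hc) hc.smul H.c_sq
  · exact fun l hl h => huniq (hc.mul' (hs l hl)) ((hs l hl).mul' hc) (H.c_comm l hl h)
  · exact huniq (hc.mul' h1) hc H.c_swap
  · exact huniq (h1.mul' hc) hc H.swap_c
  · exact huniq ((hc.mul' h2).mul' hc) hc H.c_swap_c
  · exact huniq ((hc.mul' hJ).mul' hc) specializes_zero H.c_J_c
  · exact huniq ((h1.mul' hJ).mul' hc) (hJ.mul' hc).neg H.J_c
  · exact huniq (hc.mul' (hJ.mul' h1)) (hc.mul' hJ).neg H.c_J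
  · exact huniq (((((h2.mul' h1).mul' hJ).mul' h1).mul' h2).mul' hc)
      (((((hc.mul' h2).mul' h1).mul' hJ).mul' h1).mul' h2) H.J_c_comm
  · have h := ((h2.mul' h1).mul' h3).mul' h2
    exact huniq (((((((((hc.mul' h2).mul' h1).mul' h3).mul' h2).mul' hc).mul' h2).mul' h3).mul'
      h1).mul' h2) (((((h.mul' hc).mul' h2).mul' h3).mul' h1).mul' h2 |>.mul' hc) H.c_c_comm

end DiagramAlgebra

section Presented

variable {r : ℕ} {hr : 4 ≤ r}

namespace SatisfiesRelations

variable {A : Type*} [Ring A] [Algebra (RatFunc ℝ) A] {s : ∀ l, 1 ≤ l ∧ l < r → A} {J c : A}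

/-- The homomorphism out of the presented algebra given by elements that satisfy the relations. -/
noncomputable def lift (h : SatisfiesRelations hr (RatFunc.X : RatFunc ℝ) s J c) :
    PresentedAlgebra r hr →ₐ[RatFunc ℝ] A :=
  RingQuot.liftAlgHom (RatFunc ℝ) ⟨FreeAlgebra.lift (RatFunc ℝ) fun
    | Gen.sigma l hl => s l hl
    | Gen.J => J
    | Gen.c => c, fun a b hab => by
    have hpow : ∀ y : A, y ^ 4 = y * y * (y * y) := fun y => by
      rw [← pow_two, ← pow_two, ← pow_mul]
    cases hab with
    | i l hl => simpa [fσ, pow_two] using h.sq l hl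
    | ii l m hl hm hlm =>
      rcases le_total l m with hle | hle
      · have : l + 2 ≤ m := by rw [abs_of_nonpos (by omega)] at hlm; omega
        simpa [fσ] using h.comm l m hl hm this
      · have : m + 2 ≤ l := by rw [abs_of_nonneg (by omega)] at hlm; omega
        simpa [fσ] using (h.comm m l hm hl this).symm
    | iii l hl hl' =>
      have e := congrArg (· * (s (l + 1) hl' * s l hl * s (l + 1) hl')) (h.braid l hl hl')
      have e' : s (l + 1) hl' * s l hl * s (l + 1) hl' * (s (l + 1) hl' * s l hl * s (l + 1) hl') =
          1 := by
        simp only [mul_assoc]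
        rw [← mul_assoc (s (l + 1) hl') (s (l + 1) hl'), h.sq, one_mul,
          ← mul_assoc (s l hl) (s l hl), h.sq, one_mul, h.sq]
      have e'' : (s l hl * s (l + 1) hl') ^ 3 = 1 := by
        rw [← e', ← e, pow_succ, pow_two]
        simp only [mul_assoc]
      simpa [fσ] using e''
    | iv => simpa [fJ, pow_two] using h.J_sq
    | v l hl h2 => simpa [fσ, fJ] using h.J_comm l hl h2
    | vi => simpa [fσ, fJ, hpow] using h.J_swap
    | vii => simpa [fc, pow_two] using h.c_sq
    | viii l hl h3 => simpa [fσ, fc] using h.c_comm l hl h3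
    | ix_left => simpa [fσ, fc] using h.c_swap
    | ix_right => simpa [fσ, fc] using h.swap_c.symm
    | x => simpa [fσ, fc] using h.c_swap_c
    | xi => simpa [fJ, fc] using h.c_J_c
    | xii_left => simp [fσ, fJ, fc, add_mul, h.J_c]
    | xii_right => simp [fσ, fJ, fc, mul_add, h.c_J]
    | xiii => simpa [fσ, fJ, fc] using h.J_c_comm
    | xiv => simpa [fσ, fc] using h.c_c_comm⟩

variable (h : SatisfiesRelations hr (RatFunc.X : RatFunc ℝ) s J c)

theorem lift_sigma (l : ℕ) (hl : 1 ≤ l ∧ l < r) :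
    h.lift (toPresented r hr (fσ l hl)) = s l hl := by
  simp [lift, toPresented, fσ]

theorem lift_J : h.lift (toPresented r hr (fJ r)) = J := by
  simp [lift, toPresented, fJ]

theorem lift_c : h.lift (toPresented r hr (fc r)) = c := by
  simp [lift, toPresented, fc]

end SatisfiesRelations

theorem toPresented_eq {a b : FreeAlgebra (RatFunc ℝ) (Gen r)} (h : Rel r hr a b) :
    toPresented r hr a = toPresented r hr b :=
  RingQuot.mkAlgHom_rel (RatFunc ℝ) h

/-- The generators of the presented algebra satisfy the relations. -/
theorem satisfiesRelations_presented :
    SatisfiesRelations hr (RatFunc.X : RatFunc ℝ) (fun l hl => toPresented r hr (fσ l hl))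
      (toPresented r hr (fJ r)) (toPresented r hr (fc r)) := by
  have hsq : ∀ l hl, toPresented r hr (fσ l hl) * toPresented r hr (fσ l hl) = 1 := fun l hl => by
    have := toPresented_eq (Rel.i (hr := hr) l hl)
    rwa [map_pow, map_one, pow_two] at this
  constructor
  · exact hsq
  · intro l m hl hm hlm
    have := toPresented_eq (Rel.ii (hr := hr) l m hl hm
      (by rw [abs_of_nonpos (by omega)]; omega))
    simpa using this
  · intro l hl hl'
    have := toPresented_eq (Rel.iii (hr := hr) l hl hl')
    rw [map_pow, map_one, map_mul, pow_succ, pow_two] at this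
    set a := toPresented r hr (fσ l hl)
    set b := toPresented r hr (fσ (l + 1) hl')
    have e : a * b * a * (b * a * b) = 1 := by simpa only [mul_assoc] using this
    have e' : b * a * b * (b * a * b) = 1 := by
      rw [mul_assoc, ← mul_assoc b, ← mul_assoc b, hsq, one_mul, mul_assoc, ← mul_assoc a, hsq,
        one_mul, hsq]
    exact left_inv_eq_right_inv e e'
  · simpa [pow_two] using toPresented_eq (Rel.iv (hr := hr))
  · exact fun l hl h => by simpa using toPresented_eq (Rel.v (hr := hr) l hl h)
  · have := toPresented_eq (Rel.vi (hr := hr))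
    rw [map_pow, map_one, map_mul, pow_mul (m := 2) (n := 2), pow_two, pow_two] at this
    exact this
  · simpa [pow_two] using toPresented_eq (Rel.vii (hr := hr))
  · exact fun l hl h => by simpa using toPresented_eq (Rel.viii (hr := hr) l hl h)
  · simpa using toPresented_eq (Rel.ix_left (hr := hr))
  · simpa using (toPresented_eq (Rel.ix_right (hr := hr))).symm
  · simpa using toPresented_eq (Rel.x (hr := hr))
  · simpa using toPresented_eq (Rel.xi (hr := hr))
  · have := toPresented_eq (Rel.xii_left (hr := hr))
    rw [map_zero, map_mul, map_add, map_mul, add_mul] at this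
    exact eq_neg_of_add_eq_zero_left this
  · have := toPresented_eq (Rel.xii_right (hr := hr))
    rw [map_zero, map_mul, map_add, map_mul, mul_add] at this
    exact eq_neg_of_add_eq_zero_right this.symm
  · simpa using toPresented_eq (Rel.xiii (hr := hr))
  · simpa using toPresented_eq (Rel.xiv (hr := hr))

theorem adjoin_generators : Algebra.adjoin (RatFunc ℝ)
    (Set.range fun g : Gen r => toPresented r hr (FreeAlgebra.ι (RatFunc ℝ) g)) = ⊤ := by
  rw [Set.range_comp' (toPresented r hr), ← AlgHom.map_adjoin, FreeAlgebra.adjoin_range_ι,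
    Algebra.map_top, AlgHom.range_eq_top]
  exact RingQuot.mkAlgHom_surjective _ _

/-- The system in the presented algebra. -/
noncomputable def presentedSystem (r : ℕ) (hr : 4 ≤ r) :
    BrauerSystem (PresentedAlgebra r hr) r (RatFunc.X : RatFunc ℝ) :=
  satisfiesRelations_presented.system

theorem span_monomials_presentedSystem :
    Submodule.span (RatFunc ℝ) (presentedSystem r hr).monomials = ⊤ := by
  refine BrauerSystem.span_monomials_eq_top _ adjoin_generators ?_
  rintro _ ⟨l | _ | _, rfl⟩
  · rename_i hl
    obtain ⟨l, rfl⟩ : ∃ l', l = l' + 1 := ⟨l - 1, by omega⟩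
    exact Or.inl ⟨_, (satisfiesRelations_presented.perm_swap_neighbours hl.2).symm⟩
  · exact Or.inr (Or.inl ⟨_, satisfiesRelations_presented.conjJ_zero.symm⟩)
  · exact Or.inr (Or.inr ⟨_, _, by simp, satisfiesRelations_presented.conjC_zero_one.symm⟩)

end Presented

namespace BrauerSystem

theorem J_apply {k : Type*} [CommRing k] {A : Type*} [Ring A] [Algebra k A] {r : ℕ} {x : k}
    (B : BrauerSystem A r x) (π : Perm (Fin r)) (i : Fin r) :
    B.J (π i) = B.perm π * B.J i * B.perm π⁻¹ := by
  rw [B.perm_J, mul_assoc, ← map_mul, mul_inv_cancel, map_one, mul_one]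

theorem c_apply {k : Type*} [CommRing k] {A : Type*} [Ring A] [Algebra k A] {r : ℕ} {x : k}
    (B : BrauerSystem A r x) (π : Perm (Fin r)) {i j : Fin r} (hij : i ≠ j) :
    B.c (π i) (π j) = B.perm π * B.c i j * B.perm π⁻¹ := by
  rw [B.perm_c _ _ _ hij, mul_assoc, ← map_mul, mul_inv_cancel, map_one, mul_one]

section Specializes

variable {r : ℕ} [NeZero r] {A : Type*} [Ring A] [Algebra (RatFunc ℝ) A] {x : RatFunc ℝ}
  {B : BrauerSystem A r x} {f : A →ₐ[RatFunc ℝ] DiagramAlgebra r}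

theorem specializes_cup
    (hc : ∀ i j, i ≠ j → Specializes (f (B.c i j)) ((operatorSystem r).c i j)) :
    ∀ n (p : Perm (Fin r)), p * p = 1 → p.support.card = n →
      Specializes (f (B.cup p)) ((operatorSystem r).cup p) := by
  intro n
  induction n using Nat.strong_induction_on with
  | _ n ih =>
    rintro p hp rfl
    by_cases h : ∃ i, p i ≠ i
    · obtain ⟨i, hi⟩ := h
      rw [cup_eq_c_mul _ hp hi, cup_eq_c_mul _ hp hi, map_mul]
      refine (hc _ _ hi.symm).mul' (ih _ ?_ _ (swap_mul_involution_of_moved hp) rfl)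
      exact Perm.card_support_swap_mul hi
    · push Not at h
      obtain rfl : p = 1 := Equiv.ext h
      rw [cup_one, cup_one, map_one]
      exact specializes_one

theorem specializes_marker
    (hJ : ∀ i, Specializes (f (B.J i)) ((operatorSystem r).J i)) (s : Finset (Fin r)) :
    Specializes (f (B.marker s)) ((operatorSystem r).marker s) := by
  induction s using Finset.induction_on with
  | empty =>
    rw [marker_empty, marker_empty, map_one]
    exact specializes_one
  | insert i s hi ih =>
    rw [marker_insert _ hi, marker_insert _ hi, map_mul]
    exact (hJ i).mul' ih

/-- A homomorphism to the diagram algebra that is correct on generators maps the normal form of a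
diagram to this diagram. -/
theorem map_normal
    (hs : ∀ l (hl : l + 1 < r), Specializes (f (B.perm (swap ⟨l, by omega⟩ ⟨l + 1, hl⟩)))
      ((operatorSystem r).perm (swap ⟨l, by omega⟩ ⟨l + 1, hl⟩)))
    {i₀ i₁ : Fin r} (hi : i₀ ≠ i₁)
    (hJ : Specializes (f (B.J i₀)) ((operatorSystem r).J i₀))
    (hc : Specializes (f (B.c i₀ i₁)) ((operatorSystem r).c i₀ i₁))
    {X : MarkedDiagram r} {π p : Perm (Fin r)} (hX : X.IsProduct π p) :
    f (B.normal X π p) = basis r X := by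
  have hperm : ∀ π, Specializes (f (B.perm π)) ((operatorSystem r).perm π) := fun π => by
    induction π using perm_induction with
    | one =>
      rw [map_one, map_one, map_one]
      exact specializes_one
    | mul l hl π ih =>
      rw [map_mul, map_mul, map_mul]
      exact (hs l hl).mul' ih
  have hJ' : ∀ i, Specializes (f (B.J i)) ((operatorSystem r).J i) := fun i => by
    obtain ⟨π, rfl, _⟩ := exists_perm_apply_eq 1 i₀ i
    rw [J_apply, J_apply, map_mul, map_mul]
    exact ((hperm π).mul' hJ).mul' (hperm π⁻¹)
  have hc' : ∀ i j, i ≠ j → Specializes (f (B.c i j)) ((operatorSystem r).c i j) := by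
    intro i j hij
    obtain ⟨π, rfl, rfl⟩ := exists_perm_two hi hij
    rw [c_apply _ _ hi, c_apply _ _ hi, map_mul, map_mul]
    exact ((hperm π).mul' hc).mul' (hperm π⁻¹)
  refine Specializes.unique ?_ (specializes_basis X)
  rw [← MarkedDiagram.normal_operatorSystem hX, normal, normal, map_mul, map_mul, map_mul]
  exact (((specializes_marker hJ' _).mul' (hperm π)).mul'
    (specializes_cup hc' _ p hX.involution rfl)).mul' (specializes_marker hJ' _)

end Specializes

end BrauerSystem

/-! ### The isomorphism -/

section Isomorphism

variable {r : ℕ} [NeZero r] {hr : 4 ≤ r}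

theorem lift_normal {X : MarkedDiagram r} {π p : Perm (Fin r)} (hX : X.IsProduct π p) :
    (DiagramAlgebra.satisfiesRelations hr).lift ((presentedSystem r hr).normal X π p) =
      basis r X := by
  have h := DiagramAlgebra.satisfiesRelations hr
  refine BrauerSystem.map_normal (i₀ := ⟨0, pos_of_four_le hr⟩)
    (i₁ := ⟨1, one_lt_of_four_le hr⟩) ?_ (by simp) ?_ ?_ hX
  · intro l hl
    have e : (presentedSystem r hr).perm (swap ⟨l, by omega⟩ ⟨l + 1, hl⟩) = _ :=
      satisfiesRelations_presented.perm_swap_neighbours hl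
    rw [e, SatisfiesRelations.lift_sigma]
    exact specializes_sigma (l + 1) ⟨by omega, hl⟩
  · have e : (presentedSystem r hr).J ⟨0, pos_of_four_le hr⟩ = _ :=
      satisfiesRelations_presented.conjJ_zero
    rw [e, SatisfiesRelations.lift_J]
    exact specializes_diagJ (pos_of_four_le hr)
  · have e : (presentedSystem r hr).c ⟨0, pos_of_four_le hr⟩ ⟨1, one_lt_of_four_le hr⟩ = _ :=
      satisfiesRelations_presented.conjC_zero_one
    rw [e, SatisfiesRelations.lift_c]
    exact specializes_diagC (one_lt_of_four_le hr)

/-- The inverse maps a diagram to its normal form; it is surjective since the monomials, which are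
normal forms up to sign, span the presented algebra. -/
theorem lift_bijective : Function.Bijective
    (DiagramAlgebra.satisfiesRelations hr : SatisfiesRelations hr _ _ _ _).lift := by
  choose π p hX using fun X : MarkedDiagram r => X.exists_isProduct
  set B := presentedSystem r hr with hB
  set f := (DiagramAlgebra.satisfiesRelations hr : SatisfiesRelations hr _ _ _ _).lift with hf
  set g := (basis r).constr (RatFunc ℝ) fun X => B.normal X (π X) (p X) with hg
  have hfg : ∀ d, f (g d) = d := by
    have : f.toLinearMap ∘ₗ g = LinearMap.id := (basis r).ext fun X => by
      rw [LinearMap.comp_apply, hg, Module.Basis.constr_basis]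
      exact lift_normal (hX X)
    exact fun d => congrArg (fun F => F d) this
  have hsurj : Function.Surjective g := by
    rw [← LinearMap.range_eq_top, eq_top_iff, ← span_monomials_presentedSystem, Submodule.span_le]
    rintro _ ⟨u, hu, v, hv, τ, q, hq, rfl⟩
    obtain ⟨X, hX', h⟩ := BrauerSystem.isNormal_monomial hu hv (π := τ) hq
    have hmem : B.normal X τ q ∈ LinearMap.range g :=
      ⟨basis r X, by rw [hg, Module.Basis.constr_basis, BrauerSystem.normal_eq _ (hX X) hX']⟩
    rcases h with h | h
    · rw [h]
      exact hmem
    · rw [h]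
      exact neg_mem hmem
  refine ⟨fun a b hab => ?_, fun d => ⟨g d, hfg d⟩⟩
  obtain ⟨a, rfl⟩ := hsurj a
  obtain ⟨b, rfl⟩ := hsurj b
  rw [hfg, hfg] at hab
  rw [hab]

end Isomorphism

end UnitaryBrauer

open UnitaryBrauer in
theorem theorem4p3 (r : ℕ) (hr : 4 ≤ r) :
    (∀ a b c : DiagramAlgebra r, (a * b) * c = a * (b * c)) ∧
    (∀ a : DiagramAlgebra r, 1 * a = a ∧ a * 1 = a) ∧
    ∃ Φ : PresentedAlgebra r hr ≃ₗ[RatFunc ℝ] DiagramAlgebra r,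
      Φ 1 = 1 ∧
      (∀ a b : PresentedAlgebra r hr, Φ (a * b) = Φ a * Φ b) ∧
      (∀ (l : ℕ) (hl : 1 ≤ l ∧ l < r),
        Φ (toPresented r hr (fσ l hl)) = DiagramAlgebra.basis r (MarkedDiagram.sigma l hl)) ∧
      Φ (toPresented r hr (fJ r)) = DiagramAlgebra.basis r (MarkedDiagram.diagJ (by omega)) ∧
      Φ (toPresented r hr (fc r)) = DiagramAlgebra.basis r (MarkedDiagram.diagC (by omega)) := by
  have : NeZero r := ⟨by omega⟩
  have h := DiagramAlgebra.satisfiesRelations hr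
  exact ⟨DiagramAlgebra.mul_assoc', fun a => ⟨DiagramAlgebra.one_mul' a, DiagramAlgebra.mul_one' a⟩,
    LinearEquiv.ofBijective h.lift.toLinearMap lift_bijective, map_one h.lift, map_mul h.lift,
    h.lift_sigma, h.lift_J, h.lift_c⟩
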